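/- Consider a vertex of degree \(2n\) (\(n\ge 1\)) in the interior of a piece of paper, with consecutive angles \(\alpha_1,\dots,\alpha_{2n}>0\) between its creases \(l_1,\dots,l_{2n}\), where \(\alpha_i\) lies between \(l_i\) and \(l_{i+1}\), indices being read cyclically modulo \(2n\). The paper is flat (\(\sum\alpha_i=2\pi\)) or a cone with apex at the vertex (\(\sum\alpha_i<2\pi\)). A mountain-valley (MV) assignment, that is, a map from the creases to \(\{M,V\}\), is valid if it is realized by a flat folded state along all the creases in which the paper does not cross itself. The vertex is a flat vertex fold if it has at least one such flat folded state. Let \(C(\alpha_1,\dots,\alpha_{2n})\) be the number of valid MV assignments. Let \((\alpha_1,\dots,\alpha_{2n})\) be a flat vertex fold, and suppose that \(\alpha_i=\alpha_{i+1}=\cdots=\alpha_{i+k}\), \(\alpha_{i-1}>\alpha_i\) and \(\alpha_{i+k+1}>\alpha_{i+k}\) for some \(i\) and some \(k\ge 0\). If \(k\) is even, then \((\alpha_1,\dots,\alpha_{i-2},\ \alpha_{i-1}-\alpha_i+\alpha_{i+k+1},\ \alpha_{i+k+2},\dots,\alpha_{2n})\) is again a flat vertex fold and \[C(\alpha_1,\dots,\alpha_{2n})=\binom{k+2}{(k+2)/2}\,C(\alpha_1,\dots,\alpha_{i-2},\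 \alpha_{i-1}-\alpha_i+\alpha_{i+k+1},\ \alpha_{i+k+2},\dots,\alpha_{2n}).\] If \(k\) is odd, then \((\alpha_1,\dots,\alpha_{i-1},\alpha_{i+k+1},\dots,\alpha_{2n})\) is again a flat vertex fold and \[C(\alpha_1,\dots,\alpha_{2n})=\binom{k+2}{(k+1)/2}\,C(\alpha_1,\dots,\alpha_{i-1},\alpha_{i+k+1},\dots,\alpha_{2n}).\] Moreover, this recursion computes \(C\) for every flat vertex fold: apply these two reductions repeatedly, wherever they are applicable, multiplying by the binomial coefficients, until \(2m\) angles are left that are all equal, and multiply at the end by \(2\binom{2m}{m-1}\). At least one such sequence of reductions exists, and every such sequence yields the number \(C(\alpha_1,\dots,\alpha_{2n})\). -/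

import Mathlib

namespace FlatFold

/-- The two types of creases. -/
inductive MV where
  | mountain : MV
  | valley : MV

instance : Finite MV :=
  Finite.of_injective (fun x : MV => match x with | .mountain => true | .valley => false) (by
    intro x y h
    cases x <;> cases y <;> simp_all)

/-! A vertex of degree `m` is given by the list `α` of its `m` consecutive angles.  Sectors and
creases are numbered `0, …, m - 1`; sector `i` has angle `α[i]`, and crease `c` lies between the
sectors `c - 1` and `c` (crease `0` lies between the last sector and sector `0`).

When the paper is folded flat, each sector is mapped isometrically into the plane, consecutive
sectors being turned in opposite senses.  Measuring directions from the image of crease `0`, with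
sector `0` face up, the angular coordinate of crease `c` is the partial alternating sum of the
angles.  (The total angle being at most `2 * π`, the image spans an angle of at most `π`, so that
these coordinates can be taken in `ℝ` rather than modulo `2 * π`.)  Sectors with even number lie
face up and turn in the positive sense; those with odd number lie face down. -/

/-- The angular coordinate of crease `c` in the folded state. -/
noncomputable def creasePos (α : List ℝ) (c : ℕ) : ℝ :=
  ∑ i ∈ Finset.range c, (-1) ^ i * α.getD i 0

/-- The interior of the image of sector `i` in the folded state, as a set of directions. -/
def sectorImage (α : List ℝ) (i : ℕ) : Set ℝ :=
  Set.uIoo (creasePos α i) (creasePos α (i + 1))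

/-- The sector that precedes crease `c` cyclically; the one that follows it is sector `c`. -/
def prevSector (α : List ℝ) (c : ℕ) : ℕ := (c + α.length - 1) % α.length

/-- `x` lies between `a` and `b` (in either order) for the relation `below`. -/
def Between (below : ℕ → ℕ → Prop) (a b x : ℕ) : Prop :=
  (below a x ∧ below x b) ∨ (below b x ∧ below x a)

/-- `below` describes a flat folded state of the vertex `α` without self-intersection:
`below i j` says that sector `i` lies below sector `j` where they overlap. -/
structure IsFlatFolding (α : List ℝ) (below : ℕ → ℕ → Prop) : Prop where
  /-- The last sector ends where the first one starts. -/
  closed : creasePos α α.length = 0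
  /-- Of two overlapping layers exactly one is below the other. -/
  total : ∀ i < α.length, ∀ j < α.length, i ≠ j →
    (sectorImage α i ∩ sectorImage α j).Nonempty → (below i j ↔ ¬ below j i)
  /-- Over every direction the layers are linearly ordered. -/
  trans : ∀ i < α.length, ∀ j < α.length, ∀ k < α.length,
    (sectorImage α i ∩ sectorImage α j ∩ sectorImage α k).Nonempty →
    below i j → below j k → below i k
  /-- No layer passes through a crease. -/
  crease_sector : ∀ c < α.length, ∀ k < α.length, creasePos α c ∈ sectorImage α k →
    ¬ Between below (prevSector α c) c k
  /-- Two creases with the same image whose sectors lie on the same side of it do not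
  interlace: they are nested, or one is above the other.  (The sectors at crease `c` lie on the
  positive side of its image if `c` is even, on the negative side if `c` is odd.) -/
  crease_crease : ∀ c < α.length, ∀ d < α.length, c ≠ d → (Even c ↔ Even d) →
    creasePos α c = creasePos α d →
    (Between below (prevSector α c) c (prevSector α d) ↔ Between below (prevSector α c) c d)

/-- Crease `c` is a valley when the front sides of its two sectors face each other: the sector
that lies face up (the one with even number) is below the one that lies face down. -/
def IsValley (α : List ℝ) (below : ℕ → ℕ → Prop) (c : ℕ) : Prop :=
  (Even c ∧ below c (prevSector α c)) ∨ (¬ Even c ∧ below (prevSector α c) c)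

/-- A mountain-valley assignment is valid if some flat folded state realizes it. -/
def IsValid (α : List ℝ) (f : Fin α.length → MV) : Prop :=
  ∃ below : ℕ → ℕ → Prop, IsFlatFolding α below ∧
    ∀ c : Fin α.length, f c = MV.valley ↔ IsValley α below c

/-- The number of valid mountain-valley assignments. -/
noncomputable def C (α : List ℝ) : ℕ :=
  Nat.card {f : Fin α.length → MV // IsValid α f}

/-- `α` is the list of consecutive angles of a flat vertex fold of degree `2 * n`, `n ≥ 1`, on
flat paper (total angle `2 * π`) or at the apex of a cone (total angle less than `2 * π`). -/
structure IsFlatVertexFold (α : List ℝ) : Prop where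
  ne_nil : α ≠ []
  even_length : Even α.length
  pos : ∀ a ∈ α, 0 < a
  sum_le : α.sum ≤ 2 * Real.pi
  foldable : ∃ f : Fin α.length → MV, IsValid α f

/-- `RecursionGives α c`: the number `c` results from `α` by some run of the recursion, which at
each step replaces, anywhere in the cyclic sequence of angles, a run of `k + 1` equal angles
between two strictly larger ones, multiplying by the corresponding binomial coefficient, and
which ends when all the angles are equal. -/
inductive RecursionGives : List ℝ → ℕ → Prop where
  | all_equal (n : ℕ) (a : ℝ) (hn : 1 ≤ n) :
      RecursionGives (List.replicate (2 * n) a) (2 * (2 * n).choose (n - 1))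
  | even_step (k : ℕ) (x a y : ℝ) (t α β : List ℝ) (c : ℕ) (hk : Even k) (hx : a < x) (hy : a < y)
      (hα : α.IsRotated (x :: (List.replicate (k + 1) a ++ y :: t)))
      (hβ : β.IsRotated ((x - a + y) :: t)) (hc : RecursionGives β c) :
      RecursionGives α ((k + 2).choose ((k + 2) / 2) * c)
  | odd_step (k : ℕ) (x a y : ℝ) (t α β : List ℝ) (c : ℕ) (hk : Odd k) (hx : a < x) (hy : a < y)
      (hα : α.IsRotated (x :: (List.replicate (k + 1) a ++ y :: t)))
      (hβ : β.IsRotated (x :: y :: t)) (hc : RecursionGives β c) :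
      RecursionGives α ((k + 2).choose ((k + 1) / 2) * c)

end FlatFold

/-!
Everything rests on the crimp: if a sector is no larger than either of its neighbours and its two
creases have different types, then it can be folded away together with these creases, merging the
three sectors into one, and the types of the other creases are valid before exactly if they are
valid after (`valid_crimp`).  No strict inequality is needed, which is what allows crimps inside a
run of equal angles.

To see this, let `p`, `s`, `q` be the three sectors, `p` below `s` below `q`.  To undo a crimp, put
the three in the place of the merged sector (`Crimp.layered_uncrimp`).  To perform it, move the
layers between `s` and `q` to a place just below the merged sector and the layers between `p` and
`s` to a place just above it; all else stays in order (`Crimp.layered`).  The former do not pass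
over the crease of `s` and `q`, nor the latter over the crease of `p` and `s`, so that the two
groups meet only over `s`.  A crease that opens in the same direction as that of `s` and `q` has
both or none of its sectors between `s` and `q`; apart from a block that moves as a whole, such a
crease sees the old order with `p` as the merged sector.  The creases that open in the other
direction are treated by the mirror symmetry that exchanges `p` and `q`.

Crimps that cancel adjacent creases of different types reduce a run of equal angles between two
larger ones to a run all of whose creases have the same type.  Such a run with at least two creases
is impossible: the paper winds up in a spiral, and its inner end, being longer than the run's
sectors, pierces it (`IsStack.not_valleyRun`).  So either no crease is left, or a single one, of the
type of the majority (`valid_run_iff`); counting the sequences of types gives the binomial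
coefficients.  In the same way a vertex with equal angles is reduced to one whose creases are all of
the same type, which must have degree two (`IsStack.not_all_valleys`), so that validity means that
the numbers of mountains and valleys differ by two (`valid_map_iff`).

Finally, a run of minimal angles shows that a reduction applies as long as the angles are not all
equal: a single larger angle is excluded since the alternating sum of the angles vanishes.
-/

namespace FlatFold

section

/-! ### Layered intervals -/

/-- A noncrossing stack of open intervals `(lo i, hi i)`, some of which are joined at common
end points.  `R u v` says that `u` and `v` are joined at their left end points (the crease opens to
the right), `L u v` that they are joined at their right end points; `below` is the stacking
order, made irreflexive.  Indices that carry no interval are represented by `hi i ≤ lo i`. -/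
structure Layered (lo hi : ℕ → ℝ) (R L below : ℕ → ℕ → Prop) : Prop where
  irrefl : ∀ i, ¬ below i i
  total : ∀ i j z, i ≠ j → z ∈ Set.Ioo (lo i) (hi i) → z ∈ Set.Ioo (lo j) (hi j) →
    (below i j ↔ ¬ below j i)
  trans : ∀ i j k z, z ∈ Set.Ioo (lo i) (hi i) → z ∈ Set.Ioo (lo j) (hi j) →
    z ∈ Set.Ioo (lo k) (hi k) → below i j → below j k → below i k
  right_sector : ∀ u v k, R u v → lo u ∈ Set.Ioo (lo k) (hi k) → ¬ Between below u v k
  left_sector : ∀ u v k, L u v → hi u ∈ Set.Ioo (lo k) (hi k) → ¬ Between below u v k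
  right_right : ∀ u v u' v', R u v → R u' v' → lo u = lo u' →
    (Between below u v u' ↔ Between below u v v')
  left_left : ∀ u v u' v', L u v → L u' v' → hi u = hi u' →
    (Between below u v u' ↔ Between below u v v')

/-- The joined intervals are nonempty and share the end points at which they are joined; only
finitely many intervals are nonempty. -/
structure Joined (lo hi : ℕ → ℝ) (R L : ℕ → ℕ → Prop) : Prop where
  right : ∀ u v, R u v → lo u = lo v ∧ lo u < hi u ∧ lo v < hi v
  left : ∀ u v, L u v → hi u = hi v ∧ lo u < hi u ∧ lo v < hi v
  finite : {i | lo i < hi i}.Finite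

lemma between_flip (b : ℕ → ℕ → Prop) (u v k : ℕ) :
    Between (fun i j => b j i) u v k ↔ Between b u v k := by
  unfold Between; tauto

lemma between_comm (b : ℕ → ℕ → Prop) (u v k : ℕ) : Between b u v k ↔ Between b v u k := by
  unfold Between; tauto

variable {lo hi : ℕ → ℝ} {R L below : ℕ → ℕ → Prop}

/-- Turning the stack upside down. -/
lemma Layered.flip (h : Layered lo hi R L below) : Layered lo hi R L (fun i j => below j i) where
  irrefl := h.irrefl
  total i j z hij hi hj := h.total j i z hij.symm hj hi
  trans i j k z hi hj hk h1 h2 := h.trans k j i z hk hj hi h2 h1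
  right_sector u v k := by rw [between_flip]; exact h.right_sector u v k
  left_sector u v k := by rw [between_flip]; exact h.left_sector u v k
  right_right u v u' v' := by simp only [between_flip]; exact h.right_right u v u' v'
  left_left u v u' v' := by simp only [between_flip]; exact h.left_left u v u' v'

lemma neg_mem_Ioo_neg {a b z : ℝ} : -z ∈ Set.Ioo (-b) (-a) ↔ z ∈ Set.Ioo a b := by
  simp [Set.mem_Ioo, and_comm]

lemma mem_Ioo_neg {a b z : ℝ} : z ∈ Set.Ioo (-b) (-a) ↔ -z ∈ Set.Ioo a b := by
  rw [← neg_mem_Ioo_neg (a := a), neg_neg]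

/-- Turning the stack by a half turn, which exchanges left and right as well as up and down. -/
lemma Layered.mirror (h : Layered lo hi R L below) :
    Layered (fun i => -hi i) (fun i => -lo i) L R (fun i j => below j i) where
  irrefl := h.irrefl
  total i j z hij hi hj := h.flip.total i j (-z) hij (mem_Ioo_neg.1 hi) (mem_Ioo_neg.1 hj)
  trans i j k z hi hj hk :=
    h.flip.trans i j k (-z) (mem_Ioo_neg.1 hi) (mem_Ioo_neg.1 hj) (mem_Ioo_neg.1 hk)
  right_sector u v k hu hk := h.flip.left_sector u v k hu (neg_mem_Ioo_neg.1 hk)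
  left_sector u v k hu hk := h.flip.right_sector u v k hu (neg_mem_Ioo_neg.1 hk)
  right_right u v u' v' hu hv e := h.flip.left_left u v u' v' hu hv (neg_injective e)
  left_left u v u' v' hu hv e := h.flip.right_right u v u' v' hu hv (neg_injective e)

lemma Joined.mirror (h : Joined lo hi R L) :
    Joined (fun i => -hi i) (fun i => -lo i) L R where
  right u v huv := by simpa using h.left u v huv
  left u v huv := by simpa using h.right u v huv
  finite := by simpa using h.finite

/-- Over each point the stacking order is given by integer heights. -/
lemma Layered.exists_height (h : Layered lo hi R L below) (hJ : Joined lo hi R L) (z : ℝ) :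
    ∃ f : ℕ → ℕ, ∀ i j, z ∈ Set.Ioo (lo i) (hi i) → z ∈ Set.Ioo (lo j) (hi j) →
      (below i j ↔ f i < f j) ∧ (f i = f j → i = j) := by
  let S : ℕ → Set ℕ := fun i => {k | z ∈ Set.Ioo (lo k) (hi k) ∧ below k i}
  have hfin (i) : (S i).Finite :=
    hJ.finite.subset fun k hk => hk.1.1.trans hk.1.2
  have key : ∀ i j, z ∈ Set.Ioo (lo i) (hi i) → z ∈ Set.Ioo (lo j) (hi j) → below i j →
      (S i).ncard < (S j).ncard := by
    intro i j hi hj hij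
    refine Set.ncard_lt_ncard ⟨fun k hk => ⟨hk.1, h.trans k i j z hk.1 hi hj hk.2 hij⟩, ?_⟩ (hfin j)
    intro hs
    exact h.irrefl i (hs ⟨hi, hij⟩ : i ∈ S i).2
  refine ⟨fun i => (S i).ncard, fun i j hi hj => ?_⟩
  by_cases e : i = j
  · subst e; simp [h.irrefl]
  · have t := h.total i j z e hi hj
    by_cases b : below i j
    · have := key i j hi hj b
      exact ⟨iff_of_true b this, fun h => absurd h this.ne⟩
    · have b' : below j i := by tauto
      have := key j i hj hi b'
      exact ⟨iff_of_false b this.not_gt, fun h => absurd h this.ne'⟩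

/-! ### Crimping -/

/-- The combinatorics of crimping: `s` is joined with `p` at its right end and with `q` at its left
end and is no longer than these two.  The crimped family has one interval `N`, the union of `p`
and `q`, in place of the three; `ρ` and `ρ'` embed the new indices into the old ones, `N` being
represented by `p` in the first case and by `q` in the second.  The new joints `R'` and `L'` are
the old ones apart from those of `s`. -/
structure Crimp (lo hi : ℕ → ℝ) (R L : ℕ → ℕ → Prop) (p s q N : ℕ) (ρ ρ' : ℕ → ℕ)
    (R' L' : ℕ → ℕ → Prop) : Prop where
  lo_p : lo p ≤ lo s
  hi_p : hi p = hi s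
  lo_q : lo q = lo s
  hi_q : hi s ≤ hi q
  lt : lo s < hi s
  left : L p s ∨ L s p
  right : R s q ∨ R q s
  map_N : ρ N = p
  map_N' : ρ' N = q
  map_eq : ∀ i, i ≠ N → ρ' i = ρ i
  map_ne : ∀ i, i ≠ N → ρ i ≠ p ∧ ρ i ≠ s ∧ ρ i ≠ q
  inj : ∀ i j, i ≠ N → j ≠ N → ρ i = ρ j → i = j
  surj : ∀ i, i = p ∨ i = s ∨ i = q ∨ ∃ j, j ≠ N ∧ i = ρ j
  map_R : ∀ u v, R' u v → R (ρ u) (ρ v)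
  map_L : ∀ u v, L' u v → L (ρ' u) (ρ' v)
  surj_R : ∀ a b, R a b → (a = s ∧ b = q) ∨ (a = q ∧ b = s) ∨ ∃ u v, R' u v ∧ a = ρ u ∧ b = ρ v
  surj_L : ∀ a b, L a b → (a = p ∧ b = s) ∨ (a = s ∧ b = p) ∨
    ∃ u v, L' u v ∧ a = ρ' u ∧ b = ρ' v
  ne_ps : p ≠ s
  ne_sq : s ≠ q
  ne_pq : p ≠ q

variable {p s q N : ℕ} {ρ ρ' : ℕ → ℕ} {R' L' : ℕ → ℕ → Prop}

lemma Crimp.mirror (c : Crimp lo hi R L p s q N ρ ρ' R' L') :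
    Crimp (fun i => -hi i) (fun i => -lo i) L R q s p N ρ' ρ L' R' where
  lo_p := neg_le_neg c.hi_q
  hi_p := congrArg Neg.neg c.lo_q
  lo_q := congrArg Neg.neg c.hi_p
  hi_q := neg_le_neg c.lo_p
  lt := neg_lt_neg c.lt
  left := c.right.symm
  right := c.left.symm
  map_N := c.map_N'
  map_N' := c.map_N
  map_eq i hi := (c.map_eq i hi).symm
  map_ne i hi := by rw [c.map_eq i hi]; have := c.map_ne i hi; tauto
  inj i j hi hj := by rw [c.map_eq i hi, c.map_eq j hj]; exact c.inj i j hi hj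
  surj i := by
    rcases c.surj i with h | h | h | ⟨j, hj, h⟩
    · tauto
    · tauto
    · tauto
    · exact Or.inr (Or.inr (Or.inr ⟨j, hj, by rw [c.map_eq j hj]; exact h⟩))
  map_R := c.map_L
  map_L := c.map_R
  surj_R a b hab := by have := c.surj_L a b hab; tauto
  surj_L a b hab := by have := c.surj_R a b hab; tauto
  ne_ps := c.ne_sq.symm
  ne_sq := c.ne_ps.symm
  ne_pq := c.ne_pq.symm

/-- The interval `i` overlaps `s` and lies there between `a` and `b`. -/
def Inside (lo hi : ℕ → ℝ) (below : ℕ → ℕ → Prop) (s a b i : ℕ) : Prop :=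
  ∃ z ∈ Set.Ioo (lo s) (hi s), z ∈ Set.Ioo (lo i) (hi i) ∧ below a i ∧ below i b

/-- Two intervals overlap, and the first lies below the second. -/
def OverlapBelow (lo hi : ℕ → ℝ) (below : ℕ → ℕ → Prop) (i j : ℕ) : Prop :=
  (∃ z, z ∈ Set.Ioo (lo i) (hi i) ∧ z ∈ Set.Ioo (lo j) (hi j)) ∧ below i j

/-- The stacking order after crimping, for `p` below `s` below `q`: what was between `s` and `q`
moves to a place just below `N`, and what was between `p` and `s` moves to a place just above `N`.
Two intervals neither of which is between `s` and `q` are compared as before, `N` being represented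
by `p`; so are two intervals neither of which is between `p` and `s`, `N` being represented by
`q`. -/
def crimpBelow (lo hi : ℕ → ℝ) (below : ℕ → ℕ → Prop) (p s q : ℕ) (ρ ρ' : ℕ → ℕ)
    (i j : ℕ) : Prop :=
  (¬ Inside lo hi below s s q (ρ i) ∧ ¬ Inside lo hi below s s q (ρ j) ∧
    OverlapBelow lo hi below (ρ i) (ρ j)) ∨
  (¬ Inside lo hi below s p s (ρ' i) ∧ ¬ Inside lo hi below s p s (ρ' j) ∧
    OverlapBelow lo hi below (ρ' i) (ρ' j)) ∨
  (Inside lo hi below s s q (ρ i) ∧ Inside lo hi below s p s (ρ' j))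

lemma inside_mirror (s a b i : ℕ) :
    Inside (fun i => -hi i) (fun i => -lo i) (fun i j => below j i) s a b i ↔
      Inside lo hi below s b a i := by
  unfold Inside
  constructor
  · rintro ⟨z, h1, h2, h3, h4⟩
    exact ⟨-z, mem_Ioo_neg.1 h1, mem_Ioo_neg.1 h2, h4, h3⟩
  · rintro ⟨z, h1, h2, h3, h4⟩
    exact ⟨-z, neg_mem_Ioo_neg.2 h1, neg_mem_Ioo_neg.2 h2, h4, h3⟩

lemma overlapBelow_mirror (i j : ℕ) :
    OverlapBelow (fun i => -hi i) (fun i => -lo i) (fun i j => below j i) i j ↔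
      OverlapBelow lo hi below j i := by
  unfold OverlapBelow
  constructor
  · rintro ⟨⟨z, h1, h2⟩, h3⟩
    exact ⟨⟨-z, mem_Ioo_neg.1 h2, mem_Ioo_neg.1 h1⟩, h3⟩
  · rintro ⟨⟨z, h1, h2⟩, h3⟩
    exact ⟨⟨-z, neg_mem_Ioo_neg.2 h2, neg_mem_Ioo_neg.2 h1⟩, h3⟩

lemma crimpBelow_mirror (i j : ℕ) :
    crimpBelow (fun i => -hi i) (fun i => -lo i) (fun i j => below j i) q s p ρ' ρ i j ↔
      crimpBelow lo hi below p s q ρ ρ' j i := by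
  unfold crimpBelow
  simp only [inside_mirror, overlapBelow_mirror]
  tauto

lemma Crimp.mem_of_mem (c : Crimp lo hi R L p s q N ρ ρ' R' L') {z : ℝ}
    (hz : z ∈ Set.Ioo (lo s) (hi s)) :
    z ∈ Set.Ioo (lo p) (hi p) ∧ z ∈ Set.Ioo (lo q) (hi q) :=
  ⟨⟨c.lo_p.trans_lt hz.1, by rw [c.hi_p]; exact hz.2⟩,
    ⟨by rw [c.lo_q]; exact hz.1, hz.2.trans_le c.hi_q⟩⟩

/-- Left of the right end of `s`, the crimped interval looks like `p`. -/
lemma Crimp.mem_left_iff (c : Crimp lo hi R L p s q N ρ ρ' R' L') {z : ℝ} (hz : z < hi s) {i : ℕ} :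
    z ∈ Set.Ioo (lo (ρ i)) (hi (ρ' i)) ↔ z ∈ Set.Ioo (lo (ρ i)) (hi (ρ i)) := by
  by_cases e : i = N
  · subst e
    rw [c.map_N, c.map_N', c.hi_p]
    exact and_congr_right fun _ => iff_of_true (hz.trans_le c.hi_q) hz
  · rw [c.map_eq i e]

/-- Right of the left end of `s`, the crimped interval looks like `q`. -/
lemma Crimp.mem_right_iff (c : Crimp lo hi R L p s q N ρ ρ' R' L') {z : ℝ} (hz : lo s < z) {i : ℕ} :
    z ∈ Set.Ioo (lo (ρ i)) (hi (ρ' i)) ↔ z ∈ Set.Ioo (lo (ρ' i)) (hi (ρ' i)) := by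
  by_cases e : i = N
  · subst e
    rw [c.map_N, c.map_N', c.lo_q]
    exact and_congr_left fun _ => iff_of_true (c.lo_p.trans_lt hz) hz
  · rw [c.map_eq i e]

/-- Over a point of `s`, the heights before crimping. -/
lemma Crimp.exists_old_height (c : Crimp lo hi R L p s q N ρ ρ' R' L')
    (h : Layered lo hi R L below) (hJ : Joined lo hi R L)
    (hps : below p s) (hsq : below s q) {z : ℝ} (hz : z ∈ Set.Ioo (lo s) (hi s)) :
    ∃ f : ℕ → ℕ, f p < f s ∧ f s < f q ∧
      (∀ i j, z ∈ Set.Ioo (lo i) (hi i) → z ∈ Set.Ioo (lo j) (hi j) →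
        (below i j ↔ f i < f j) ∧ (f i = f j → i = j)) ∧
      (∀ i, z ∈ Set.Ioo (lo i) (hi i) → (Inside lo hi below s p s i ↔ f p < f i ∧ f i < f s)) ∧
      (∀ i, z ∈ Set.Ioo (lo i) (hi i) → (Inside lo hi below s s q i ↔ f s < f i ∧ f i < f q)) := by
  obtain ⟨f, hf⟩ := h.exists_height hJ z
  obtain ⟨hp, hq⟩ := c.mem_of_mem hz
  refine ⟨f, ((hf p s hp hz).1).1 hps, ((hf s q hz hq).1).1 hsq, hf, fun i hi => ?_, fun i hi => ?_⟩
  · rw [← (hf p i hp hi).1, ← (hf i s hi hz).1]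
    exact ⟨fun ⟨_, _, _, h1, h2⟩ => ⟨h1, h2⟩, fun ⟨h1, h2⟩ => ⟨z, hz, hi, h1, h2⟩⟩
  · rw [← (hf s i hz hi).1, ← (hf i q hi hq).1]
    exact ⟨fun ⟨_, _, _, h1, h2⟩ => ⟨h1, h2⟩, fun ⟨h1, h2⟩ => ⟨z, hz, hi, h1, h2⟩⟩

/-- An interval that lies between `s` and `q` somewhere does not cross the left end of `s`. -/
lemma Crimp.lo_le_of_inside (c : Crimp lo hi R L p s q N ρ ρ' R' L')
    (h : Layered lo hi R L below) {i : ℕ}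
    (hi' : Inside lo hi below s s q i) : lo s ≤ lo i := by
  by_contra hlt
  push Not at hlt
  obtain ⟨z, hz, hzi, h1, h2⟩ := hi'
  have hm : lo s ∈ Set.Ioo (lo i) (hi i) := ⟨hlt, hz.1.trans hzi.2⟩
  rcases c.right with r | r
  · exact h.right_sector _ _ i r hm (Or.inl ⟨h1, h2⟩)
  · refine h.right_sector _ _ i r (by rw [c.lo_q]; exact hm) (Or.inr ⟨h1, h2⟩)

lemma Crimp.not_inside_of_mem (c : Crimp lo hi R L p s q N ρ ρ' R' L')
    (h : Layered lo hi R L below) {i : ℕ} {z : ℝ} (hz : z ≤ lo s)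
    (hi' : z ∈ Set.Ioo (lo i) (hi i)) : ¬ Inside lo hi below s s q i := fun hh =>
  absurd (c.lo_le_of_inside h hh) (by have := hi'.1; linarith)

lemma Crimp.not_inside_of_mem' (c : Crimp lo hi R L p s q N ρ ρ' R' L')
    (h : Layered lo hi R L below) {i : ℕ} {z : ℝ} (hz : hi s ≤ z)
    (hi' : z ∈ Set.Ioo (lo i) (hi i)) : ¬ Inside lo hi below s p s i := by
  have := c.mirror.not_inside_of_mem (z := -z) h.mirror (neg_le_neg hz)
    (neg_mem_Ioo_neg.2 hi')
  rwa [inside_mirror] at this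

/-- The representative of `N` is not between `s` and `q`. -/
lemma Crimp.not_inside_p (h : Layered lo hi R L below) (c : Crimp lo hi R L p s q N ρ ρ' R' L')
    (hps : below p s) : ¬ Inside lo hi below s s q p := by
  rintro ⟨z, hz, hzp, h1, -⟩
  exact ((h.total p s z c.ne_ps hzp hz).1 hps) h1

lemma Crimp.overlapBelow_of_right (c : Crimp lo hi R L p s q N ρ ρ' R' L')
    (h : Layered lo hi R L below) (hJ : Joined lo hi R L)
    (hps : below p s) (hsq : below s q) {i j : ℕ} {z : ℝ}
    (hi' : z ∈ Set.Ioo (lo (ρ i)) (hi (ρ i))) (hj' : z ∈ Set.Ioo (lo (ρ j)) (hi (ρ j)))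
    (gi : ¬ Inside lo hi below s s q (ρ i)) (gi' : ¬ Inside lo hi below s p s (ρ' i))
    (hij : OverlapBelow lo hi below (ρ' i) (ρ' j)) : below (ρ i) (ρ j) := by
  -- an interval that overlaps both `p` and `q` overlaps `s`
  have helly : ∀ k, ∀ z w : ℝ, z ∈ Set.Ioo (lo p) (hi p) → z ∈ Set.Ioo (lo k) (hi k) →
      w ∈ Set.Ioo (lo q) (hi q) → w ∈ Set.Ioo (lo k) (hi k) →
      ∃ y ∈ Set.Ioo (lo s) (hi s), y ∈ Set.Ioo (lo k) (hi k) := by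
    intro k z w hz hzk hw hwk
    rw [c.hi_p] at hz
    rw [c.lo_q] at hw
    obtain ⟨y, hy, hy'⟩ := exists_between (a₁ := max (lo s) (lo k)) (a₂ := min (hi s) (hi k))
      (max_lt (lt_min c.lt (hw.1.trans hwk.2)) (lt_min (hzk.1.trans hz.2) (hzk.1.trans hzk.2)))
    rw [max_lt_iff] at hy
    rw [lt_min_iff] at hy'
    exact ⟨y, ⟨hy.1, hy'.1⟩, hy.2, hy'.2⟩
  obtain ⟨⟨w, hwi, hwj⟩, hb⟩ := hij
  by_cases ei : i = N
  · by_cases ej : j = N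
    · rw [ei, ej] at hb
      exact absurd hb (h.irrefl _)
    · subst ei
      rw [c.map_N] at hi' ⊢
      rw [c.map_N'] at hwi hb
      rw [c.map_eq j ej] at hwj hb
      obtain ⟨y, hy, hyj⟩ := helly _ _ _ hi' hj' hwi hwj
      obtain ⟨f, f1, f2, hf, g1, g2⟩ := c.exists_old_height h hJ hps hsq hy
      obtain ⟨yp, yq⟩ := c.mem_of_mem hy
      rw [(hf _ _ yp hyj).1]
      rw [(hf _ _ yq hyj).1] at hb
      omega
  · by_cases ej : j = N
    · subst ej
      rw [c.map_N] at hj' ⊢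
      rw [c.map_N'] at hwj hb
      rw [c.map_eq i ei] at hwi hb gi'
      obtain ⟨y, hy, hyj⟩ := helly _ _ _ hj' hi' hwj hwi
      obtain ⟨f, f1, f2, hf, g1, g2⟩ := c.exists_old_height h hJ hps hsq hy
      obtain ⟨yp, yq⟩ := c.mem_of_mem hy
      have ne := c.map_ne i ei
      have n1 := mt (hf _ _ hyj yp).2 ne.1
      have n2 := mt (hf _ _ hyj hy).2 ne.2.1
      rw [(hf _ _ hyj yp).1]
      rw [(hf _ _ hyj yq).1] at hb
      rw [g1 _ hyj] at gi'
      rw [g2 _ hyj] at gi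
      omega
    · rwa [c.map_eq i ei, c.map_eq j ej] at hb

/-- Left of the right end of `s`, the new order agrees with the old one, `N` being represented by
`p`, except on what was between `s` and `q`. -/
lemma Crimp.crimpBelow_iff_left (c : Crimp lo hi R L p s q N ρ ρ' R' L')
    (h : Layered lo hi R L below) (hJ : Joined lo hi R L)
    (hps : below p s) (hsq : below s q) {i j : ℕ} {z : ℝ} (hz : z < hi s)
    (hi' : z ∈ Set.Ioo (lo (ρ i)) (hi (ρ' i))) (hj' : z ∈ Set.Ioo (lo (ρ j)) (hi (ρ' j)))
    (gi : ¬ Inside lo hi below s s q (ρ i)) (gj : ¬ Inside lo hi below s s q (ρ j)) :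
    crimpBelow lo hi below p s q ρ ρ' i j ↔ below (ρ i) (ρ j) := by
  have mi := (c.mem_left_iff hz).1 hi'
  have mj := (c.mem_left_iff hz).1 hj'
  constructor
  · rintro (⟨-, -, -, hb⟩ | ⟨gi', -, hb⟩ | ⟨g, -⟩)
    · exact hb
    · exact c.overlapBelow_of_right h hJ hps hsq mi mj gi gi' hb
    · exact absurd g gi
  · exact fun hb => Or.inl ⟨gi, gj, ⟨z, mi, mj⟩, hb⟩

lemma Crimp.crimpBelow_iff_right (c : Crimp lo hi R L p s q N ρ ρ' R' L')
    (h : Layered lo hi R L below) (hJ : Joined lo hi R L)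
    (hps : below p s) (hsq : below s q) {i j : ℕ} {z : ℝ} (hz : lo s < z)
    (hi' : z ∈ Set.Ioo (lo (ρ i)) (hi (ρ' i))) (hj' : z ∈ Set.Ioo (lo (ρ j)) (hi (ρ' j)))
    (gi : ¬ Inside lo hi below s p s (ρ' i)) (gj : ¬ Inside lo hi below s p s (ρ' j)) :
    crimpBelow lo hi below p s q ρ ρ' i j ↔ below (ρ' i) (ρ' j) := by
  have := c.mirror.crimpBelow_iff_left h.mirror hJ.mirror hsq hps (neg_lt_neg hz)
    (neg_mem_Ioo_neg.2 hj') (neg_mem_Ioo_neg.2 hi') (by rwa [inside_mirror])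
    (by rwa [inside_mirror])
  rwa [crimpBelow_mirror] at this

/-- Over a point of `s`, the heights after crimping: the layers between `s` and `q` form a block
just below `N`. -/
lemma Crimp.exists_new_height (c : Crimp lo hi R L p s q N ρ ρ' R' L')
    (h : Layered lo hi R L below) (hJ : Joined lo hi R L)
    (hps : below p s) (hsq : below s q) {z : ℝ} (hz : z ∈ Set.Ioo (lo s) (hi s)) :
    ∃ w : ℕ → ℕ,
      (∀ i j, z ∈ Set.Ioo (lo (ρ i)) (hi (ρ' i)) → z ∈ Set.Ioo (lo (ρ j)) (hi (ρ' j)) →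
        (crimpBelow lo hi below p s q ρ ρ' i j ↔ w i < w j) ∧ (w i = w j → i = j) ∧
        (Inside lo hi below s s q (ρ i) → Inside lo hi below s s q (ρ j) →
          (w i < w j ↔ below (ρ i) (ρ j))) ∧
        (Inside lo hi below s s q (ρ i) → ¬ Inside lo hi below s s q (ρ j) → j ≠ N →
          (w i < w j ↔ w N < w j) ∧ (w j < w i ↔ w j < w N)) ∧
        (Inside lo hi below s s q (ρ i) → ¬ Inside lo hi below s s q (ρ j) → j = N →
          w i < w N)) := by
  obtain ⟨f, f1, f2, hf, g1, g2⟩ := c.exists_old_height h hJ hps hsq hz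
  obtain ⟨zp, zq⟩ := c.mem_of_mem hz
  let w : ℕ → ℕ := fun i => if i = N then f p + (f q - f s) else
    if f (ρ i) < f p then f (ρ i) else if f (ρ i) < f s then f (ρ i) + (f q - f s) else
    if f (ρ i) < f q then f (ρ i) - f s + f p else f (ρ i)
  have zN : z ∈ Set.Ioo (lo (ρ N)) (hi (ρ' N)) := by
    rw [c.map_N, c.map_N']; exact ⟨zp.1, zq.2⟩
  have hw : ∀ i, z ∈ Set.Ioo (lo (ρ i)) (hi (ρ' i)) →
      (i = N ∧ f (ρ i) = f p ∧ f (ρ' i) = f q ∧ w i = f p + (f q - f s)) ∨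
      (i ≠ N ∧ f (ρ' i) = f (ρ i) ∧ f (ρ i) ≠ f p ∧ f (ρ i) ≠ f s ∧ f (ρ i) ≠ f q ∧
        ((f (ρ i) < f p ∧ w i = f (ρ i)) ∨ (f p < f (ρ i) ∧ f (ρ i) < f s ∧
        w i = f (ρ i) + (f q - f s)) ∨ (f s < f (ρ i) ∧ f (ρ i) < f q ∧
        w i = f (ρ i) - f s + f p) ∨ (f q < f (ρ i) ∧ w i = f (ρ i)))) := by
    intro i hi
    by_cases e : i = N
    · left; subst e; simp [c.map_N, c.map_N', w]
    · right
      have ne := c.map_ne i e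
      have mi := (c.mem_left_iff hz.2).1 hi
      have n1 := mt (hf _ _ mi zp).2 ne.1
      have n2 := mt (hf _ _ mi hz).2 ne.2.1
      have n3 := mt (hf _ _ mi zq).2 ne.2.2
      refine ⟨e, by rw [c.map_eq i e], n1, n2, n3, ?_⟩
      simp only [w, e, if_false]
      split_ifs <;> omega
  refine ⟨w, fun i j hzi hzj => ?_⟩
  have mi := (c.mem_left_iff hz.2).1 hzi
  have mj := (c.mem_left_iff hz.2).1 hzj
  have mi' := (c.mem_right_iff hz.1).1 hzi
  have mj' := (c.mem_right_iff hz.1).1 hzj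
  have inj : f (ρ i) = f (ρ j) → i = j ∨ i = N ∨ j = N := by
    intro e
    by_cases ei : i = N
    · tauto
    by_cases ej : j = N
    · tauto
    exact Or.inl (c.inj i j ei ej ((hf _ _ mi mj).2 e))
  have hwi := hw i hzi
  have hwj := hw j hzj
  have hwN := hw N zN
  have key : crimpBelow lo hi below p s q ρ ρ' i j ↔
      ((¬ (f s < f (ρ i) ∧ f (ρ i) < f q) ∧ ¬ (f s < f (ρ j) ∧ f (ρ j) < f q) ∧
        f (ρ i) < f (ρ j)) ∨
      (¬ (f p < f (ρ' i) ∧ f (ρ' i) < f s) ∧ ¬ (f p < f (ρ' j) ∧ f (ρ' j) < f s) ∧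
        f (ρ' i) < f (ρ' j)) ∨
      ((f s < f (ρ i) ∧ f (ρ i) < f q) ∧ (f p < f (ρ' j) ∧ f (ρ' j) < f s))) := by
    have o1 : OverlapBelow lo hi below (ρ i) (ρ j) ↔ f (ρ i) < f (ρ j) := by
      rw [← (hf _ _ mi mj).1]
      exact ⟨fun h => h.2, fun h => ⟨⟨z, mi, mj⟩, h⟩⟩
    have o2 : OverlapBelow lo hi below (ρ' i) (ρ' j) ↔ f (ρ' i) < f (ρ' j) := by
      rw [← (hf _ _ mi' mj').1]
      exact ⟨fun h => h.2, fun h => ⟨⟨z, mi', mj'⟩, h⟩⟩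
    unfold crimpBelow
    rw [g2 _ mi, g2 _ mj, g1 _ mi', g1 _ mj', o1, o2]
  rw [key, g2 _ mi, g2 _ mj, (hf _ _ mi mj).1]
  have ewN : w N = f p + (f q - f s) := by simp [w]
  clear hwN key g1 g2 hf hw
  clear_value w
  generalize f (ρ i) = a at *
  generalize f (ρ' i) = a' at *
  generalize f (ρ j) = b at *
  generalize f (ρ' j) = b' at *
  generalize f p = x at *
  generalize f s = y at *
  generalize f q = z at *
  generalize w N = v at *
  generalize w i = u at *
  generalize w j = u' at *
  rcases hwi with ⟨ei, h1, h2, h3⟩ |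
    ⟨ei, h1, h2, h3, h4, ⟨h5, h6⟩ | ⟨h5, h6, h7⟩ | ⟨h5, h6, h7⟩ | ⟨h5, h6⟩⟩ <;>
  rcases hwj with ⟨ej, h1', h2', h3'⟩ |
    ⟨ej, h1', h2', h3', h4', ⟨h5', h6'⟩ | ⟨h5', h6', h7'⟩ | ⟨h5', h6', h7'⟩ | ⟨h5', h6'⟩⟩ <;>
  (refine ⟨?_, ?_, ?_, ?_, ?_⟩ <;> omega)

lemma exists_between_five {a b₁ b₂ b₃ b₄ b₅ : ℝ} (h₁ : a < b₁) (h₂ : a < b₂) (h₃ : a < b₃)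
    (h₄ : a < b₄) (h₅ : a < b₅) :
    ∃ z, a < z ∧ z < b₁ ∧ z < b₂ ∧ z < b₃ ∧ z < b₄ ∧ z < b₅ := by
  obtain ⟨z, hz, hz'⟩ := exists_between
    (lt_min h₁ (lt_min h₂ (lt_min h₃ (lt_min h₄ h₅))))
  simp only [lt_min_iff] at hz'
  exact ⟨z, hz, hz'⟩

/-- Of two intervals joined at their left ends, both or none lie between `s` and `q`. -/
lemma Crimp.inside_iff (c : Crimp lo hi R L p s q N ρ ρ' R' L')
    (h : Layered lo hi R L below) (hJ : Joined lo hi R L)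
    (hps : below p s) (hsq : below s q) {a b : ℕ} (hR : R a b) (hlt : lo a < hi s) :
    Inside lo hi below s s q a ↔ Inside lo hi below s s q b := by
  obtain ⟨e, ha, hb⟩ := hJ.right a b hR
  rcases lt_trichotomy (lo a) (lo s) with hl | hl | hl
  · exact iff_of_false (fun g => absurd (c.lo_le_of_inside h g) (by linarith))
      (fun g => absurd (c.lo_le_of_inside h g) (by linarith))
  · have key : ∀ i, lo i = lo s → lo i < hi i →
        (Inside lo hi below s s q i ↔ Between below s q i) := by
      intro i ei hi'
      refine ⟨fun ⟨_, _, _, h1, h2⟩ => Or.inl ⟨h1, h2⟩, fun hB => ?_⟩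
      obtain ⟨z, hz, hz1, hz2, -⟩ := exists_between_five c.lt (ei ▸ hi') c.lt c.lt c.lt
      obtain ⟨-, zq⟩ := c.mem_of_mem (z := z) ⟨hz, hz1⟩
      have zi : z ∈ Set.Ioo (lo i) (hi i) := ⟨ei ▸ hz, hz2⟩
      rcases hB with hB | hB
      · exact ⟨z, ⟨hz, hz1⟩, zi, hB⟩
      · have := h.trans q i s z zq zi ⟨hz, hz1⟩ hB.1 hB.2
        exact absurd this ((h.total s q z c.ne_sq ⟨hz, hz1⟩ zq).1 hsq)
    rw [key a hl ha, key b (e ▸ hl) hb]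
    rcases c.right with r | r
    · exact h.right_right s q a b r hR hl.symm
    · rw [between_comm, between_comm _ s q]
      exact h.right_right q s a b r hR (c.lo_q.trans hl.symm)
  · obtain ⟨z, hz, hz1, hz2, hz3, -⟩ := exists_between_five hlt ha (e ▸ hb) ha ha
    have zs : z ∈ Set.Ioo (lo s) (hi s) := ⟨hl.trans hz, hz1⟩
    obtain ⟨f, f1, f2, hf, -, g2⟩ := c.exists_old_height h hJ hps hsq zs
    obtain ⟨-, zq⟩ := c.mem_of_mem zs
    have za : z ∈ Set.Ioo (lo a) (hi a) := ⟨hz, hz2⟩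
    have zb : z ∈ Set.Ioo (lo b) (hi b) := ⟨e ▸ hz, hz3⟩
    have n1 := h.right_sector a b s hR ⟨hl, hlt⟩
    have n2 := h.right_sector a b q hR ⟨c.lo_q ▸ hl, hlt.trans_le c.hi_q⟩
    have d1 : f a ≠ f s := fun e' => by
      have := (hf a s za zs).2 e'; subst this; exact lt_irrefl _ hl
    have d2 : f a ≠ f q := fun e' => by
      have := (hf a q za zq).2 e'; subst this; rw [c.lo_q] at hl; exact lt_irrefl _ hl
    have d3 : f b ≠ f s := fun e' => by
      have := (hf b s zb zs).2 e'; subst this; rw [e] at hl; exact lt_irrefl _ hl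
    have d4 : f b ≠ f q := fun e' => by
      have := (hf b q zb zq).2 e'; subst this; rw [e, c.lo_q] at hl; exact lt_irrefl _ hl
    unfold Between at n1 n2
    rw [(hf a s za zs).1, (hf s b zs zb).1, (hf b s zb zs).1, (hf s a zs za).1] at n1
    rw [(hf a q za zq).1, (hf q b zq zb).1, (hf b q zb zq).1, (hf q a zq za).1] at n2
    rw [g2 a za, g2 b zb]
    omega

lemma Crimp.between_left (c : Crimp lo hi R L p s q N ρ ρ' R' L')
    (h : Layered lo hi R L below) (hJ : Joined lo hi R L)
    (hps : below p s) (hsq : below s q) {u v k : ℕ} {z : ℝ} (hz : z < hi s)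
    (hu : z ∈ Set.Ioo (lo (ρ u)) (hi (ρ' u))) (hv : z ∈ Set.Ioo (lo (ρ v)) (hi (ρ' v)))
    (hk : z ∈ Set.Ioo (lo (ρ k)) (hi (ρ' k))) (gu : ¬ Inside lo hi below s s q (ρ u))
    (gv : ¬ Inside lo hi below s s q (ρ v)) (gk : ¬ Inside lo hi below s s q (ρ k)) :
    Between (crimpBelow lo hi below p s q ρ ρ') u v k ↔ Between below (ρ u) (ρ v) (ρ k) := by
  unfold Between
  rw [c.crimpBelow_iff_left h hJ hps hsq hz hu hk gu gk,
    c.crimpBelow_iff_left h hJ hps hsq hz hk hv gk gv,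
    c.crimpBelow_iff_left h hJ hps hsq hz hv hk gv gk,
    c.crimpBelow_iff_left h hJ hps hsq hz hk hu gk gu]

lemma Crimp.between_right (c : Crimp lo hi R L p s q N ρ ρ' R' L')
    (h : Layered lo hi R L below) (hJ : Joined lo hi R L)
    (hps : below p s) (hsq : below s q) {u v k : ℕ} {z : ℝ} (hz : hi s ≤ z)
    (hu : z ∈ Set.Ioo (lo (ρ u)) (hi (ρ' u))) (hv : z ∈ Set.Ioo (lo (ρ v)) (hi (ρ' v)))
    (hk : z ∈ Set.Ioo (lo (ρ k)) (hi (ρ' k))) :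
    Between (crimpBelow lo hi below p s q ρ ρ') u v k ↔ Between below (ρ' u) (ρ' v) (ρ' k) := by
  have hz' := c.lt.trans_le hz
  have g : ∀ i, z ∈ Set.Ioo (lo (ρ i)) (hi (ρ' i)) → ¬ Inside lo hi below s p s (ρ' i) :=
    fun i hi' => c.not_inside_of_mem' h hz ((c.mem_right_iff hz').1 hi')
  unfold Between
  rw [c.crimpBelow_iff_right h hJ hps hsq hz' hu hk (g u hu) (g k hk),
    c.crimpBelow_iff_right h hJ hps hsq hz' hk hv (g k hk) (g v hv),
    c.crimpBelow_iff_right h hJ hps hsq hz' hv hk (g v hv) (g k hk),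
    c.crimpBelow_iff_right h hJ hps hsq hz' hk hu (g k hk) (g u hu)]

lemma Crimp.mem_N (c : Crimp lo hi R L p s q N ρ ρ' R' L') {z : ℝ}
    (hz : z ∈ Set.Ioo (lo s) (hi s)) : z ∈ Set.Ioo (lo (ρ N)) (hi (ρ' N)) := by
  rw [c.map_N, c.map_N']
  exact ⟨(c.mem_of_mem hz).1.1, (c.mem_of_mem hz).2.2⟩

/-- What was between `s` and `q` stays in the same order and forms a block. -/
lemma Crimp.block (c : Crimp lo hi R L p s q N ρ ρ' R' L')
    (h : Layered lo hi R L below) (hJ : Joined lo hi R L)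
    (hps : below p s) (hsq : below s q) {u v k : ℕ} {z : ℝ} (hz : z < hi s)
    (hu : z ∈ Set.Ioo (lo (ρ u)) (hi (ρ' u))) (hv : z ∈ Set.Ioo (lo (ρ v)) (hi (ρ' v)))
    (hk : z ∈ Set.Ioo (lo (ρ k)) (hi (ρ' k))) (gu : Inside lo hi below s s q (ρ u))
    (gv : Inside lo hi below s s q (ρ v)) :
    (crimpBelow lo hi below p s q ρ ρ' u v ↔ below (ρ u) (ρ v)) ∧
    (Inside lo hi below s s q (ρ k) →
      (Between (crimpBelow lo hi below p s q ρ ρ') u v k ↔ Between below (ρ u) (ρ v) (ρ k))) ∧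
    (¬ Inside lo hi below s s q (ρ k) →
      ¬ Between (crimpBelow lo hi below p s q ρ ρ') u v k ∧
      ∀ j, z ∈ Set.Ioo (lo (ρ j)) (hi (ρ' j)) → ¬ Inside lo hi below s s q (ρ j) →
      (Between (crimpBelow lo hi below p s q ρ ρ') k j u ↔
        Between (crimpBelow lo hi below p s q ρ ρ') k j v)) := by
  have zs : z ∈ Set.Ioo (lo s) (hi s) := ⟨(c.lo_le_of_inside h gu).trans_lt hu.1, hz⟩
  obtain ⟨w, hw⟩ := c.exists_new_height h hJ hps hsq zs
  have key : ∀ j, z ∈ Set.Ioo (lo (ρ j)) (hi (ρ' j)) → ¬ Inside lo hi below s s q (ρ j) →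
      (w u < w j ↔ w v < w j) ∧ (w j < w u ↔ w j < w v) := by
    intro j hj gj
    by_cases e : j = N
    · have h1 := (hw u j hu hj).2.2.2.2 gu gj e
      have h2 := (hw v j hv hj).2.2.2.2 gv gj e
      subst e
      omega
    · have h1 := (hw u j hu hj).2.2.2.1 gu gj e
      have h2 := (hw v j hv hj).2.2.2.1 gv gj e
      omega
  refine ⟨(hw u v hu hv).1.trans ((hw u v hu hv).2.2.1 gu gv), fun gk => ?_, fun gk => ⟨?_, ?_⟩⟩
  · unfold Between
    rw [(hw u k hu hk).1, (hw u k hu hk).2.2.1 gu gk, (hw k v hk hv).1, (hw k v hk hv).2.2.1 gk gv,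
      (hw v k hv hk).1, (hw v k hv hk).2.2.1 gv gk, (hw k u hk hu).1, (hw k u hk hu).2.2.1 gk gu]
  · unfold Between
    rw [(hw u k hu hk).1, (hw k v hk hv).1, (hw v k hv hk).1, (hw k u hk hu).1]
    have := key k hk gk
    omega
  · intro j hj gj
    have h1 := key k hk gk
    have h2 := key j hj gj
    unfold Between
    rw [(hw k u hk hu).1, (hw u j hu hj).1, (hw j u hj hu).1, (hw u k hu hk).1,
      (hw k v hk hv).1, (hw v j hv hj).1, (hw j v hj hv).1, (hw v k hv hk).1]
    omega

/-- A layer that passes over a crease and moves to a place just below `N` does so without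
getting into the crease, since `N` passes over it too. -/
lemma Crimp.between_inside (c : Crimp lo hi R L p s q N ρ ρ' R' L')
    (h : Layered lo hi R L below) (hJ : Joined lo hi R L)
    (hps : below p s) (hsq : below s q) {u v k : ℕ} {z : ℝ} (hz : z < hi s)
    (hu : z ∈ Set.Ioo (lo (ρ u)) (hi (ρ' u))) (hv : z ∈ Set.Ioo (lo (ρ v)) (hi (ρ' v)))
    (hk : z ∈ Set.Ioo (lo (ρ k)) (hi (ρ' k))) (gu : ¬ Inside lo hi below s s q (ρ u))
    (gv : ¬ Inside lo hi below s s q (ρ v)) (gk : Inside lo hi below s s q (ρ k))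
    (uN : u ≠ N) (vN : v ≠ N) :
    Between (crimpBelow lo hi below p s q ρ ρ') u v k ↔
      Between (crimpBelow lo hi below p s q ρ ρ') u v N := by
  have zs : z ∈ Set.Ioo (lo s) (hi s) := ⟨(c.lo_le_of_inside h gk).trans_lt hk.1, hz⟩
  obtain ⟨w, hw⟩ := c.exists_new_height h hJ hps hsq zs
  have zN := c.mem_N zs
  have h1 := (hw k u hk hu).2.2.2.1 gk gu uN
  have h2 := (hw k v hk hv).2.2.2.1 gk gv vN
  unfold Between
  rw [(hw k u hk hu).1, (hw u k hu hk).1, (hw k v hk hv).1, (hw v k hv hk).1,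
    (hw N u zN hu).1, (hw u N hu zN).1, (hw N v zN hv).1, (hw v N hv zN).1]
  omega

/-- The conditions at the creases that open to the right hold after crimping, and the creases keep
their sense. -/
lemma Crimp.right_conditions (c : Crimp lo hi R L p s q N ρ ρ' R' L')
    (h : Layered lo hi R L below) (hJ : Joined lo hi R L)
    (hps : below p s) (hsq : below s q) :
    (∀ u v, R' u v → (crimpBelow lo hi below p s q ρ ρ' u v ↔ below (ρ u) (ρ v)) ∧
      (crimpBelow lo hi below p s q ρ ρ' v u ↔ below (ρ v) (ρ u))) ∧
    (∀ u v k, R' u v → lo (ρ u) ∈ Set.Ioo (lo (ρ k)) (hi (ρ' k)) →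
      ¬ Between (crimpBelow lo hi below p s q ρ ρ') u v k) ∧
    (∀ u v u' v', R' u v → R' u' v' → lo (ρ u) = lo (ρ u') →
      (Between (crimpBelow lo hi below p s q ρ ρ') u v u' ↔
        Between (crimpBelow lo hi below p s q ρ ρ') u v v')) := by
  have ne : ∀ u, hi s ≤ lo (ρ u) → ρ' u = ρ u := by
    intro u hu
    refine c.map_eq u fun e => ?_
    rw [e, c.map_N] at hu
    exact absurd (hu.trans c.lo_p) (not_le.2 c.lt)
  refine ⟨fun u v huv => ?_, fun u v k huv hk => ?_, fun u v u' v' huv huv' e' => ?_⟩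
  · have hR := c.map_R u v huv
    obtain ⟨e, hu, hv⟩ := hJ.right _ _ hR
    rcases lt_or_ge (lo (ρ u)) (hi s) with hP | hP
    · obtain ⟨z, hz, hz1, hz2, hz3, -⟩ := exists_between_five hP hu (e ▸ hv) hu hu
      have zu := (c.mem_left_iff hz1).2 ⟨hz, hz2⟩
      have zv := (c.mem_left_iff hz1).2 ⟨e ▸ hz, hz3⟩
      have gi := c.inside_iff h hJ hps hsq hR hP
      by_cases gu : Inside lo hi below s s q (ρ u)
      · exact ⟨(c.block h hJ hps hsq hz1 zu zv zu gu (gi.1 gu)).1,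
          (c.block h hJ hps hsq hz1 zv zu zu (gi.1 gu) gu).1⟩
      · have gv := fun g => gu (gi.2 g)
        exact ⟨c.crimpBelow_iff_left h hJ hps hsq hz1 zu zv gu gv,
          c.crimpBelow_iff_left h hJ hps hsq hz1 zv zu gv gu⟩
    · obtain ⟨z, hz, hz2, hz3, -⟩ := exists_between_five hu (e ▸ hv) hu hu hu
      have eu := ne u hP
      have ev := ne v (e ▸ hP)
      have zu : z ∈ Set.Ioo (lo (ρ' u)) (hi (ρ' u)) := by rw [eu]; exact ⟨hz, hz2⟩
      have zv : z ∈ Set.Ioo (lo (ρ' v)) (hi (ρ' v)) := by rw [ev]; exact ⟨e ▸ hz, hz3⟩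
      have hzs : lo s < z := c.lt.trans (hP.trans_lt hz)
      have gu := c.not_inside_of_mem' h (hP.trans hz.le) zu
      have gv := c.not_inside_of_mem' h (hP.trans hz.le) zv
      have zu' := (c.mem_right_iff hzs).2 zu
      have zv' := (c.mem_right_iff hzs).2 zv
      rw [c.crimpBelow_iff_right h hJ hps hsq hzs zu' zv' gu gv,
        c.crimpBelow_iff_right h hJ hps hsq hzs zv' zu' gv gu, eu, ev]
      exact ⟨Iff.rfl, Iff.rfl⟩
  · have hR := c.map_R u v huv
    obtain ⟨e, hu, hv⟩ := hJ.right _ _ hR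
    rcases lt_or_ge (lo (ρ u)) (hi s) with hP | hP
    · obtain ⟨z, hz, hz1, hz2, hz3, hz4, -⟩ := exists_between_five hP hu (e ▸ hv) hk.2 hu
      have zu := (c.mem_left_iff hz1).2 ⟨hz, hz2⟩
      have zv := (c.mem_left_iff hz1).2 ⟨e ▸ hz, hz3⟩
      have zk : z ∈ Set.Ioo (lo (ρ k)) (hi (ρ' k)) := ⟨hk.1.trans hz, hz4⟩
      have gi := c.inside_iff h hJ hps hsq hR hP
      by_cases gu : Inside lo hi below s s q (ρ u)
      · have hb := (c.block h hJ hps hsq hz1 zu zv zk gu (gi.1 gu)).2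
        by_cases gk : Inside lo hi below s s q (ρ k)
        · rw [hb.1 gk]
          exact h.right_sector _ _ _ hR ((c.mem_left_iff hP).1 hk)
        · exact (hb.2 gk).1
      · have gv := fun g => gu (gi.2 g)
        by_cases gk : Inside lo hi below s s q (ρ k)
        · have hsP : lo s < lo (ρ u) := (c.lo_le_of_inside h gk).trans_lt hk.1
          have gN : ¬ Inside lo hi below s s q (ρ N) := by
            rw [c.map_N]; exact Crimp.not_inside_p h c hps
          have nN : ∀ i, lo s < lo (ρ i) → i ≠ N := by
            rintro i hi' rfl
            rw [c.map_N] at hi'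
            exact absurd c.lo_p (not_le.2 hi')
          rw [c.between_inside h hJ hps hsq hz1 zu zv zk gu gv gk (nN u hsP) (nN v (e ▸ hsP)),
            c.between_left h hJ hps hsq hz1 zu zv (c.mem_N ⟨hsP.trans hz, hz1⟩) gu gv gN, c.map_N]
          exact h.right_sector _ _ _ hR (c.mem_of_mem ⟨hsP, hP⟩).1
        · rw [c.between_left h hJ hps hsq hz1 zu zv zk gu gv gk]
          exact h.right_sector _ _ _ hR ((c.mem_left_iff hP).1 hk)
    · obtain ⟨z, hz, hz2, hz3, hz4, -⟩ := exists_between_five hu (e ▸ hv) hk.2 hu hu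
      have zu : z ∈ Set.Ioo (lo (ρ u)) (hi (ρ' u)) := by rw [ne u hP]; exact ⟨hz, hz2⟩
      have zv : z ∈ Set.Ioo (lo (ρ v)) (hi (ρ' v)) := by
        rw [ne v (e ▸ hP)]; exact ⟨e ▸ hz, hz3⟩
      have zk : z ∈ Set.Ioo (lo (ρ k)) (hi (ρ' k)) := ⟨hk.1.trans hz, hz4⟩
      rw [c.between_right h hJ hps hsq (hP.trans hz.le) zu zv zk, ne u hP, ne v (e ▸ hP)]
      exact h.right_sector _ _ _ hR ((c.mem_right_iff (c.lt.trans_le hP)).1 hk)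
  · have hR := c.map_R u v huv
    have hR' := c.map_R u' v' huv'
    obtain ⟨e, hu, hv⟩ := hJ.right _ _ hR
    obtain ⟨e1, hu', hv'⟩ := hJ.right _ _ hR'
    rcases lt_or_ge (lo (ρ u)) (hi s) with hP | hP
    · obtain ⟨z, hz, hz1, hz2, hz3, hz4, hz5⟩ := exists_between_five hP hu (e ▸ hv)
        (e' ▸ hu') (by rw [e', e1]; exact hv')
      have zu := (c.mem_left_iff hz1).2 ⟨hz, hz2⟩
      have zv := (c.mem_left_iff hz1).2 ⟨e ▸ hz, hz3⟩
      have zu' := (c.mem_left_iff hz1).2 ⟨e' ▸ hz, hz4⟩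
      have zv' := (c.mem_left_iff hz1).2 ⟨by rw [← e1, ← e']; exact hz, hz5⟩
      have gi := c.inside_iff h hJ hps hsq hR hP
      have gi' := c.inside_iff h hJ hps hsq hR' (e' ▸ hP)
      by_cases gu : Inside lo hi below s s q (ρ u) <;>
      by_cases gu' : Inside lo hi below s s q (ρ u')
      · rw [(c.block h hJ hps hsq hz1 zu zv zu' gu (gi.1 gu)).2.1 gu',
          (c.block h hJ hps hsq hz1 zu zv zv' gu (gi.1 gu)).2.1 (gi'.1 gu')]
        exact h.right_right _ _ _ _ hR hR' e'
      · exact iff_of_false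
          ((c.block h hJ hps hsq hz1 zu zv zu' gu (gi.1 gu)).2.2 gu').1
          ((c.block h hJ hps hsq hz1 zu zv zv' gu (gi.1 gu)).2.2 (fun g => gu' (gi'.2 g))).1
      · exact ((c.block h hJ hps hsq hz1 zu' zv' zu gu' (gi'.1 gu')).2.2 gu).2 v zv
          (fun g => gu (gi.2 g))
      · have gv := fun g => gu (gi.2 g)
        have gv' := fun g => gu' (gi'.2 g)
        rw [c.between_left h hJ hps hsq hz1 zu zv zu' gu gv gu',
          c.between_left h hJ hps hsq hz1 zu zv zv' gu gv gv']
        exact h.right_right _ _ _ _ hR hR' e'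
    · have hP' : hi s ≤ lo (ρ u') := e' ▸ hP
      obtain ⟨z, hz, hz2, hz3, hz4, hz5, -⟩ := exists_between_five hu (e ▸ hv)
        (e' ▸ hu') (show lo (ρ u) < hi (ρ v') by rw [e', e1]; exact hv') hu
      have zu : z ∈ Set.Ioo (lo (ρ u)) (hi (ρ' u)) := by rw [ne u hP]; exact ⟨hz, hz2⟩
      have zv : z ∈ Set.Ioo (lo (ρ v)) (hi (ρ' v)) := by
        rw [ne v (e ▸ hP)]; exact ⟨e ▸ hz, hz3⟩
      have zu' : z ∈ Set.Ioo (lo (ρ u')) (hi (ρ' u')) := by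
        rw [ne u' hP']; exact ⟨e' ▸ hz, hz4⟩
      have zv' : z ∈ Set.Ioo (lo (ρ v')) (hi (ρ' v')) := by
        rw [ne v' (e1 ▸ hP')]; exact ⟨by rw [← e1, ← e']; exact hz, hz5⟩
      rw [c.between_right h hJ hps hsq (hP.trans hz.le) zu zv zu',
        c.between_right h hJ hps hsq (hP.trans hz.le) zu zv zv', ne u hP, ne v (e ▸ hP), ne u' hP',
        ne v' (e1 ▸ hP')]
      exact h.right_right _ _ _ _ hR hR' e'

/-- Crimping a layered family gives a layered family. -/
lemma Crimp.layered (c : Crimp lo hi R L p s q N ρ ρ' R' L')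
    (h : Layered lo hi R L below) (hJ : Joined lo hi R L)
    (hps : below p s) (hsq : below s q) :
    Layered (fun i => lo (ρ i)) (fun i => hi (ρ' i)) R' L' (crimpBelow lo hi below p s q ρ ρ') := by
  have rc := c.right_conditions h hJ hps hsq
  have lc := c.mirror.right_conditions h.mirror hJ.mirror hsq hps
  have bm : ∀ u v k, Between (crimpBelow (fun i => -hi i) (fun i => -lo i)
      (fun i j => below j i) q s p ρ' ρ) u v k ↔
      Between (crimpBelow lo hi below p s q ρ ρ') u v k := by
    intro u v k
    rw [← between_flip]
    unfold Between
    simp only [crimpBelow_mirror]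
  refine ⟨?_, ?_, ?_, rc.2.1, ?_, rc.2.2, ?_⟩
  · intro i hi'
    rcases hi' with ⟨-, -, -, hb⟩ | ⟨-, -, -, hb⟩ | ⟨g, g'⟩
    · exact h.irrefl _ hb
    · exact h.irrefl _ hb
    · by_cases e : i = N
      · rw [e, c.map_N] at g
        exact Crimp.not_inside_p h c hps g
      · rw [c.map_eq i e] at g'
        obtain ⟨z, hz, hz', h1, -⟩ := g
        obtain ⟨-, -, -, -, h2⟩ := g'
        exact (h.total _ _ z (c.map_ne i e).2.1 hz' hz).1 h2 h1
  · intro i j z hij hi' hj'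
    rcases le_or_gt z (lo s) with hz | hz
    · have hz1 := hz.trans_lt c.lt
      have mi := (c.mem_left_iff hz1).1 hi'
      have mj := (c.mem_left_iff hz1).1 hj'
      have gi := c.not_inside_of_mem h hz mi
      have gj := c.not_inside_of_mem h hz mj
      rw [c.crimpBelow_iff_left h hJ hps hsq hz1 hi' hj' gi gj,
        c.crimpBelow_iff_left h hJ hps hsq hz1 hj' hi' gj gi]
      refine h.total _ _ z (fun e => hij ?_) mi mj
      by_cases ei : i = N
      · by_contra ej
        rw [ei, c.map_N] at e
        exact (c.map_ne j (fun h => ej (ei.trans h.symm))).1 e.symm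
      · by_cases ej : j = N
        · rw [ej, c.map_N] at e
          exact absurd e (c.map_ne i ei).1
        · exact c.inj i j ei ej e
    rcases le_or_gt (hi s) z with hz2 | hz2
    · have mi := (c.mem_right_iff hz).1 hi'
      have mj := (c.mem_right_iff hz).1 hj'
      have gi := c.not_inside_of_mem' h hz2 mi
      have gj := c.not_inside_of_mem' h hz2 mj
      rw [c.crimpBelow_iff_right h hJ hps hsq hz hi' hj' gi gj,
        c.crimpBelow_iff_right h hJ hps hsq hz hj' hi' gj gi]
      refine h.total _ _ z (fun e => hij ?_) mi mj
      by_cases ei : i = N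
      · by_contra ej
        rw [ei, c.map_N'] at e
        exact (c.mirror.map_ne j (fun h => ej (ei.trans h.symm))).1 e.symm
      · by_cases ej : j = N
        · rw [ej, c.map_N'] at e
          exact absurd e (c.mirror.map_ne i ei).1
        · exact c.mirror.inj i j ei ej e
    · obtain ⟨w, hw⟩ := c.exists_new_height h hJ hps hsq ⟨hz, hz2⟩
      have := mt (hw i j hi' hj').2.1 hij
      rw [(hw i j hi' hj').1, (hw j i hj' hi').1]
      omega
  · intro i j k z hi' hj' hk'
    rcases le_or_gt z (lo s) with hz | hz
    · have hz1 := hz.trans_lt c.lt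
      have mi := (c.mem_left_iff hz1).1 hi'
      have mj := (c.mem_left_iff hz1).1 hj'
      have mk := (c.mem_left_iff hz1).1 hk'
      have gi := c.not_inside_of_mem h hz mi
      have gj := c.not_inside_of_mem h hz mj
      have gk := c.not_inside_of_mem h hz mk
      rw [c.crimpBelow_iff_left h hJ hps hsq hz1 hi' hj' gi gj,
        c.crimpBelow_iff_left h hJ hps hsq hz1 hj' hk' gj gk,
        c.crimpBelow_iff_left h hJ hps hsq hz1 hi' hk' gi gk]
      exact h.trans _ _ _ z mi mj mk
    rcases le_or_gt (hi s) z with hz2 | hz2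
    · have mi := (c.mem_right_iff hz).1 hi'
      have mj := (c.mem_right_iff hz).1 hj'
      have mk := (c.mem_right_iff hz).1 hk'
      have gi := c.not_inside_of_mem' h hz2 mi
      have gj := c.not_inside_of_mem' h hz2 mj
      have gk := c.not_inside_of_mem' h hz2 mk
      rw [c.crimpBelow_iff_right h hJ hps hsq hz hi' hj' gi gj,
        c.crimpBelow_iff_right h hJ hps hsq hz hj' hk' gj gk,
        c.crimpBelow_iff_right h hJ hps hsq hz hi' hk' gi gk]
      exact h.trans _ _ _ z mi mj mk
    · obtain ⟨w, hw⟩ := c.exists_new_height h hJ hps hsq ⟨hz, hz2⟩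
      rw [(hw i j hi' hj').1, (hw j k hj' hk').1, (hw i k hi' hk').1]
      omega
  · intro u v k huv hk
    have := lc.2.1 u v k huv (neg_mem_Ioo_neg.2 hk)
    rwa [bm] at this
  · intro u v u' v' huv huv' e
    have := lc.2.2 u v u' v' huv huv' (congrArg Neg.neg e)
    rwa [bm, bm] at this

/-- The creases that open to the left keep their sense. -/
lemma Crimp.crimpBelow_iff_of_left (c : Crimp lo hi R L p s q N ρ ρ' R' L')
    (h : Layered lo hi R L below) (hJ : Joined lo hi R L)
    (hps : below p s) (hsq : below s q) {u v : ℕ} (huv : L' u v) :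
    crimpBelow lo hi below p s q ρ ρ' u v ↔ below (ρ' u) (ρ' v) := by
  have := ((c.mirror.right_conditions h.mirror hJ.mirror hsq hps).1 u v huv).2
  rwa [crimpBelow_mirror] at this

/-! ### Undoing a crimp -/

/-- The collapse of the intervals of a crimp, sending `p`, `s` and `q` to `N`. -/
structure Collapse (p s q N : ℕ) (ρ ρ' τ : ℕ → ℕ) : Prop where
  map_p : τ p = N
  map_s : τ s = N
  map_q : τ q = N
  left_inv : ∀ j, τ (ρ j) = j
  left_inv' : ∀ j, τ (ρ' j) = j
  cases : ∀ i, i = p ∨ i = s ∨ i = q ∨ (τ i ≠ N ∧ i = ρ (τ i))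

lemma Collapse.mirror {τ : ℕ → ℕ} (t : Collapse p s q N ρ ρ' τ)
    (c : Crimp lo hi R L p s q N ρ ρ' R' L') : Collapse q s p N ρ' ρ τ where
  map_p := t.map_q
  map_s := t.map_s
  map_q := t.map_p
  left_inv := t.left_inv'
  left_inv' := t.left_inv
  cases i := by
    rcases t.cases i with e | e | e | ⟨e, e'⟩
    · tauto
    · tauto
    · tauto
    · exact Or.inr (Or.inr (Or.inr ⟨e, by rw [c.map_eq _ e]; exact e'⟩))

lemma Crimp.exists_collapse (c : Crimp lo hi R L p s q N ρ ρ' R' L') :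
    ∃ τ, Collapse p s q N ρ ρ' τ := by
  have ex : ∀ i, ∃ j, (i = p ∨ i = s ∨ i = q → j = N) ∧
      (¬ (i = p ∨ i = s ∨ i = q) → j ≠ N ∧ i = ρ j) := by
    intro i
    by_cases hi' : i = p ∨ i = s ∨ i = q
    · exact ⟨N, fun _ => rfl, fun h => absurd hi' h⟩
    · obtain ⟨j, hj⟩ : ∃ j, j ≠ N ∧ i = ρ j := by have := c.surj i; tauto
      exact ⟨j, fun h => absurd h hi', fun _ => hj⟩
  choose τ h1 h2 using ex
  have li : ∀ j, τ (ρ j) = j := by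
    intro j
    by_cases e : j = N
    · rw [e, c.map_N]; exact h1 p (Or.inl rfl)
    · have := h2 (ρ j) (by have := c.map_ne j e; tauto)
      exact (c.inj _ _ e this.1 this.2).symm
  refine ⟨τ, h1 p (Or.inl rfl), h1 s (Or.inr (Or.inl rfl)), h1 q (Or.inr (Or.inr rfl)), li, ?_, ?_⟩
  · intro j
    by_cases e : j = N
    · rw [e, c.map_N']; exact h1 q (Or.inr (Or.inr rfl))
    · rw [c.map_eq j e]; exact li j
  · intro i
    have := h2 i
    tauto

/-- The stacking order before a crimp that keeps `p`, `s` and `q` next to each other. -/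
def uncrimpBelow (p s q : ℕ) (τ : ℕ → ℕ) (below : ℕ → ℕ → Prop) (i j : ℕ) : Prop :=
  below (τ i) (τ j) ∨ (i = p ∧ j = s) ∨ (i = s ∧ j = q) ∨ (i = p ∧ j = q)

variable {τ : ℕ → ℕ}

lemma uncrimpBelow_mirror (i j : ℕ) :
    uncrimpBelow q s p τ (fun i j => below j i) i j ↔ uncrimpBelow p s q τ below j i := by
  unfold uncrimpBelow; tauto

lemma Crimp.mem_collapse (c : Crimp lo hi R L p s q N ρ ρ' R' L') (t : Collapse p s q N ρ ρ' τ)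
    {i : ℕ} {z : ℝ} (hz : z ∈ Set.Ioo (lo i) (hi i)) :
    z ∈ Set.Ioo (lo (ρ (τ i))) (hi (ρ' (τ i))) := by
  rcases t.cases i with e | e | e | ⟨e, e'⟩
  · rw [e] at hz ⊢
    rw [t.map_p, c.map_N, c.map_N']
    exact ⟨hz.1, by have := hz.2; rw [c.hi_p] at this; exact this.trans_le c.hi_q⟩
  · rw [e] at hz ⊢
    rw [t.map_s, c.map_N, c.map_N']
    exact ⟨c.lo_p.trans_lt hz.1, hz.2.trans_le c.hi_q⟩
  · rw [e] at hz ⊢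
    rw [t.map_q, c.map_N, c.map_N']
    exact ⟨by have := hz.1; rw [c.lo_q] at this; exact c.lo_p.trans_lt this, hz.2⟩
  · rw [c.map_eq _ e, ← e']
    exact hz

lemma Crimp.uncrimpBelow_map (c : Crimp lo hi R L p s q N ρ ρ' R' L')
    (t : Collapse p s q N ρ ρ' τ) (u v : ℕ) :
    uncrimpBelow p s q τ below (ρ u) (ρ v) ↔ below u v := by
  have hne : ∀ u, ρ u ≠ s ∧ ρ u ≠ q := by
    intro u
    by_cases e : u = N
    · rw [e, c.map_N]; exact ⟨c.ne_ps, c.ne_pq⟩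
    · exact (c.map_ne u e).2
  unfold uncrimpBelow
  rw [t.left_inv, t.left_inv]
  have := hne v
  tauto

lemma Crimp.uncrimp_right_conditions (c : Crimp lo hi R L p s q N ρ ρ' R' L')
    (t : Collapse p s q N ρ ρ' τ)
    (h : Layered (fun i => lo (ρ i)) (fun i => hi (ρ' i)) R' L' below) (hJ : Joined lo hi R L) :
    (∀ u v k, R u v → lo u ∈ Set.Ioo (lo k) (hi k) →
      ¬ Between (uncrimpBelow p s q τ below) u v k) ∧
    (∀ u v u' v', R u v → R u' v' → lo u = lo u' →
      (Between (uncrimpBelow p s q τ below) u v u' ↔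
        Between (uncrimpBelow p s q τ below) u v v')) := by
  have n1 := c.ne_ps
  have n2 := c.ne_sq
  have n3 := c.ne_pq
  have hne : ∀ u, ρ u ≠ s ∧ ρ u ≠ q := by
    intro u
    by_cases e : u = N
    · rw [e, c.map_N]; exact ⟨n1, n3⟩
    · exact (c.map_ne u e).2
  have irr := h.irrefl N
  -- nothing gets between `s` and `q`
  have tight : ∀ k z, z ∈ Set.Ioo (lo s) (hi s) → z ∈ Set.Ioo (lo k) (hi k) →
      ¬ Between (uncrimpBelow p s q τ below) s q k := by
    intro k z zs zk hB
    rcases t.cases k with e | e | e | ⟨e, -⟩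
    · subst e
      simp only [Between, uncrimpBelow, t.map_p, t.map_s, t.map_q] at hB
      tauto
    · subst e
      simp only [Between, uncrimpBelow, t.map_s, t.map_q] at hB
      tauto
    · subst e
      simp only [Between, uncrimpBelow, t.map_s, t.map_q] at hB
      tauto
    · have zN := c.mem_collapse t zs
      have zk' := c.mem_collapse t zk
      rw [t.map_s] at zN
      have := h.total N (τ k) z e.symm zN zk'
      have k1 : k ≠ p := fun e' => e (e' ▸ t.map_p)
      have k2 : k ≠ s := fun e' => e (e' ▸ t.map_s)
      have k3 : k ≠ q := fun e' => e (e' ▸ t.map_q)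
      simp only [Between, uncrimpBelow, t.map_s, t.map_q] at hB
      tauto
  have tight' : ∀ k, lo k = lo s → lo k < hi k →
      ¬ Between (uncrimpBelow p s q τ below) s q k := by
    intro k ek hk
    obtain ⟨z, hz, hz1, hz2, -⟩ := exists_between_five c.lt (ek ▸ hk) c.lt c.lt c.lt
    exact tight k z ⟨hz, hz1⟩ ⟨ek ▸ hz, hz2⟩
  have tight'' : ∀ k, lo s ∈ Set.Ioo (lo k) (hi k) →
      ¬ Between (uncrimpBelow p s q τ below) s q k := by
    intro k hk
    obtain ⟨z, hz, hz1, hz2, -⟩ := exists_between_five c.lt hk.2 c.lt c.lt c.lt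
    exact tight k z ⟨hz, hz1⟩ ⟨hk.1.trans hz, hz2⟩
  -- for the other layers `s` and `q` are in the same place
  have same : ∀ u v, Between (uncrimpBelow p s q τ below) (ρ u) (ρ v) s ↔
      Between (uncrimpBelow p s q τ below) (ρ u) (ρ v) q := by
    intro u v
    have e1 := hne u
    have e2 := hne v
    simp only [Between, uncrimpBelow, t.map_s, t.map_q, t.left_inv]
    tauto
  constructor
  · intro u v k huv hk
    rcases c.surj_R u v huv with ⟨rfl, rfl⟩ | ⟨rfl, rfl⟩ | ⟨u', v', huv', rfl, rfl⟩
    · exact tight'' k hk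
    · rw [between_comm]
      rw [c.lo_q] at hk
      exact tight'' k hk
    · intro hB
      refine h.right_sector u' v' (τ k) huv' (c.mem_collapse t hk) ?_
      have hp : ∀ u, lo (ρ u) = lo (ρ u') → ¬ (ρ u = p ∧ (k = s ∨ k = q)) := by
        rintro u eu ⟨e, e' | e'⟩
        · rw [← eu, e, e'] at hk; exact absurd c.lo_p (not_le.2 hk.1)
        · rw [← eu, e, e', c.lo_q] at hk; exact absurd c.lo_p (not_le.2 hk.1)
      have h1 := hp u' rfl
      have h2 := hp v' (hJ.right _ _ huv).1.symm
      have e1 := hne u'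
      have e2 := hne v'
      simp only [Between, uncrimpBelow, t.left_inv] at hB ⊢
      tauto
  · have special : ∀ u v, R u v → lo u = lo s →
        (Between (uncrimpBelow p s q τ below) s q u ↔
          Between (uncrimpBelow p s q τ below) s q v) := by
      intro u v huv e
      obtain ⟨e1, hu, hv⟩ := hJ.right u v huv
      exact iff_of_false (tight' u e hu) (tight' v (e1 ▸ e) hv)
    intro u v u' v' huv huv' e
    rcases c.surj_R u v huv with ⟨rfl, rfl⟩ | ⟨rfl, rfl⟩ | ⟨a, b, hab, rfl, rfl⟩
    · exact special _ _ huv' e.symm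
    · rw [between_comm, between_comm _ _ _ v']
      exact special _ _ huv' (e.symm.trans c.lo_q)
    · rcases c.surj_R u' v' huv' with ⟨rfl, rfl⟩ | ⟨rfl, rfl⟩ | ⟨a', b', hab', rfl, rfl⟩
      · exact same a b
      · exact (same a b).symm
      · unfold Between
        simp only [c.uncrimpBelow_map t]
        exact h.right_right a b a' b' hab hab' e

/-- Undoing a crimp of a layered family gives a layered family. -/
lemma Crimp.layered_uncrimp (c : Crimp lo hi R L p s q N ρ ρ' R' L')
    (t : Collapse p s q N ρ ρ' τ)
    (h : Layered (fun i => lo (ρ i)) (fun i => hi (ρ' i)) R' L' below) (hJ : Joined lo hi R L) :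
    Layered lo hi R L (uncrimpBelow p s q τ below) := by
  have n1 := c.ne_ps
  have n2 := c.ne_sq
  have n3 := c.ne_pq
  have rc := c.uncrimp_right_conditions t h hJ
  have lc := c.mirror.uncrimp_right_conditions (t.mirror c) h.mirror hJ.mirror
  have bm : ∀ u v k, Between (uncrimpBelow q s p τ (fun i j => below j i)) u v k ↔
      Between (uncrimpBelow p s q τ below) u v k := by
    intro u v k
    rw [← between_flip]
    unfold Between
    simp only [uncrimpBelow_mirror]
  have irr := h.irrefl N
  refine ⟨?_, ?_, ?_, rc.1, ?_, rc.2, ?_⟩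
  · intro i
    have := h.irrefl (τ i)
    unfold uncrimpBelow
    rintro (h | ⟨rfl, h⟩ | ⟨rfl, h⟩ | ⟨rfl, h⟩) <;> tauto
  · intro i j z hij zi zj
    by_cases e : τ i = τ j
    · have hm : ∀ i, τ i = N → i = p ∨ i = s ∨ i = q := by
        intro i hi; have := t.cases i; tauto
      by_cases eN : τ i = N
      · have := hm i eN
        have := hm j (e ▸ eN)
        have irr' := h.irrefl (τ j)
        unfold uncrimpBelow
        rw [e]
        rcases hm i eN with rfl | rfl | rfl <;> rcases hm j (e ▸ eN) with rfl | rfl | rfl <;> tauto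
      · have h1 := t.cases i
        have h2 := t.cases j
        have m1 := t.map_p
        have m2 := t.map_s
        have m3 := t.map_q
        have a1 : i = ρ (τ i) := by
          rcases h1 with rfl | rfl | rfl | h1 <;> tauto
        have a2 : j = ρ (τ j) := by
          rcases h2 with rfl | rfl | rfl | h2
          · exact absurd (e.trans m1) eN
          · exact absurd (e.trans m2) eN
          · exact absurd (e.trans m3) eN
          · exact h2.2
        exact absurd (a1.trans (e ▸ a2.symm)) hij
    · have := h.total _ _ z e (c.mem_collapse t zi) (c.mem_collapse t zj)
      have hs : ∀ i j, (i = p ∧ j = s) ∨ (i = s ∧ j = q) ∨ (i = p ∧ j = q) → τ i = τ j := by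
        rintro i j (⟨rfl, rfl⟩ | ⟨rfl, rfl⟩ | ⟨rfl, rfl⟩) <;>
          simp only [t.map_p, t.map_s, t.map_q]
      have h1 := mt (hs i j) e
      have h2 := mt (hs j i) (fun e' => e e'.symm)
      unfold uncrimpBelow
      rw [or_iff_left h1, or_iff_left h2]
      exact this
  · intro i j k z zi zj zk hij hjk
    have hs : ∀ i j, (i = p ∧ j = s) ∨ (i = s ∧ j = q) ∨ (i = p ∧ j = q) → τ i = τ j := by
      rintro i j (⟨rfl, rfl⟩ | ⟨rfl, rfl⟩ | ⟨rfl, rfl⟩) <;>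
        simp only [t.map_p, t.map_s, t.map_q]
    rcases hij with hij | hij <;> rcases hjk with hjk | hjk
    · exact Or.inl (h.trans _ _ _ z (c.mem_collapse t zi) (c.mem_collapse t zj)
        (c.mem_collapse t zk) hij hjk)
    · exact Or.inl (hs _ _ hjk ▸ hij)
    · exact Or.inl (hs _ _ hij ▸ hjk)
    · right
      clear * - hij hjk n1 n2 n3
      omega
  · intro u v k huv hk
    have := lc.1 u v k huv (neg_mem_Ioo_neg.2 hk)
    rwa [bm] at this
  · intro u v u' v' huv huv' e
    have := lc.2 u v u' v' huv huv' (congrArg Neg.neg e)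
    rwa [bm, bm] at this

end

section

/-! ### The layered family of a folded vertex -/

lemma creasePos_zero (α : List ℝ) : creasePos α 0 = 0 := by simp [creasePos]

lemma creasePos_cons_succ (a : ℝ) (t : List ℝ) (c : ℕ) :
    creasePos (a :: t) (c + 1) = a - creasePos t c := by
  unfold creasePos
  rw [Finset.sum_range_succ']
  simp only [List.getD_cons_succ, List.getD_cons_zero, pow_succ, pow_zero, one_mul, mul_neg,
    mul_one,    neg_mul, Finset.sum_neg_distrib]
  ring

lemma creasePos_succ (α : List ℝ) (c : ℕ) :
    creasePos α (c + 1) = creasePos α c + (-1) ^ c * α.getD c 0 := by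
  unfold creasePos
  rw [Finset.sum_range_succ]

lemma creasePos_of_le {α : List ℝ} {c : ℕ} (h : α.length ≤ c) :
    creasePos α c = creasePos α α.length := by
  induction c, h using Nat.le_induction with
  | base => rfl
  | succ n hn ih => rw [creasePos_succ, List.getD_eq_default _ _ hn, ih]; ring

/-- The left end of the image of sector `i`. -/
noncomputable def sectorLo (α : List ℝ) (i : ℕ) : ℝ := min (creasePos α i) (creasePos α (i + 1))

/-- The right end of the image of sector `i`. -/
noncomputable def sectorHi (α : List ℝ) (i : ℕ) : ℝ := max (creasePos α i) (creasePos α (i + 1))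

/-- `u` and `v` are the sectors at a crease that opens to the right. -/
def RightJoint (α : List ℝ) (u v : ℕ) : Prop :=
  ∃ c < α.length, Even c ∧ ((u = prevSector α c ∧ v = c) ∨ (u = c ∧ v = prevSector α c))

/-- `u` and `v` are the sectors at a crease that opens to the left. -/
def LeftJoint (α : List ℝ) (u v : ℕ) : Prop :=
  ∃ c < α.length, ¬ Even c ∧ ((u = prevSector α c ∧ v = c) ∨ (u = c ∧ v = prevSector α c))

/-- The layers of the vertex `α` are stacked without crossing. -/
def IsStack (α : List ℝ) (below : ℕ → ℕ → Prop) : Prop :=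
  Layered (sectorLo α) (sectorHi α) (RightJoint α) (LeftJoint α) below

/-- The conditions on the angles of a vertex that do not depend on the stacking order. -/
structure IsClosed (α : List ℝ) : Prop where
  length_pos : 0 < α.length
  even : Even α.length
  pos : ∀ a ∈ α, 0 < a
  closed : creasePos α α.length = 0

lemma lt_length_of_mem {α : List ℝ} {i : ℕ} {z : ℝ}
    (h : z ∈ Set.Ioo (sectorLo α i) (sectorHi α i)) : i < α.length := by
  by_contra hn
  push Not at hn
  rw [sectorLo, sectorHi, creasePos_of_le hn, creasePos_of_le (hn.trans (Nat.le_succ i))] at h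
  simp at h

lemma prevSector_zero (α : List ℝ) (h : 0 < α.length) : prevSector α 0 = α.length - 1 := by
  unfold prevSector
  rw [zero_add, Nat.mod_eq_of_lt (by omega)]

lemma prevSector_succ (α : List ℝ) {c : ℕ} (h : c < α.length) : prevSector α (c + 1) = c := by
  unfold prevSector
  rw [show c + 1 + α.length - 1 = c + α.length by omega, Nat.add_mod_right, Nat.mod_eq_of_lt h]

lemma prevSector_eq (α : List ℝ) {c : ℕ} (h : c < α.length) :
    (c = 0 ∧ prevSector α c = α.length - 1) ∨ (c ≠ 0 ∧ prevSector α c = c - 1) := by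
  rcases c with _ | c
  · exact Or.inl ⟨rfl, prevSector_zero α h⟩
  · exact Or.inr ⟨by omega, prevSector_succ α (by omega)⟩

variable {α : List ℝ}

lemma IsClosed.creasePos_lt (hα : IsClosed α) {i : ℕ} (h : i < α.length) :
    (Even i → creasePos α i < creasePos α (i + 1)) ∧
      (¬ Even i → creasePos α (i + 1) < creasePos α i) := by
  have hp := hα.pos _ (List.getElem_mem h)
  rw [creasePos_succ, List.getD_eq_getElem _ _ h]
  refine ⟨fun e => ?_, fun e => ?_⟩
  · rw [e.neg_one_pow]; linarith
  · rw [(Nat.not_even_iff_odd.1 e).neg_one_pow]; linarith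

lemma IsClosed.sector_even (hα : IsClosed α) {i : ℕ} (h : i < α.length) (e : Even i) :
    sectorLo α i = creasePos α i ∧ sectorHi α i = creasePos α (i + 1) := by
  have := (hα.creasePos_lt h).1 e
  exact ⟨min_eq_left this.le, max_eq_right this.le⟩

lemma IsClosed.sector_odd (hα : IsClosed α) {i : ℕ} (h : i < α.length) (e : ¬ Even i) :
    sectorLo α i = creasePos α (i + 1) ∧ sectorHi α i = creasePos α i := by
  have := (hα.creasePos_lt h).2 e
  exact ⟨min_eq_right this.le, max_eq_left this.le⟩

lemma IsClosed.lo_lt_hi (hα : IsClosed α) {i : ℕ} (h : i < α.length) :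
    sectorLo α i < sectorHi α i := by
  have := hα.creasePos_lt h
  by_cases e : Even i
  · rw [(hα.sector_even h e).1, (hα.sector_even h e).2]; exact this.1 e
  · rw [(hα.sector_odd h e).1, (hα.sector_odd h e).2]; exact this.2 e

lemma IsClosed.prev_lt (hα : IsClosed α) (c : ℕ) :
    prevSector α c < α.length := Nat.mod_lt _ hα.length_pos

lemma IsClosed.even_prev (hα : IsClosed α) {c : ℕ} (h : c < α.length) :
    Even (prevSector α c) ↔ ¬ Even c := by
  have := hα.even
  have := prevSector_eq α h
  grind

lemma IsClosed.creasePos_prev (hα : IsClosed α) {c : ℕ} (h : c < α.length) :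
    creasePos α (prevSector α c + 1) = creasePos α c := by
  have hl := hα.length_pos
  rcases prevSector_eq α h with ⟨e, e'⟩ | ⟨e, e'⟩
  · rw [e', e, Nat.sub_add_cancel hl, hα.closed, creasePos_zero]
  · rw [e', Nat.sub_add_cancel (by omega)]

lemma IsClosed.crease_even (hα : IsClosed α) {c : ℕ} (h : c < α.length) (e : Even c) :
    sectorLo α c = creasePos α c ∧ sectorLo α (prevSector α c) = creasePos α c := by
  refine ⟨(hα.sector_even h e).1, ?_⟩
  rw [(hα.sector_odd (hα.prev_lt c) (by rw [hα.even_prev h]; tauto)).1, hα.creasePos_prev h]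

lemma IsClosed.crease_odd (hα : IsClosed α) {c : ℕ} (h : c < α.length) (e : ¬ Even c) :
    sectorHi α c = creasePos α c ∧ sectorHi α (prevSector α c) = creasePos α c := by
  refine ⟨(hα.sector_odd h e).2, ?_⟩
  rw [(hα.sector_even (hα.prev_lt c) (by rw [hα.even_prev h]; tauto)).2, hα.creasePos_prev h]

lemma IsClosed.joined (hα : IsClosed α) :
    Joined (sectorLo α) (sectorHi α) (RightJoint α) (LeftJoint α) where
  right := by
    rintro u v ⟨c, hc, e, ⟨rfl, rfl⟩ | ⟨rfl, rfl⟩⟩ <;>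
    · obtain ⟨h1, h2⟩ := hα.crease_even hc e
      exact ⟨by rw [h1, h2], hα.lo_lt_hi (by first | exact hc | exact hα.prev_lt _),
        hα.lo_lt_hi (by first | exact hc | exact hα.prev_lt _)⟩
  left := by
    rintro u v ⟨c, hc, e, ⟨rfl, rfl⟩ | ⟨rfl, rfl⟩⟩ <;>
    · obtain ⟨h1, h2⟩ := hα.crease_odd hc e
      exact ⟨by rw [h1, h2], hα.lo_lt_hi (by first | exact hc | exact hα.prev_lt _),
        hα.lo_lt_hi (by first | exact hc | exact hα.prev_lt _)⟩
  finite := by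
    refine (Set.finite_lt_nat α.length).subset fun i hi => ?_
    obtain ⟨z, hz⟩ := exists_between (show sectorLo α i < sectorHi α i from hi)
    exact lt_length_of_mem hz

lemma IsStack.isFlatFolding (hα : IsClosed α) {below : ℕ → ℕ → Prop} (h : IsStack α below) :
    IsFlatFolding α below where
  closed := hα.closed
  total i _ j _ hij := fun ⟨z, hi, hj⟩ => h.total i j z hij hi hj
  trans i _ j _ k _ := fun ⟨z, ⟨hi, hj⟩, hk⟩ => h.trans i j k z hi hj hk
  crease_sector c hc k _ hk := by
    by_cases e : Even c
    · refine h.right_sector _ _ k ⟨c, hc, e, Or.inl ⟨rfl, rfl⟩⟩ ?_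
      rw [(hα.crease_even hc e).2]; exact hk
    · refine h.left_sector _ _ k ⟨c, hc, e, Or.inl ⟨rfl, rfl⟩⟩ ?_
      rw [(hα.crease_odd hc e).2]; exact hk
  crease_crease c hc d hd _ hcd ep := by
    by_cases e : Even c
    · have e' := hcd.1 e
      exact h.right_right _ _ _ _ ⟨c, hc, e, Or.inl ⟨rfl, rfl⟩⟩ ⟨d, hd, e', Or.inl ⟨rfl, rfl⟩⟩
        (by rw [(hα.crease_even hc e).2, (hα.crease_even hd e').2, ep])
    · have e' := fun h => e (hcd.2 h)
      exact h.left_left _ _ _ _ ⟨c, hc, e, Or.inl ⟨rfl, rfl⟩⟩ ⟨d, hd, e', Or.inl ⟨rfl, rfl⟩⟩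
        (by rw [(hα.crease_odd hc e).2, (hα.crease_odd hd e').2, ep])

lemma IsClosed.prev_ne (hα : IsClosed α) {c : ℕ} (h : c < α.length) : prevSector α c ≠ c := by
  intro e
  have := hα.even_prev h
  rw [e] at this
  tauto

lemma between_and_ne (b : ℕ → ℕ → Prop) {u v k : ℕ} (h1 : k ≠ u) (h2 : k ≠ v) :
    Between (fun i j => i ≠ j ∧ b i j) u v k ↔ Between b u v k := by
  have := h1.symm
  have := h2.symm
  unfold Between
  tauto

lemma IsFlatFolding.isStack (hα : IsClosed α) {below : ℕ → ℕ → Prop}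
    (h : IsFlatFolding α below) : IsStack α (fun i j => i ≠ j ∧ below i j) := by
  have sec : ∀ c < α.length, ∀ k, creasePos α c ∈ Set.Ioo (sectorLo α k) (sectorHi α k) →
      ¬ Between (fun i j => i ≠ j ∧ below i j) (prevSector α c) c k := by
    intro c hc k hk hB
    refine h.crease_sector c hc k (lt_length_of_mem hk) hk ?_
    unfold Between at hB ⊢
    tauto
  have cr : ∀ c < α.length, ∀ d < α.length, (Even c ↔ Even d) →
      creasePos α c = creasePos α d →
      (Between (fun i j => i ≠ j ∧ below i j) (prevSector α c) c (prevSector α d) ↔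
        Between (fun i j => i ≠ j ∧ below i j) (prevSector α c) c d) := by
    intro c hc d hd e ep
    by_cases hcd : c = d
    · subst hcd
      simp [Between]
    · have pc := hα.even_prev hc
      have pd := hα.even_prev hd
      have qc := prevSector_eq α hc
      have qd := prevSector_eq α hd
      have n1 : prevSector α d ≠ prevSector α c := by omega
      have n2 : prevSector α d ≠ c := by intro e'; rw [e'] at pd; tauto
      have n3 : d ≠ prevSector α c := by intro e'; rw [← e'] at pc; tauto
      rw [between_and_ne _ n1 n2, between_and_ne _ n3 (Ne.symm hcd)]
      exact h.crease_crease c hc d hd hcd e ep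
  refine ⟨fun i hi => hi.1 rfl, ?_, ?_, ?_, ?_, ?_, ?_⟩
  · intro i j z hij hi hj
    have := h.total i (lt_length_of_mem hi) j (lt_length_of_mem hj) hij ⟨z, hi, hj⟩
    have := hij.symm
    tauto
  · rintro i j k z hi hj hk ⟨n1, h1⟩ ⟨n2, h2⟩
    refine ⟨?_, h.trans i (lt_length_of_mem hi) j (lt_length_of_mem hj) k (lt_length_of_mem hk)
      ⟨z, ⟨hi, hj⟩, hk⟩ h1 h2⟩
    rintro rfl
    exact (h.total i (lt_length_of_mem hi) j (lt_length_of_mem hj) n1 ⟨z, hi, hj⟩).1 h1 h2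
  · rintro u v k ⟨c, hc, e, ⟨rfl, rfl⟩ | ⟨rfl, rfl⟩⟩ hk
    · rw [(hα.crease_even hc e).2] at hk
      exact sec _ hc k hk
    · rw [(hα.crease_even hc e).1] at hk
      rw [between_comm]
      exact sec _ hc k hk
  · rintro u v k ⟨c, hc, e, ⟨rfl, rfl⟩ | ⟨rfl, rfl⟩⟩ hk
    · rw [(hα.crease_odd hc e).2] at hk
      exact sec _ hc k hk
    · rw [(hα.crease_odd hc e).1] at hk
      rw [between_comm]
      exact sec _ hc k hk
  · rintro u v u' v' ⟨c, hc, e, hu⟩ ⟨d, hd, e', hu'⟩ ep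
    have := cr c hc d hd (iff_of_true e e') (by
      rcases hu with ⟨rfl, rfl⟩ | ⟨rfl, rfl⟩ <;> rcases hu' with ⟨rfl, rfl⟩ | ⟨rfl, rfl⟩ <;>
      simpa only [hα.crease_even hc e, hα.crease_even hd e'] using ep)
    rcases hu with ⟨rfl, rfl⟩ | ⟨rfl, rfl⟩ <;> rcases hu' with ⟨rfl, rfl⟩ | ⟨rfl, rfl⟩
    · exact this
    · exact this.symm
    · rw [between_comm, this, between_comm]
    · rw [between_comm, ← this, between_comm]
  · rintro u v u' v' ⟨c, hc, e, hu⟩ ⟨d, hd, e', hu'⟩ ep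
    have := cr c hc d hd (iff_of_false e e') (by
      rcases hu with ⟨rfl, rfl⟩ | ⟨rfl, rfl⟩ <;> rcases hu' with ⟨rfl, rfl⟩ | ⟨rfl, rfl⟩ <;>
      simpa only [hα.crease_odd hc e, hα.crease_odd hd e'] using ep)
    rcases hu with ⟨rfl, rfl⟩ | ⟨rfl, rfl⟩ <;> rcases hu' with ⟨rfl, rfl⟩ | ⟨rfl, rfl⟩
    · exact this
    · exact this.symm
    · rw [between_comm, this, between_comm]
    · rw [between_comm, ← this, between_comm]

/-- A vertex given by the list of its angles, each together with the type of the crease that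
precedes it, is validly folded. -/
def Valid (l : List (ℝ × MV)) : Prop :=
  IsClosed (l.map Prod.fst) ∧ ∃ below, IsStack (l.map Prod.fst) below ∧
    ∀ c x, l[c]? = some x → (x.2 = MV.valley ↔ IsValley (l.map Prod.fst) below c)

/-- The angles `α` together with the crease types `f`. -/
def withCreases (α : List ℝ) (f : Fin α.length → MV) : List (ℝ × MV) :=
  List.ofFn fun i => (α[i], f i)

lemma map_fst_withCreases (α : List ℝ) (f : Fin α.length → MV) :
    (withCreases α f).map Prod.fst = α := by
  simp [withCreases, List.map_ofFn, Function.comp_def]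

lemma getElem?_withCreases (α : List ℝ) (f : Fin α.length → MV) {c : ℕ} (h : c < α.length) :
    (withCreases α f)[c]? = some (α[c], f ⟨c, h⟩) := by
  simp [withCreases, h]

lemma isValid_iff (he : Even α.length) (h0 : 0 < α.length) (hp : ∀ a ∈ α, 0 < a)
    (f : Fin α.length → MV) : IsValid α f ↔ Valid (withCreases α f) := by
  unfold Valid
  rw [map_fst_withCreases]
  constructor
  · rintro ⟨below, hb, hv⟩
    have hα : IsClosed α := ⟨h0, he, hp, hb.closed⟩
    refine ⟨hα, _, hb.isStack hα, fun c x hx => ?_⟩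
    have hc : c < α.length := by
      have := (List.getElem?_eq_some_iff.1 hx).1
      simpa [withCreases] using this
    rw [getElem?_withCreases α f hc, Option.some_inj] at hx
    rw [← hx]
    have := hv ⟨c, hc⟩
    have n1 := hα.prev_ne hc
    have n2 := n1.symm
    rw [this]
    unfold IsValley
    tauto
  · rintro ⟨hα, below, hb, hv⟩
    exact ⟨below, hb.isFlatFolding hα, fun c => hv c _ (getElem?_withCreases α f c.2)⟩

end

section

/-! ### Crimping a vertex -/

/-- The old index of a sector or crease after a crimp at sector `1`; the crimped sector `0` is
represented by the old sector `0`. -/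
def crimpIndex (i : ℕ) : ℕ := if i = 0 then 0 else i + 2

lemma crimpIndex_zero : crimpIndex 0 = 0 := rfl

lemma crimpIndex_of_ne {i : ℕ} (h : i ≠ 0) : crimpIndex i = i + 2 := by simp [crimpIndex, h]

lemma even_crimpIndex (i : ℕ) : Even (crimpIndex i) ↔ Even i := by
  unfold crimpIndex
  split_ifs with h
  · rw [h]
  · simp [Nat.even_add]

variable {x a y : ℝ} {t : List ℝ}

lemma creasePos_crimp (c : ℕ) (hc : c ≠ 0) :
    creasePos (x :: a :: y :: t) (c + 2) = creasePos ((x - a + y) :: t) c := by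
  obtain ⟨c, rfl⟩ := Nat.exists_eq_succ_of_ne_zero hc
  simp only [Nat.succ_eq_add_one, creasePos_cons_succ]
  ring

lemma isClosed_crimp (ha : 0 < a) (hx : a ≤ x) (hy : a ≤ y) :
    IsClosed (x :: a :: y :: t) ↔ IsClosed ((x - a + y) :: t) := by
  constructor
  · rintro ⟨-, h2, h3, h4⟩
    refine ⟨by simp, by simpa [Nat.even_add_one] using h2, ?_, ?_⟩
    · intro b hb
      rcases List.mem_cons.1 hb with rfl | hb
      · linarith
      · exact h3 b (by simp [hb])
    · rw [← creasePos_crimp _ (by simp)]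
      simpa using h4
  · rintro ⟨-, h2, h3, h4⟩
    refine ⟨by simp, by simpa [Nat.even_add_one] using h2, ?_, ?_⟩
    · intro b hb
      simp only [List.mem_cons] at hb
      rcases hb with rfl | rfl | rfl | hb
      · linarith
      · exact ha
      · linarith
      · exact h3 b (by simp [hb])
    · rw [← creasePos_crimp _ (by simp)] at h4
      simpa using h4

lemma prevSector_crimp (ht : t ≠ []) {c : ℕ} (hc : c < t.length + 1) :
    (c ≠ 1 → prevSector (x :: a :: y :: t) (crimpIndex c) =
      crimpIndex (prevSector ((x - a + y) :: t) c)) ∧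
    (c ≠ 0 → prevSector (x :: a :: y :: t) (c + 2) = prevSector ((x - a + y) :: t) c + 2) := by
  have hl := List.length_pos_of_ne_nil ht
  have h1 := prevSector_eq ((x - a + y) :: t) (c := c) (by simpa using hc)
  have h2 := prevSector_eq (x :: a :: y :: t) (c := c + 2) (by simp; omega)
  have h3 := prevSector_zero (x :: a :: y :: t) (by simp)
  simp only [List.length_cons] at h1 h2 h3
  refine ⟨fun hc1 => ?_, fun hc0 => by omega⟩
  by_cases e : c = 0
  · subst e
    rw [crimpIndex_zero, h3, crimpIndex_of_ne (by omega)]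
    omega
  · rw [crimpIndex_of_ne e, crimpIndex_of_ne (by omega)]
    omega

lemma prevSector_one (x a : ℝ) (t : List ℝ) : prevSector (x :: a :: t) 1 = 0 :=
  prevSector_succ _ (by simp)

lemma prevSector_two (x a y : ℝ) (t : List ℝ) : prevSector (x :: a :: y :: t) 2 = 1 :=
  prevSector_succ _ (by simp)

/-- The geometric crimp at a sector that is no larger than its neighbours. -/
lemma crimp_vertex (hc : IsClosed (x :: a :: y :: t)) (hx : a ≤ x) (hy : a ≤ y) (ht : t ≠ []) :
    Crimp (sectorLo (x :: a :: y :: t)) (sectorHi (x :: a :: y :: t))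
      (RightJoint (x :: a :: y :: t)) (LeftJoint (x :: a :: y :: t)) 0 1 2 0 crimpIndex (· + 2)
      (RightJoint ((x - a + y) :: t)) (LeftJoint ((x - a + y) :: t)) := by
  have ha : 0 < a := hc.pos a (by simp)
  have p0 : creasePos (x :: a :: y :: t) 0 = 0 := creasePos_zero _
  have p1 : creasePos (x :: a :: y :: t) 1 = x := by simp [creasePos_cons_succ, creasePos_zero]
  have p2 : creasePos (x :: a :: y :: t) 2 = x - a := by simp [creasePos_cons_succ, creasePos_zero]
  have p3 : creasePos (x :: a :: y :: t) 3 = x - a + y := by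
    simp [creasePos_cons_succ, creasePos_zero]; ring
  have l0 : sectorLo (x :: a :: y :: t) 0 = 0 := by
    rw [sectorLo, p0, p1, min_eq_left]; linarith
  have h0 : sectorHi (x :: a :: y :: t) 0 = x := by
    rw [sectorHi, p0, p1, max_eq_right]; linarith
  have l1 : sectorLo (x :: a :: y :: t) 1 = x - a := by
    rw [sectorLo, p1, p2, min_eq_right]; linarith
  have h1 : sectorHi (x :: a :: y :: t) 1 = x := by
    rw [sectorHi, p1, p2, max_eq_left]; linarith
  have l2 : sectorLo (x :: a :: y :: t) 2 = x - a := by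
    rw [sectorLo, p2, p3, min_eq_left]; linarith
  have h2 : sectorHi (x :: a :: y :: t) 2 = x - a + y := by
    rw [sectorHi, p2, p3, max_eq_right]; linarith
  have len : (x :: a :: y :: t).length = t.length + 3 := rfl
  have len' : ((x - a + y) :: t).length = t.length + 1 := rfl
  exact {
    lo_p := by rw [l0, l1]; linarith
    hi_p := by rw [h0, h1]
    lo_q := by rw [l2, l1]
    hi_q := by rw [h1, h2]; linarith
    lt := by rw [l1, h1]; linarith
    left := Or.inl ⟨1, by simp, by decide, Or.inl ⟨(prevSector_one _ _ _).symm, rfl⟩⟩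
    right := Or.inl ⟨2, by simp, by decide, Or.inl ⟨(prevSector_two _ _ _ _).symm, rfl⟩⟩
    map_N := rfl
    map_N' := rfl
    map_eq := fun i hi => (crimpIndex_of_ne hi).symm
    map_ne := fun i hi => by rw [crimpIndex_of_ne hi]; omega
    inj := fun i j hi hj => by rw [crimpIndex_of_ne hi, crimpIndex_of_ne hj]; omega
    surj := fun i => by
      by_cases h : i < 3
      · omega
      · exact Or.inr (Or.inr (Or.inr ⟨i - 2, by omega, by rw [crimpIndex_of_ne] <;> omega⟩))
    map_R := by
      rintro u v ⟨c, hc, e, h⟩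
      have := (prevSector_crimp (x := x) (a := a) (y := y) ht hc).1 (by rintro rfl; simp at e)
      refine ⟨crimpIndex c, ?_, (even_crimpIndex c).2 e, ?_⟩
      · rw [len] ; rw [len'] at hc; unfold crimpIndex; split_ifs <;> omega
      · rw [this]
        rcases h with ⟨rfl, rfl⟩ | ⟨rfl, rfl⟩ <;> tauto
    map_L := by
      rintro u v ⟨c, hc, e, h⟩
      have := (prevSector_crimp (x := x) (a := a) (y := y) ht hc).2 (by rintro rfl; simp at e)
      refine ⟨c + 2, ?_, by simpa [Nat.even_add] using e, ?_⟩
      · rw [len] ; rw [len'] at hc; omega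
      · rw [this]
        rcases h with ⟨rfl, rfl⟩ | ⟨rfl, rfl⟩ <;> tauto
    surj_R := by
      rintro u v ⟨c, hc, e, h⟩
      by_cases c2 : c = 2
      · subst c2
        rw [prevSector_two] at h
        tauto
      · right; right
        obtain ⟨c', hc', rfl⟩ : ∃ c', c' < t.length + 1 ∧ c = crimpIndex c' := by
          by_cases c0 : c = 0
          · exact ⟨0, by omega, c0⟩
          · have : c ≠ 1 := by rintro rfl; simp at e
            exact ⟨c - 2, by rw [len] at hc; omega, by rw [crimpIndex_of_ne] <;> omega⟩
        have e' := (even_crimpIndex c').1 e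
        have := (prevSector_crimp (x := x) (a := a) (y := y) ht hc').1 (by rintro rfl; simp at e')
        rw [this] at h
        rcases h with ⟨rfl, rfl⟩ | ⟨rfl, rfl⟩
        · exact ⟨_, _, ⟨c', hc', e', Or.inl ⟨rfl, rfl⟩⟩, rfl, rfl⟩
        · exact ⟨_, _, ⟨c', hc', e', Or.inr ⟨rfl, rfl⟩⟩, rfl, rfl⟩
    surj_L := by
      rintro u v ⟨c, hc, e, h⟩
      by_cases c1 : c = 1
      · subst c1
        rw [prevSector_one] at h
        tauto
      · right; right
        obtain ⟨c', hc', rfl⟩ : ∃ c', c' < t.length + 1 ∧ c = c' + 2 := by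
          have : c ≠ 0 := by rintro rfl; simp at e
          exact ⟨c - 2, by rw [len] at hc; omega, by omega⟩
        have e' : ¬ Even c' := by simpa [Nat.even_add] using e
        have := (prevSector_crimp (x := x) (a := a) (y := y) ht hc').2 (by rintro rfl; simp at e')
        rw [this] at h
        rcases h with ⟨rfl, rfl⟩ | ⟨rfl, rfl⟩
        · exact ⟨_, _, ⟨c', hc', e', Or.inl ⟨rfl, rfl⟩⟩, rfl, rfl⟩
        · exact ⟨_, _, ⟨c', hc', e', Or.inr ⟨rfl, rfl⟩⟩, rfl, rfl⟩
    ne_ps := by decide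
    ne_sq := by decide
    ne_pq := by decide }

lemma sectorLo_crimp (hc : IsClosed (x :: a :: y :: t)) (hx : a ≤ x) (hy : a ≤ y) :
    sectorLo ((x - a + y) :: t) = fun i => sectorLo (x :: a :: y :: t) (crimpIndex i) := by
  have ha : 0 < a := hc.pos a (by simp)
  funext i
  by_cases e : i = 0
  · subst e
    simp only [crimpIndex_zero, sectorLo, creasePos_zero, creasePos_cons_succ]
    rw [min_eq_left, min_eq_left] <;> linarith
  · rw [crimpIndex_of_ne e, sectorLo, sectorLo, creasePos_crimp _ e,
      show i + 2 + 1 = i + 1 + 2 by omega, creasePos_crimp _ (by omega)]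

lemma sectorHi_crimp (hc : IsClosed (x :: a :: y :: t)) (hx : a ≤ x) (hy : a ≤ y) :
    sectorHi ((x - a + y) :: t) = fun i => sectorHi (x :: a :: y :: t) (i + 2) := by
  have ha : 0 < a := hc.pos a (by simp)
  funext i
  by_cases e : i = 0
  · subst e
    simp only [sectorHi, creasePos_zero, creasePos_cons_succ]
    rw [max_eq_right, max_eq_right] <;> linarith
  · rw [sectorHi, sectorHi, creasePos_crimp _ e,
      show i + 2 + 1 = i + 1 + 2 by omega, creasePos_crimp _ (by omega)]

/-- `below` and `below'` agree on the senses of all the creases that survive a crimp. -/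
def SameSense (x a y : ℝ) (t : List ℝ) (below below' : ℕ → ℕ → Prop) : Prop :=
  (∀ u v, RightJoint ((x - a + y) :: t) u v →
    (below' u v ↔ below (crimpIndex u) (crimpIndex v))) ∧
  (∀ u v, LeftJoint ((x - a + y) :: t) u v → (below' u v ↔ below (u + 2) (v + 2)))

lemma RightJoint.symm {α : List ℝ} {u v : ℕ} : RightJoint α u v → RightJoint α v u :=
  fun ⟨c, hc, e, h⟩ => ⟨c, hc, e, by tauto⟩

lemma LeftJoint.symm {α : List ℝ} {u v : ℕ} : LeftJoint α u v → LeftJoint α v u :=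
  fun ⟨c, hc, e, h⟩ => ⟨c, hc, e, by tauto⟩

lemma SameSense.flip {below below' : ℕ → ℕ → Prop} (h : SameSense x a y t below below') :
    SameSense x a y t (fun i j => below j i) (fun i j => below' j i) :=
  ⟨fun u v huv => h.1 v u huv.symm, fun u v huv => h.2 v u huv.symm⟩

lemma IsStack.exists_crimp (hc : IsClosed (x :: a :: y :: t)) (hx : a ≤ x) (hy : a ≤ y)
    (ht : t ≠ []) {below : ℕ → ℕ → Prop} (h : IsStack (x :: a :: y :: t) below)
    (hb : (below 0 1 ∧ below 1 2) ∨ (below 1 0 ∧ below 2 1)) :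
    ∃ below', IsStack ((x - a + y) :: t) below' ∧ SameSense x a y t below below' := by
  have cr := crimp_vertex hc hx hy ht
  have key : ∀ below : ℕ → ℕ → Prop, IsStack (x :: a :: y :: t) below → below 0 1 → below 1 2 →
      ∃ below', IsStack ((x - a + y) :: t) below' ∧ SameSense x a y t below below' := by
    intro below h h1 h2
    refine ⟨_, ?_, fun u v huv => ((cr.right_conditions h hc.joined h1 h2).1 u v huv).1,
      fun u v huv => cr.crimpBelow_iff_of_left h hc.joined h1 h2 huv⟩
    have := cr.layered h hc.joined h1 h2
    unfold IsStack
    rw [sectorLo_crimp hc hx hy, sectorHi_crimp hc hx hy]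
    exact this
  rcases hb with hb | hb
  · exact key below h hb.1 hb.2
  · obtain ⟨b, h1, h2⟩ := key _ h.flip hb.1 hb.2
    exact ⟨_, h1.flip, h2.flip⟩

lemma IsStack.exists_uncrimp (hc : IsClosed (x :: a :: y :: t)) (hx : a ≤ x) (hy : a ≤ y)
    (ht : t ≠ []) {below' : ℕ → ℕ → Prop} (h : IsStack ((x - a + y) :: t) below') :
    ∃ below, IsStack (x :: a :: y :: t) below ∧ SameSense x a y t below below' ∧
      below 0 1 ∧ below 1 2 := by
  have cr := crimp_vertex hc hx hy ht
  obtain ⟨τ, hτ⟩ := cr.exists_collapse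
  unfold IsStack at h
  rw [sectorLo_crimp hc hx hy, sectorHi_crimp hc hx hy] at h
  refine ⟨_, cr.layered_uncrimp hτ h hc.joined, ⟨fun u v _ => (cr.uncrimpBelow_map hτ u v).symm,
    fun u v _ => ?_⟩, Or.inr (Or.inl ⟨rfl, rfl⟩), Or.inr (Or.inr (Or.inl ⟨rfl, rfl⟩))⟩
  rw [← uncrimpBelow_mirror]
  exact (cr.mirror.uncrimpBelow_map (below := fun i j => below' j i) (hτ.mirror cr) v u).symm

lemma SameSense.isValley_iff {below below' : ℕ → ℕ → Prop} (h : SameSense x a y t below below')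
    (ht : t ≠ []) {c : ℕ} (hc : c < t.length + 1) :
    IsValley (x :: a :: y :: t) below (crimpIndex c) ↔
      IsValley ((x - a + y) :: t) below' c := by
  unfold IsValley
  rw [even_crimpIndex]
  by_cases e : Even c
  · have h1 := (prevSector_crimp (x := x) (a := a) (y := y) ht hc).1 (by rintro rfl; simp at e)
    have h2 := h.1 c (prevSector ((x - a + y) :: t) c) ⟨c, hc, e, Or.inr ⟨rfl, rfl⟩⟩
    rw [h1, h2]
    tauto
  · have c0 : c ≠ 0 := by rintro rfl; simp at e
    have h1 := (prevSector_crimp (x := x) (a := a) (y := y) ht hc).2 c0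
    have h2 := h.2 (prevSector ((x - a + y) :: t) c) c ⟨c, hc, e, Or.inl ⟨rfl, rfl⟩⟩
    rw [crimpIndex_of_ne c0, h1, h2]
    tauto

lemma isValley_one (x a : ℝ) (t : List ℝ) (below : ℕ → ℕ → Prop) :
    IsValley (x :: a :: t) below 1 ↔ below 0 1 := by
  simp [IsValley, prevSector_one]

lemma isValley_two (x a y : ℝ) (t : List ℝ) (below : ℕ → ℕ → Prop) :
    IsValley (x :: a :: y :: t) below 2 ↔ below 2 1 := by
  simp [IsValley, prevSector_two]

lemma valley_iff_ne {e f : MV} (h : e ≠ f) : (e = MV.valley ↔ f ≠ MV.valley) := by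
  cases e <;> cases f <;> simp_all

/-- The crimp: a sector that is no larger than its neighbours and whose two creases are of
different types may be folded away. -/
theorem valid_crimp {e₀ e₁ e₂ : MV} {T : List (ℝ × MV)} (ha : 0 < a) (hx : a ≤ x) (hy : a ≤ y)
    (he : e₁ ≠ e₂) :
    Valid ((x, e₀) :: (a, e₁) :: (y, e₂) :: T) ↔ Valid ((x - a + y, e₀) :: T) := by
  by_cases hT : T = []
  · subst hT
    refine iff_of_false (fun h => ?_) (fun h => ?_)
    · have := h.1.even; simp [Nat.even_iff] at this
    · have := h.1.even; simp at this
  have ht : T.map Prod.fst ≠ [] := by simpa using hT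
  -- the creases that survive
  have lookup : ∀ (c : ℕ) (z : ℝ × MV), c ≠ 0 →
      (((x - a + y, e₀) :: T)[c]? = some z ↔
        ((x, e₀) :: (a, e₁) :: (y, e₂) :: T)[c + 2]? = some z) := by
    intro c z hc
    obtain ⟨c, rfl⟩ := Nat.exists_eq_succ_of_ne_zero hc
    simp
  unfold Valid
  simp only [List.map_cons]
  constructor
  · rintro ⟨hc, below, hb, hv⟩
    have v1 := hv 1 _ rfl
    have v2 := hv 2 _ rfl
    rw [isValley_one] at v1
    rw [isValley_two] at v2
    simp only at v1 v2
    have cr := crimp_vertex hc hx hy ht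
    obtain ⟨z, hz⟩ := exists_between cr.lt
    have zs : z ∈ Set.Ioo _ _ := hz
    obtain ⟨zp, zq⟩ := cr.mem_of_mem zs
    have t1 := hb.total 0 1 z (by decide) zp zs
    have t2 := hb.total 1 2 z (by decide) zs zq
    have hne := valley_iff_ne he
    obtain ⟨b, h1, h2⟩ := hb.exists_crimp hc hx hy ht (by tauto)
    refine ⟨(isClosed_crimp ha hx hy).1 hc, b, h1, fun c w hw => ?_⟩
    have hlt : c < (T.map Prod.fst).length + 1 := by
      have := (List.getElem?_eq_some_iff.1 hw).1
      simpa using this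
    rw [← h2.isValley_iff ht hlt]
    by_cases c0 : c = 0
    · subst c0
      have := hv 0 _ rfl
      simp only [List.getElem?_cons_zero, Option.some_inj] at hw
      rw [← hw]
      exact this
    · rw [crimpIndex_of_ne c0]
      exact hv _ w ((lookup c w c0).1 hw)
  · rintro ⟨hc', below', hb', hv⟩
    have hc := (isClosed_crimp ha hx hy).2 hc'
    obtain ⟨below, hb, hs, hv1, hv2⟩ : ∃ below, IsStack (x :: a :: y :: T.map Prod.fst) below ∧
        SameSense x a y (T.map Prod.fst) below below' ∧ (e₁ = MV.valley ↔ below 0 1) ∧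
        (e₂ = MV.valley ↔ below 2 1) := by
      have cr := crimp_vertex hc hx hy ht
      obtain ⟨z, hz⟩ := exists_between cr.lt
      have zs : z ∈ Set.Ioo _ _ := hz
      obtain ⟨zp, zq⟩ := cr.mem_of_mem zs
      have hne := valley_iff_ne he
      by_cases e1 : e₁ = MV.valley
      · obtain ⟨b, h1, h2, h3, h4⟩ := hb'.exists_uncrimp hc hx hy ht
        have t2 := h1.total 1 2 z (by decide) zs zq
        exact ⟨b, h1, h2, by tauto, by tauto⟩
      · obtain ⟨b, h1, h2, h3, h4⟩ := IsStack.exists_uncrimp hc hx hy ht hb'.flip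
        have t1 := h1.total 0 1 z (by decide) zp zs
        exact ⟨_, h1.flip, h2.flip, by tauto, by tauto⟩
    refine ⟨hc, below, hb, fun c w hw => ?_⟩
    by_cases c1 : c = 1
    · subst c1
      simp only [List.getElem?_cons_succ, List.getElem?_cons_zero, Option.some_inj] at hw
      rw [isValley_one, ← hw]
      exact hv1
    by_cases c2 : c = 2
    · subst c2
      simp only [List.getElem?_cons_succ, List.getElem?_cons_zero, Option.some_inj] at hw
      rw [isValley_two, ← hw]
      exact hv2
    have hlt := (List.getElem?_eq_some_iff.1 hw).1
    by_cases c0 : c = 0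
    · subst c0
      have := hv 0 _ rfl
      simp only [List.getElem?_cons_zero, Option.some_inj] at hw
      rw [← hw, ← crimpIndex_zero, hs.isValley_iff ht (by simp)]
      exact this
    · obtain ⟨c, rfl⟩ : ∃ d, c = d + 2 := ⟨c - 2, by omega⟩
      have c0' : c ≠ 0 := by omega
      rw [← crimpIndex_of_ne c0', hs.isValley_iff ht (by simp at hlt ⊢; omega)]
      exact hv c w ((lookup c w c0').2 hw)

end

section

/-! ### Rotating the list of angles -/

/-- A layered family pulled back along a reflection `z ↦ a - z` of the line, upside down. -/
lemma Layered.reflect {lo hi lo' hi' : ℕ → ℝ} {R L R' L' below : ℕ → ℕ → Prop}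
    (h : Layered lo hi R L below) (a : ℝ) (σ : ℕ → ℕ)
    (hI : ∀ i, lo' i < hi' i → lo' i = a - hi (σ i) ∧ hi' i = a - lo (σ i))
    (hinj : ∀ i j, lo' i < hi' i → lo' j < hi' j → σ i = σ j → i = j)
    (hJ : Joined lo' hi' R' L')
    (hR : ∀ u v, R' u v → L (σ u) (σ v)) (hL : ∀ u v, L' u v → R (σ u) (σ v)) :
    Layered lo' hi' R' L' (fun i j => below (σ j) (σ i)) := by
  have mem : ∀ i z, z ∈ Set.Ioo (lo' i) (hi' i) → a - z ∈ Set.Ioo (lo (σ i)) (hi (σ i)) := by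
    intro i z hz
    obtain ⟨h1, h2⟩ := hI i (hz.1.trans hz.2)
    rw [h1, h2] at hz
    exact ⟨by linarith [hz.2], by linarith [hz.1]⟩
  refine ⟨fun i => h.irrefl _, ?_, ?_, ?_, ?_, ?_, ?_⟩
  · intro i j z hij hi' hj'
    exact h.flip.total _ _ (a - z)
      (fun e => hij (hinj i j (hi'.1.trans hi'.2) (hj'.1.trans hj'.2) e))
      (mem i z hi') (mem j z hj')
  · intro i j k z hi' hj' hk'
    exact h.flip.trans _ _ _ (a - z) (mem i z hi') (mem j z hj') (mem k z hk')
  · intro u v k huv hk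
    have hk' := mem k _ hk
    rw [(hI u (hJ.right u v huv).2.1).1, sub_sub_cancel] at hk'
    exact h.flip.left_sector _ _ _ (hR u v huv) hk'
  · intro u v k huv hk
    have hk' := mem k _ hk
    rw [(hI u (hJ.left u v huv).2.1).2, sub_sub_cancel] at hk'
    exact h.flip.right_sector _ _ _ (hL u v huv) hk'
  · intro u v u' v' huv huv' e
    rw [(hI u (hJ.right u v huv).2.1).1, (hI u' (hJ.right u' v' huv').2.1).1] at e
    exact h.flip.left_left _ _ _ _ (hR u v huv) (hR u' v' huv') (by linarith)
  · intro u v u' v' huv huv' e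
    rw [(hI u (hJ.left u v huv).2.1).2, (hI u' (hJ.left u' v' huv').2.1).2] at e
    exact h.flip.right_right _ _ _ _ (hL u v huv) (hL u' v' huv') (by linarith)

variable {a : ℝ} {t : List ℝ}

/-- The next sector in the cyclic order. -/
def nextSector (n i : ℕ) : ℕ := if i + 1 = n then 0 else i + 1

lemma creasePos_append {s : List ℝ} {c : ℕ} (h : c ≤ t.length) :
    creasePos (t ++ s) c = creasePos t c := by
  unfold creasePos
  refine Finset.sum_congr rfl fun i hi => ?_
  rw [List.getD_append _ _ _ _ (by rw [Finset.mem_range] at hi; omega)]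

lemma IsClosed.creasePos_rotate (h : IsClosed (a :: t)) {c : ℕ} (hc : c < t.length + 1) :
    creasePos (t ++ [a]) c = a - creasePos (a :: t) (nextSector (t.length + 1) c) ∧
    creasePos (t ++ [a]) (c + 1) = a - creasePos (a :: t) (nextSector (t.length + 1) c + 1) := by
  have key : ∀ c < t.length + 1, creasePos (t ++ [a]) c = a - creasePos (a :: t) (c + 1) := by
    intro c hc
    rw [creasePos_append (by omega), creasePos_cons_succ]
    ring
  have h0 := h.closed
  have he := h.even
  rw [List.length_cons] at h0 he
  unfold nextSector
  by_cases e : c + 1 = t.length + 1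
  · rw [if_pos e, key c hc, e, h0, creasePos_zero, creasePos_succ _ t.length, key _ (by omega), h0,
      creasePos_cons_succ, creasePos_zero, List.getD_append_right _ _ _ _ le_rfl]
    have : Odd t.length := by
      rw [← Nat.not_even_iff_odd]; rw [Nat.even_add_one] at he; exact he
    simp [this.neg_one_pow]
  · rw [if_neg e]
    exact ⟨key c hc, key (c + 1) (by omega)⟩

lemma IsClosed.rotate (h : IsClosed (a :: t)) : IsClosed (t ++ [a]) := by
  refine ⟨by simp, by simpa using h.even, fun b hb => h.pos b (by simpa [or_comm] using hb), ?_⟩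
  rw [List.length_append, List.length_singleton, (h.creasePos_rotate (Nat.lt_succ_self _)).2]
  simp [nextSector, creasePos_cons_succ, creasePos_zero]

lemma prevSector_rotate {c : ℕ} (hc : c < t.length + 1) :
    nextSector (t.length + 1) (prevSector (t ++ [a]) c) = c ∧
    prevSector (a :: t) (nextSector (t.length + 1) c) = c := by
  have h1 := prevSector_eq (t ++ [a]) (c := c) (by simpa using hc)
  have h2 : prevSector (a :: t) (nextSector (t.length + 1) c) = c := by
    unfold nextSector
    split_ifs with e
    · rw [prevSector_zero _ (by simp), List.length_cons]; omega
    · exact prevSector_succ _ hc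
  refine ⟨?_, h2⟩
  simp only [List.length_append, List.length_cons, List.length_nil] at h1
  unfold nextSector
  split_ifs <;> omega

lemma IsClosed.even_nextSector (h : IsClosed (a :: t)) {c : ℕ} :
    Even (nextSector (t.length + 1) c) ↔ ¬ Even c := by
  have he := h.even
  rw [List.length_cons] at he
  unfold nextSector
  split_ifs with e
  · rw [← e, Nat.even_add_one] at he; simpa using he
  · rw [Nat.even_add_one]

lemma nextSector_lt (n : ℕ) {c : ℕ} (hc : c < n) : nextSector n c < n := by
  unfold nextSector; split_ifs <;> omega

lemma IsStack.rotate (hc : IsClosed (a :: t)) {below : ℕ → ℕ → Prop}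
    (h : IsStack (a :: t) below) :
    IsStack (t ++ [a]) (fun i j => below (nextSector (t.length + 1) j)
      (nextSector (t.length + 1) i)) := by
  have lt : ∀ i, sectorLo (t ++ [a]) i < sectorHi (t ++ [a]) i → i < t.length + 1 := by
    intro i hi
    obtain ⟨z, hz⟩ := exists_between hi
    simpa using lt_length_of_mem hz
  refine Layered.reflect h a (nextSector (t.length + 1)) (fun i hi => ?_) (fun i j hi hj e => ?_)
    hc.rotate.joined ?_ ?_
  · obtain ⟨h1, h2⟩ := hc.creasePos_rotate (lt i hi)
    rw [sectorLo, sectorHi, sectorLo, sectorHi, h1, h2, min_sub_sub_left, max_sub_sub_left]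
    exact ⟨rfl, rfl⟩
  · have h1 := lt i hi
    have h2 := lt j hj
    unfold nextSector at e
    split_ifs at e <;> omega
  · rintro u v ⟨c, hcl, e, h⟩
    have hcl' : c < t.length + 1 := by simpa using hcl
    obtain ⟨p1, p2⟩ := prevSector_rotate (a := a) hcl'
    refine ⟨nextSector (t.length + 1) c, nextSector_lt _ hcl',
      by rw [hc.even_nextSector]; tauto, ?_⟩
    rw [p2]
    rcases h with ⟨rfl, rfl⟩ | ⟨rfl, rfl⟩
    · rw [p1]; tauto
    · rw [p1]; tauto
  · rintro u v ⟨c, hcl, e, h⟩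
    have hcl' : c < t.length + 1 := by simpa using hcl
    obtain ⟨p1, p2⟩ := prevSector_rotate (a := a) hcl'
    refine ⟨nextSector (t.length + 1) c, nextSector_lt _ hcl',
      by rw [hc.even_nextSector]; exact e, ?_⟩
    rw [p2]
    rcases h with ⟨rfl, rfl⟩ | ⟨rfl, rfl⟩
    · rw [p1]; tauto
    · rw [p1]; tauto

lemma Valid.rotate_one {z : ℝ × MV} {T : List (ℝ × MV)} (h : Valid (z :: T)) :
    Valid (T ++ [z]) := by
  obtain ⟨hc, below, hb, hv⟩ := h
  rw [List.map_cons] at hc hb hv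
  refine ⟨?_, fun i j => below (nextSector ((T.map Prod.fst).length + 1) j)
    (nextSector ((T.map Prod.fst).length + 1) i), ?_, fun c w hw => ?_⟩
  · simpa using hc.rotate
  · have := hb.rotate hc
    rwa [List.map_append]
  · have hlt : c < (T.map Prod.fst).length + 1 := by
      have := (List.getElem?_eq_some_iff.1 hw).1
      simpa using this
    have hw' : (z :: T)[nextSector ((T.map Prod.fst).length + 1) c]? = some w := by
      rw [List.length_map] at hlt ⊢
      unfold nextSector
      split_ifs with e
      · obtain rfl : c = T.length := by omega
        rw [List.getElem?_append_right le_rfl] at hw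
        simpa using hw
      · rw [List.getElem?_append_left (by omega)] at hw
        simpa using hw
    rw [hv _ w hw', List.map_append, List.map_cons, List.map_nil]
    obtain ⟨p1, p2⟩ := prevSector_rotate (a := z.1) hlt
    unfold IsValley
    simp only [hc.even_nextSector, p1, p2]
    tauto

theorem valid_of_isRotated {l l' : List (ℝ × MV)} (h : l.IsRotated l') (hl : Valid l) :
    Valid l' := by
  obtain ⟨n, rfl⟩ := h
  induction n generalizing l with
  | zero => simpa using hl
  | succ n ih =>
    cases l with
    | nil => simpa using hl
    | cons z T =>
      rw [List.rotate_cons_succ]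
      exact ih hl.rotate_one

theorem valid_iff_of_isRotated {l l' : List (ℝ × MV)} (h : l.IsRotated l') : Valid l ↔ Valid l' :=
  ⟨valid_of_isRotated h, valid_of_isRotated h.symm⟩

end

section

/-! ### Spirals -/

/-- All the creases numbered from `m` to `n` are valleys. -/
def ValleyRun (α : List ℝ) (below : ℕ → ℕ → Prop) (m n : ℕ) : Prop :=
  ∀ c, m ≤ c → c ≤ n → IsValley α below c

lemma joint_succ {α : List ℝ} {c : ℕ} (h : c + 1 < α.length) :
    (Even c → LeftJoint α c (c + 1)) ∧ (¬ Even c → RightJoint α c (c + 1)) := by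
  have hp := prevSector_succ α (c := c) (by omega)
  refine ⟨fun e => ⟨c + 1, h, by rwa [Nat.even_add_one, not_not], Or.inl ⟨hp.symm, rfl⟩⟩,
    fun e => ⟨c + 1, h, by rwa [Nat.even_add_one], Or.inl ⟨hp.symm, rfl⟩⟩⟩

/-- The positions of the creases of a run of equal angles. -/
lemma creasePos_run (x a : ℝ) (k : ℕ) (s : List ℝ) {c : ℕ} (hc : c ≤ k + 1) :
    creasePos (x :: (List.replicate (k + 1) a ++ s)) (c + 1) = if Even c then x else x - a := by
  induction c with
  | zero => simp [creasePos_cons_succ, creasePos_zero]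
  | succ c ih =>
    rw [creasePos_succ, ih (by omega), List.getD_cons_succ,
      List.getD_append _ _ _ _ (by simpa using hc),
      List.getD_replicate _ (by omega)]
    by_cases e : Even c
    · have : ¬ Even (c + 1) := by rw [Nat.even_add_one]; tauto
      rw [if_pos e, if_neg this, (Nat.not_even_iff_odd.1 this).neg_one_pow]
      ring
    · have : Even (c + 1) := by rw [Nat.even_add_one]; exact e
      rw [if_neg e, if_pos this, this.neg_one_pow]
      ring

/-- A run of equal angles between two strictly larger ones cannot have all its creases valleys:
the paper would wind up in a spiral whose inner end, being too long, would pierce it. -/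
lemma IsStack.not_valleyRun {x a y : ℝ} {k : ℕ} {t : List ℝ} (hx : a < x) (hy : a < y)
    (hc : IsClosed (x :: (List.replicate (k + 1) a ++ y :: t))) {below : ℕ → ℕ → Prop}
    (h : IsStack (x :: (List.replicate (k + 1) a ++ y :: t)) below) :
    ¬ ValleyRun (x :: (List.replicate (k + 1) a ++ y :: t)) below 1 (k + 2) := by
  intro hv
  have ha : 0 < a := hc.pos a (by simp)
  have P := fun c (hc : c ≤ k + 1) => creasePos_run x a k (y :: t) hc
  have len : (x :: (List.replicate (k + 1) a ++ y :: t)).length = k + 3 + t.length := by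
    simp; ring
  have hlast : (x :: (List.replicate (k + 1) a ++ y :: t)).getD (k + 2) 0 = y := by
    rw [List.getD_cons_succ, List.getD_append_right _ _ _ _ (by simp)]
    simp
  have Plast := creasePos_succ (x :: (List.replicate (k + 1) a ++ y :: t)) (k + 2)
  rw [hlast, P (k + 1) le_rfl] at Plast
  generalize x :: (List.replicate (k + 1) a ++ y :: t) = α at *
  have P0 := creasePos_zero α
  -- the intervals
  have I0 : sectorLo α 0 = 0 ∧ sectorHi α 0 = x := by
    have := P 0 (by omega)
    have p1 : creasePos α (0 + 1) = x := by simpa using this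
    rw [sectorLo, sectorHi, P0, p1]
    exact ⟨min_eq_left (by linarith), max_eq_right (by linarith)⟩
  have I : ∀ i ≤ k, sectorLo α (i + 1) = x - a ∧ sectorHi α (i + 1) = x := by
    intro i hi
    rw [sectorLo, sectorHi, P i (by omega), P (i + 1) (by omega)]
    by_cases e : Even i
    · have : ¬ Even (i + 1) := by rw [Nat.even_add_one]; tauto
      rw [if_pos e, if_neg this]
      exact ⟨min_eq_right (by linarith), max_eq_left (by linarith)⟩
    · have : Even (i + 1) := by rw [Nat.even_add_one]; exact e
      rw [if_neg e, if_pos this]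
      exact ⟨min_eq_left (by linarith), max_eq_right (by linarith)⟩
  have Ilast : (Even k → sectorLo α (k + 2) = x - a ∧ sectorHi α (k + 2) = x - a + y) ∧
      (¬ Even k → sectorLo α (k + 2) = x - y ∧ sectorHi α (k + 2) = x) := by
    constructor
    · intro e
      have e1 : ¬ Even (k + 1) := by rw [Nat.even_add_one]; tauto
      have e2 : Even (k + 2) := by rw [Nat.even_add_one]; exact e1
      have q := P (k + 1) le_rfl
      rw [if_neg e1] at q Plast
      rw [e2.neg_one_pow] at Plast
      rw [sectorLo, sectorHi, q, Plast]
      exact ⟨min_eq_left (by linarith), by rw [max_eq_right] <;> linarith⟩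
    · intro e
      have e1 : Even (k + 1) := by rw [Nat.even_add_one]; exact e
      have e2 : ¬ Even (k + 2) := by rw [Nat.even_add_one]; tauto
      have q := P (k + 1) le_rfl
      rw [if_pos e1] at q Plast
      rw [(Nat.not_even_iff_odd.1 e2).neg_one_pow] at Plast
      rw [sectorLo, sectorHi, q, Plast]
      exact ⟨by rw [min_eq_right] <;> linarith, max_eq_left (by linarith)⟩
  obtain ⟨z, hz1, hz2⟩ := exists_between (show x - a < x by linarith)
  have mem : ∀ i ≤ k + 2, z ∈ Set.Ioo (sectorLo α i) (sectorHi α i) := by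
    intro i hi
    rcases i with _ | i
    · rw [I0.1, I0.2]; exact ⟨by linarith, hz2⟩
    · by_cases e : i ≤ k
      · rw [(I i e).1, (I i e).2]; exact ⟨hz1, hz2⟩
      · obtain rfl : i = k + 1 := by omega
        by_cases e : Even k
        · rw [(Ilast.1 e).1, (Ilast.1 e).2]; exact ⟨hz1, by linarith⟩
        · rw [(Ilast.2 e).1, (Ilast.2 e).2]; exact ⟨by linarith, hz2⟩
  obtain ⟨f, hf⟩ := h.exists_height hc.joined z
  have hb : ∀ i j, i ≤ k + 2 → j ≤ k + 2 → (below i j ↔ f i < f j) :=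
    fun i j hi hj => (hf i j (mem i hi) (mem j hj)).1
  have hB : ∀ i j l, i ≤ k + 2 → j ≤ k + 2 → l ≤ k + 2 → (Between below i j l ↔
      (f i < f l ∧ f l < f j) ∨ (f j < f l ∧ f l < f i)) := by
    intro i j l hi hj hl
    unfold Between
    rw [hb i l hi hl, hb l j hl hj, hb j l hj hl, hb l i hl hi]
  have step : ∀ c ≤ k + 1, (Even c → f c < f (c + 1)) ∧ (¬ Even c → f (c + 1) < f c) := by
    intro c hc
    have := hv (c + 1) (by omega) (by omega)
    unfold IsValley at this
    rw [prevSector_succ α (by omega), Nat.even_add_one, hb _ _ (by omega) (by omega),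
      hb _ _ (by omega) (by omega)] at this
    tauto
  -- each layer of the spiral lies between the two preceding ones
  have spiral : ∀ i ≤ k, (Even i → f i < f (i + 2) ∧ f (i + 2) < f (i + 1)) ∧
      (¬ Even i → f (i + 1) < f (i + 2) ∧ f (i + 2) < f i) := by
    intro i
    induction i with
    | zero =>
      intro _
      refine ⟨fun _ => ?_, fun h => absurd Even.zero h⟩
      have s0 : f 0 < f 1 := (step 0 (by omega)).1 Even.zero
      have s1 : f 2 < f 1 := (step 1 (by omega)).2 (by decide)
      have := h.right_sector 1 2 0 ((joint_succ (by omega)).2 (by decide)) (by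
        rw [(I 0 (by omega)).1, I0.1, I0.2]; exact ⟨by linarith, by linarith⟩)
      rw [hB _ _ _ (by omega) (by omega) (by omega)] at this
      have ne : f 0 ≠ f 2 := fun e => by
        have := (hf 0 2 (mem 0 (by omega)) (mem 2 (by omega))).2 e; omega
      simp only [zero_add]
      omega
    | succ i ih =>
      intro hi
      obtain ⟨ih1, ih2⟩ := ih (by omega)
      have s2 := step (i + 2) (by omega)
      have e2 : Even (i + 2) ↔ Even i := by simp [Nat.even_add]
      rw [e2] at s2
      by_cases e : Even i
      · have := h.left_left i (i + 1) (i + 2) (i + 3) ((joint_succ (by omega)).1 e)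
          ((joint_succ (by omega)).1 (e2.2 e)) (by
            rw [(I (i + 1) (by omega)).2]
            rcases i with _ | i
            · exact I0.2
            · exact (I i (by omega)).2)
        rw [hB _ _ _ (by omega) (by omega) (by omega), hB _ _ _ (by omega) (by omega) (by omega)]
          at this
        have s := ih1 e
        have s' := s2.1 e
        refine ⟨fun h => absurd h (by rw [Nat.even_add_one]; tauto), fun _ => ?_⟩
        simp only [add_assoc, Nat.reduceAdd] at *
        omega
      · have i0 : i ≠ 0 := by rintro rfl; simp at e
        have := h.right_right i (i + 1) (i + 2) (i + 3) ((joint_succ (by omega)).2 e)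
          ((joint_succ (by omega)).2 (mt e2.1 e)) (by
            obtain ⟨j, rfl⟩ := Nat.exists_eq_succ_of_ne_zero i0
            rw [(I (j + 1 + 1) (by omega)).1]
            exact (I j (by omega)).1)
        rw [hB _ _ _ (by omega) (by omega) (by omega), hB _ _ _ (by omega) (by omega) (by omega)]
          at this
        have s := ih2 e
        have s' := s2.2 e
        refine ⟨fun _ => ?_, fun h => absurd e (by rw [Nat.even_add_one] at h; exact h)⟩
        simp only [add_assoc, Nat.reduceAdd] at *
        omega
  obtain ⟨s1, s2⟩ := spiral k le_rfl
  by_cases e : Even k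
  · refine h.left_sector k (k + 1) (k + 2) ((joint_succ (by omega)).1 e) ?_ ?_
    · have : sectorHi α k = x := by
        rcases k with _ | k
        · exact I0.2
        · exact (I k (by omega)).2
      rw [this, (Ilast.1 e).1, (Ilast.1 e).2]
      exact ⟨by linarith, by linarith⟩
    · rw [hB _ _ _ (by omega) (by omega) (by omega)]
      exact Or.inl (s1 e)
  · have k0 : k ≠ 0 := by rintro rfl; simp at e
    refine h.right_sector k (k + 1) (k + 2) ((joint_succ (by omega)).2 e) ?_ ?_
    · have : sectorLo α k = x - a := by
        obtain ⟨j, rfl⟩ := Nat.exists_eq_succ_of_ne_zero k0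
        exact (I j (by omega)).1
      rw [this, (Ilast.2 e).1, (Ilast.2 e).2]
      exact ⟨by linarith, by linarith⟩
    · rw [hB _ _ _ (by omega) (by omega) (by omega)]
      exact Or.inr (s2 e)

lemma isClosed_replicate {n : ℕ} {a : ℝ} (hn : 0 < n) (he : Even n) (ha : 0 < a) :
    IsClosed (List.replicate n a) ∧ ∀ c < n, sectorLo (List.replicate n a) c = 0 ∧
      sectorHi (List.replicate n a) c = a := by
  have P : ∀ c ≤ n, creasePos (List.replicate n a) c = if Even c then 0 else a := by
    intro c hc
    induction c with
    | zero => simp [creasePos_zero]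
    | succ c ih =>
      rw [creasePos_succ, ih (by omega), List.getD_replicate _ (by omega)]
      by_cases e : Even c
      · have : ¬ Even (c + 1) := by rw [Nat.even_add_one]; tauto
        rw [if_pos e, if_neg this, e.neg_one_pow]
        ring
      · have : Even (c + 1) := by rw [Nat.even_add_one]; exact e
        rw [if_neg e, if_pos this, (Nat.not_even_iff_odd.1 e).neg_one_pow]
        ring
  refine ⟨⟨by simpa using hn, by simpa using he, fun b hb => ?_, ?_⟩, fun c hc => ?_⟩
  · rw [List.eq_of_mem_replicate hb]; exact ha
  · rw [List.length_replicate, P n le_rfl, if_pos he]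
  · rw [sectorLo, sectorHi, P c hc.le, P (c + 1) hc]
    by_cases e : Even c
    · have : ¬ Even (c + 1) := by rw [Nat.even_add_one]; tauto
      rw [if_pos e, if_neg this]
      exact ⟨min_eq_left ha.le, max_eq_right ha.le⟩
    · have : Even (c + 1) := by rw [Nat.even_add_one]; exact e
      rw [if_neg e, if_pos this]
      exact ⟨min_eq_right ha.le, max_eq_left ha.le⟩

/-- A vertex of degree at least four with equal angles cannot have all its creases valleys: the
creases next to the highest even sector would interlace with others. -/
lemma IsStack.not_all_valleys {n : ℕ} {a : ℝ} (hn : 4 ≤ n) (he : Even n) (ha : 0 < a)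
    {below : ℕ → ℕ → Prop} (h : IsStack (List.replicate n a) below) :
    ¬ ∀ c < n, IsValley (List.replicate n a) below c := by
  intro hv
  obtain ⟨hc, I⟩ := isClosed_replicate (by omega) he ha
  have len : (List.replicate n a).length = n := List.length_replicate
  generalize List.replicate n a = α at *
  have mem : ∀ i < n, a / 2 ∈ Set.Ioo (sectorLo α i) (sectorHi α i) := by
    intro i hi
    rw [(I i hi).1, (I i hi).2]
    exact ⟨by linarith, by linarith⟩
  obtain ⟨f, hf⟩ := h.exists_height hc.joined (a / 2)
  have hb : ∀ i j, i < n → j < n → (below i j ↔ f i < f j) :=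
    fun i j hi hj => (hf i j (mem i hi) (mem j hj)).1
  have hB : ∀ i j l, i < n → j < n → l < n → (Between below i j l ↔
      (f i < f l ∧ f l < f j) ∨ (f j < f l ∧ f l < f i)) := by
    intro i j l hi hj hl
    unfold Between
    rw [hb i l hi hl, hb l j hl hj, hb j l hj hl, hb l i hl hi]
  have step : ∀ c < n, (Even c → f c < f (prevSector α c)) ∧
      (¬ Even c → f (prevSector α c) < f c) := by
    intro c hcn
    have hp := hc.prev_lt c
    rw [len] at hp
    have := hv c hcn
    unfold IsValley at this
    rw [hb _ _ hcn hp, hb _ _ hp hcn] at this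
    tauto
  obtain ⟨e, he', hmax⟩ := Finset.exists_max_image ((Finset.range n).filter Even) f
    ⟨0, by simp; omega⟩
  rw [Finset.mem_filter, Finset.mem_range] at he'
  obtain ⟨hen, ee⟩ := he'
  -- the sectors `pp, p, e, e₁, e₂` are consecutive
  obtain ⟨p, hp⟩ : ∃ p, p = prevSector α e := ⟨_, rfl⟩
  obtain ⟨pp, hpp⟩ : ∃ pp, pp = prevSector α p := ⟨_, rfl⟩
  have e1n : e + 1 < n := by
    rcases Nat.lt_or_ge (e + 1) n with h | h
    · exact h
    · obtain rfl : n = e + 1 := by omega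
      rw [Nat.even_add_one] at he
      exact absurd ee he
  have p1 : prevSector α (e + 1) = e := prevSector_succ α (by omega)
  obtain ⟨e₂, he₂, p2, d2⟩ : ∃ e₂ < n, prevSector α e₂ = e + 1 ∧ e₂ ≠ e := by
    by_cases h' : e + 2 < n
    · exact ⟨e + 2, h', prevSector_succ α (by omega), by omega⟩
    · exact ⟨0, by omega, by rw [prevSector_zero α (by omega)]; omega, by omega⟩
  have hpn : p < n := by rw [hp, ← len]; exact hc.prev_lt e
  have hppn : pp < n := by rw [hpp, ← len]; exact hc.prev_lt p
  have ep : ¬ Even p := by rw [hp, hc.even_prev (by omega)]; tauto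
  have epp : Even pp := by rw [hpp, hc.even_prev (by omega)]; exact ep
  have ee1 : ¬ Even (e + 1) := by rw [Nat.even_add_one]; tauto
  have ee2 : Even e₂ := by
    by_contra h'
    rw [← hc.even_prev (by omega), p2] at h'
    exact ee1 h'
  have dpp : pp ≠ e := by
    have q1 := prevSector_eq α (c := e) (by omega)
    have q2 := prevSector_eq α (c := p) (by omega)
    omega
  have s1 := (step e hen).1 ee
  have s3 := (step (e + 1) e1n).2 ee1
  have s4 := (step e₂ he₂).1 ee2
  rw [← hp] at s1
  rw [p1] at s3
  rw [p2] at s4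
  have m1 := hmax pp (by simp [hppn, epp])
  have m2 := hmax e₂ (by simp [he₂, ee2])
  have m1' : f pp ≠ f e := fun h' => dpp ((hf pp e (mem _ hppn) (mem _ hen)).2 h')
  have m2' : f e₂ ≠ f e := fun h' => d2 ((hf e₂ e (mem _ he₂) (mem _ hen)).2 h')
  have r := h.right_right (e + 1) e₂ e p ⟨e₂, by omega, ee2, Or.inl ⟨p2.symm, rfl⟩⟩
    ⟨e, by omega, ee, Or.inr ⟨rfl, hp⟩⟩ (by rw [(I _ e1n).1, (I _ hen).1])
  have l := h.left_left e (e + 1) p pp ⟨e + 1, by omega, ee1, Or.inl ⟨p1.symm, rfl⟩⟩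
    ⟨p, by omega, ep, Or.inr ⟨rfl, hpp⟩⟩ (by rw [(I _ hen).2, (I _ hpn).2])
  rw [hB _ _ _ e1n he₂ hen, hB _ _ _ e1n he₂ hpn] at r
  rw [hB _ _ _ hen e1n hpn, hB _ _ _ hen e1n hppn] at l
  omega

lemma isValley_flip {α : List ℝ} (hα : IsClosed α) {below : ℕ → ℕ → Prop} (h : IsStack α below)
    {c : ℕ} (hc : c < α.length) :
    IsValley α (fun i j => below j i) c ↔ ¬ IsValley α below c := by
  have hp := hα.prev_lt c
  have hne := hα.prev_ne hc
  -- the two sectors at a crease overlap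
  have key : ∃ z, z ∈ Set.Ioo (sectorLo α c) (sectorHi α c) ∧
      z ∈ Set.Ioo (sectorLo α (prevSector α c)) (sectorHi α (prevSector α c)) := by
    have h1 := hα.lo_lt_hi hc
    have h2 := hα.lo_lt_hi hp
    by_cases e : Even c
    · obtain ⟨e1, e2⟩ := hα.crease_even hc e
      obtain ⟨z, hz, hz'⟩ := exists_between (lt_min h1 (show sectorLo α c < _ by
        rw [e1, ← e2]; exact h2))
      rw [lt_min_iff] at hz'
      exact ⟨z, ⟨hz, hz'.1⟩, ⟨by rw [e2, ← e1]; exact hz, hz'.2⟩⟩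
    · obtain ⟨e1, e2⟩ := hα.crease_odd hc e
      obtain ⟨z, hz, hz'⟩ := exists_between (max_lt h1 (show _ < sectorHi α c by
        rw [e1, ← e2]; exact h2))
      rw [max_lt_iff] at hz
      exact ⟨z, ⟨hz.1, hz'⟩, ⟨hz.2, by rw [e2, ← e1]; exact hz'⟩⟩
  obtain ⟨z, zc, zp⟩ := key
  have := h.total _ _ z hne zp zc
  unfold IsValley
  tauto

/-- If all the creases in a set have the same type, some stacking order makes all of them valleys:
when they are mountains, turn the folded state upside down. -/
lemma Valid.exists_valleys {l : List (ℝ × MV)} (h : Valid l) (S : Set ℕ) (e : MV)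
    (hS : ∀ c ∈ S, ∃ b, l[c]? = some (b, e)) :
    ∃ below, IsStack (l.map Prod.fst) below ∧ ∀ c ∈ S, IsValley (l.map Prod.fst) below c := by
  obtain ⟨hc, below, hb, hv⟩ := h
  by_cases he : e = MV.valley
  · refine ⟨below, hb, fun c hcS => ?_⟩
    obtain ⟨b, hb'⟩ := hS c hcS
    exact (hv c _ hb').1 he
  · refine ⟨_, hb.flip, fun c hcS => ?_⟩
    obtain ⟨b, hb'⟩ := hS c hcS
    rw [isValley_flip hc hb (by simpa using (List.getElem?_eq_some_iff.1 hb').1)]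
    exact fun h => he ((hv c _ hb').2 h)

theorem not_valid_run {x a y : ℝ} {k : ℕ} {e₀ e : MV} {T : List (ℝ × MV)} (hx : a < x)
    (hy : a < y) : ¬ Valid ((x, e₀) :: (List.replicate (k + 1) (a, e) ++ (y, e) :: T)) := by
  intro h
  have hc := h.1
  obtain ⟨below, hb, hv⟩ := h.exists_valleys {c | 1 ≤ c ∧ c ≤ k + 2} e (by
    rintro c ⟨h1, h2⟩
    obtain ⟨c, rfl⟩ : ∃ d, c = d + 1 := ⟨c - 1, by omega⟩
    rw [List.getElem?_cons_succ]
    by_cases e' : c < k + 1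
    · exact ⟨a, by rw [List.getElem?_append_left (by simpa using e'),
        List.getElem?_replicate_of_lt e']⟩
    · obtain rfl : c = k + 1 := by omega
      exact ⟨y, by rw [List.getElem?_append_right (by simp)]; simp⟩)
  simp only [List.map_cons, List.map_append, List.map_replicate] at hc hb hv
  exact hb.not_valleyRun hx hy hc fun c h1 h2 => hv c ⟨h1, h2⟩

theorem not_valid_replicate {n : ℕ} {a : ℝ} {e : MV} (hn : 4 ≤ n) :
    ¬ Valid (List.replicate n (a, e)) := by
  intro h
  have hc := h.1
  obtain ⟨below, hb, hv⟩ := h.exists_valleys {c | c < n} e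
    fun c hcn => ⟨a, List.getElem?_replicate_of_lt hcn⟩
  simp only [List.map_replicate] at hc hb hv
  exact hb.not_all_valleys hn (by simpa using hc.even) (hc.pos a (by simp; omega)) hv

theorem valid_two {a : ℝ} (ha : 0 < a) {e₀ e₁ : MV} : Valid [(a, e₀), (a, e₁)] ↔ e₀ = e₁ := by
  constructor
  · rintro ⟨-, below, -, hv⟩
    have h0 := hv 0 _ rfl
    have h1 := hv 1 _ rfl
    simp [IsValley, prevSector] at h0 h1
    have := h0.trans h1.symm
    cases e₀ <;> cases e₁ <;> simp_all
  · rintro rfl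
    obtain ⟨hc, I⟩ := isClosed_replicate (n := 2) (by omega) (by decide) ha
    have st : IsStack [a, a] (fun i j => i = 0 ∧ j = 1) := by
      have lt : ∀ i z, z ∈ Set.Ioo (sectorLo [a, a] i) (sectorHi [a, a] i) → i < 2 :=
        fun i z hz => lt_length_of_mem hz
      have bt : ∀ u v k, k = u ∨ k = v →
          ¬ Between (fun i j => i = 0 ∧ j = 1) u v k := by
        intro u v k hk; unfold Between; omega
      have pr : ∀ c < 2, (prevSector [a, a] c = 0 ∧ c = 1) ∨ (prevSector [a, a] c = 1 ∧ c = 0) := by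
        intro c hc; interval_cases c <;> simp [prevSector]
      have uR : ∀ u v, RightJoint [a, a] u v → (u = 0 ∧ v = 1) ∨ (u = 1 ∧ v = 0) := by
        rintro u v ⟨c, hc, e, h⟩
        have := pr c hc
        omega
      have uL : ∀ u v, LeftJoint [a, a] u v → (u = 0 ∧ v = 1) ∨ (u = 1 ∧ v = 0) := by
        rintro u v ⟨c, hc, e, h⟩
        have := pr c hc
        omega
      refine ⟨by omega, ?_, by omega, ?_, ?_, ?_, ?_⟩
      · intro i j z hij hi hj
        have := lt i z hi
        have := lt j z hj
        omega
      · intro u v k huv hk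
        have h1 := lt k _ hk
        have h2 := uR u v huv
        exact bt u v k (by omega)
      · intro u v k huv hk
        have h1 := lt k _ hk
        have h2 := uL u v huv
        exact bt u v k (by omega)
      · intro u v u' v' huv huv' _
        have h1 := uR u v huv
        have h2 := uR u' v' huv'
        exact iff_of_false (bt _ _ _ (by omega)) (bt _ _ _ (by omega))
      · intro u v u' v' huv huv' _
        have h1 := uL u v huv
        have h2 := uL u' v' huv'
        exact iff_of_false (bt _ _ _ (by omega)) (bt _ _ _ (by omega))
    have vl : ∀ c < 2, IsValley [a, a] (fun i j => i = 0 ∧ j = 1) c := by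
      intro c hc; interval_cases c <;> simp [IsValley, prevSector]
    by_cases he : e₀ = MV.valley
    · refine ⟨hc, _, st, fun c w hw => ?_⟩
      have hlt : c < 2 := (List.getElem?_eq_some_iff.1 hw).1
      refine iff_of_true ?_ (vl c hlt)
      interval_cases c <;> simp at hw <;> rw [← hw] <;> exact he
    · refine ⟨hc, _, st.flip, fun c w hw => ?_⟩
      have hlt : c < 2 := (List.getElem?_eq_some_iff.1 hw).1
      refine iff_of_false ?_ (fun h => (isValley_flip hc st hlt).1 h (vl c hlt))
      interval_cases c <;> simp at hw <;> rw [← hw] <;> exact he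

end

section

/-! ### Runs of equal angles -/

lemma valid_crimp_append {x a y : ℝ} {e₀ e₁ e₂ : MV} {P T : List (ℝ × MV)} (ha : 0 < a)
    (hx : a ≤ x) (hy : a ≤ y) (he : e₁ ≠ e₂) :
    Valid (P ++ (x, e₀) :: (a, e₁) :: (y, e₂) :: T) ↔ Valid (P ++ (x - a + y, e₀) :: T) := by
  rw [valid_iff_of_isRotated List.isRotated_append,
    valid_iff_of_isRotated (List.isRotated_append (l := P))]
  exact valid_crimp ha hx hy he

/-- The part of a vertex that begins with a sector of angle `b` and goes on with sectors of angle
`a`, the last of which is lengthened by `y - a`, and then with `T`.  The sector of angle `b` comes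
after a crease of type `e`, and the following creases have the types `g`.  When `g` is empty, it is
the first sector that is lengthened. -/
def run (a y : ℝ) (T : List (ℝ × MV)) : ℝ → MV → List MV → List (ℝ × MV)
  | b, e, [] => (b - a + y, e) :: T
  | b, e, w :: g => (b, e) :: run a y T a w g

variable {a y : ℝ} {T : List (ℝ × MV)}

lemma valid_run_cancel (ha : 0 < a) (hy : a ≤ y) {u v : MV} (huv : u ≠ v) (g₁ g₂ : List MV)
    (b : ℝ) (e : MV) (P : List (ℝ × MV)) (hb : a ≤ b) :
    Valid (P ++ run a y T b e (g₁ ++ u :: v :: g₂)) ↔ Valid (P ++ run a y T b e (g₁ ++ g₂)) := by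
  induction g₁ generalizing b e P with
  | nil =>
    rcases g₂ with _ | ⟨w, g₂⟩
    · simp only [List.nil_append, run]
      rw [valid_crimp_append ha hb (by linarith) huv, sub_self, zero_add]
    · simp only [List.nil_append, run]
      rw [valid_crimp_append ha hb le_rfl huv, sub_add_cancel]
  | cons w g₁ ih =>
    have := ih a w (P ++ [(b, e)]) le_rfl
    simpa [run] using this

lemma run_replicate (k : ℕ) (x : ℝ) (e₀ e : MV) :
    run a y T x e₀ (List.replicate (k + 1) e) =
      (x, e₀) :: (List.replicate k (a, e) ++ (y, e) :: T) := by
  induction k generalizing x e₀ with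
  | zero => simp [run]
  | succ k ih => rw [List.replicate_succ, run, ih, List.replicate_succ, List.cons_append]

/-- Valleys count `1` and mountains `-1`. -/
def sign : MV → ℤ
  | .valley => 1
  | .mountain => -1

lemma sign_injective : Function.Injective sign := by
  intro e f h; cases e <;> cases f <;> simp_all [sign]

lemma sign_add_sign {u v : MV} (h : u ≠ v) : sign u + sign v = 0 := by
  cases u <;> cases v <;> simp_all [sign]

lemma sign_eq (e : MV) : sign e = 1 ∨ sign e = -1 := by cases e <;> simp [sign]

/-- The number of valleys minus the number of mountains. -/
def signSum (g : List MV) : ℤ := (g.map sign).sum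

lemma signSum_cons (e : MV) (g : List MV) : signSum (e :: g) = sign e + signSum g := by
  simp [signSum]

lemma signSum_append (g g' : List MV) : signSum (g ++ g') = signSum g + signSum g' := by
  simp [signSum]

lemma signSum_replicate (n : ℕ) (e : MV) : signSum (List.replicate n e) = n * sign e := by
  simp [signSum]

lemma signSum_cancel {u v : MV} (h : u ≠ v) (g₁ g₂ : List MV) :
    signSum (g₁ ++ u :: v :: g₂) = signSum (g₁ ++ g₂) := by
  have := sign_add_sign h
  simp only [signSum_append, signSum_cons]
  omega

lemma eq_replicate_or_exists_ne (g : List MV) :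
    (∃ n e, g = List.replicate n e) ∨ ∃ g₁ u v g₂, u ≠ v ∧ g = g₁ ++ u :: v :: g₂ := by
  induction g with
  | nil => exact Or.inl ⟨0, MV.valley, rfl⟩
  | cons w g ih =>
    rcases ih with ⟨n, e, rfl⟩ | ⟨g₁, u, v, g₂, h, rfl⟩
    · rcases n with _ | n
      · exact Or.inl ⟨1, w, rfl⟩
      · by_cases h : w = e
        · exact Or.inl ⟨n + 2, e, by rw [h]; rfl⟩
        · exact Or.inr ⟨[], w, e, List.replicate n e, h, rfl⟩
    · exact Or.inr ⟨w :: g₁, u, v, g₂, h, rfl⟩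

/-- The types of the creases of a run of equal angles between two strictly larger ones matter only
through the excess of valleys over mountains, which must be `0`, `1` or `-1`. -/
theorem valid_run_iff {x : ℝ} {e₀ : MV} (ha : 0 < a) (hx : a < x) (hy : a < y) (g : List MV) :
    Valid (run a y T x e₀ g) ↔ (signSum g = 0 ∧ Valid (run a y T x e₀ [])) ∨
      ∃ e, signSum g = sign e ∧ Valid (run a y T x e₀ [e]) := by
  induction hn : g.length using Nat.strong_induction_on generalizing g with
  | _ n ih =>
    rcases eq_replicate_or_exists_ne g with ⟨m, e, rfl⟩ | ⟨g₁, u, v, g₂, h, rfl⟩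
    · rw [signSum_replicate]
      have hs := sign_eq e
      match m with
      | 0 =>
        refine ⟨fun h => Or.inl ⟨by simp, h⟩, ?_⟩
        rintro (⟨-, h⟩ | ⟨e', h, -⟩)
        · exact h
        · have := sign_eq e'
          push_cast at h
          omega
      | 1 =>
        have : sign e ≠ 0 := by omega
        simp [this, sign_injective.eq_iff]
      | m + 2 =>
        rw [run_replicate]
        refine iff_of_false (not_valid_run hx hy) ?_
        rintro (⟨h, -⟩ | ⟨e', h, -⟩)
        · push_cast at h
          rcases hs with h' | h' <;> rw [h'] at h <;> omega
        · have := sign_eq e'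
          push_cast at h
          rcases hs with h' | h' <;> rw [h'] at h <;> omega
    · rw [signSum_cancel h, ← ih _ ?_ (g₁ ++ g₂) rfl]
      · exact valid_run_cancel ha hy.le h g₁ g₂ x e₀ [] hx.le
      · simp [← hn]

/-- A vertex with equal angles is validly folded if and only if the numbers of mountains and
valleys differ by two. -/
theorem valid_map_iff (ha : 0 < a) (g : List MV) (h0 : g ≠ []) (he : Even g.length) :
    Valid (g.map fun e => (a, e)) ↔ signSum g = 2 ∨ signSum g = -2 := by
  induction hn : g.length using Nat.strong_induction_on generalizing g with
  | _ n ih =>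
    rcases eq_replicate_or_exists_ne g with ⟨m, e, rfl⟩ | ⟨g₁, u, v, g₂, h, rfl⟩
    · rw [signSum_replicate, List.map_replicate]
      have hs := sign_eq e
      rw [List.length_replicate] at he
      match m with
      | 0 => exact absurd rfl h0
      | 1 => simp at he
      | 2 =>
        refine iff_of_true ((valid_two ha).2 rfl) ?_
        rcases hs with h' | h' <;> rw [h'] <;> simp
      | 3 => exact absurd he (by decide)
      | m + 4 =>
        refine iff_of_false (not_valid_replicate (by omega)) ?_
        push_cast
        rcases hs with h' | h' <;> rw [h'] <;> omega
    · rw [signSum_cancel h]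
      have rot : (g₁ ++ u :: v :: g₂).IsRotated (u :: v :: (g₂ ++ g₁)) := by
        have := List.isRotated_append (l := g₁) (l' := u :: v :: g₂)
        simpa using this
      rw [valid_iff_of_isRotated (rot.map _)]
      rcases List.eq_nil_or_concat (g₂ ++ g₁) with e | ⟨l, w, e⟩
      · rw [e]
        obtain ⟨rfl, rfl⟩ := List.append_eq_nil_iff.1 e
        refine iff_of_false (fun hv => h ((valid_two ha).1 hv)) ?_
        simp [signSum]
      · have e' : g₂ ++ g₁ = l ++ [w] := by simpa using e
        have hlen : (g₁ ++ g₂).length = (l ++ [w]).length := by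
          rw [← e', List.length_append, List.length_append, add_comm]
        have hlt : (g₁ ++ g₂).length + 2 = n := by simp [← hn]; omega
        rw [← ih _ (by omega) (g₁ ++ g₂) ?_ ?_ rfl]
        · have r1 : (u :: v :: (l ++ [w])).IsRotated (w :: u :: v :: l) :=
            List.isRotated_append (l := u :: v :: l) (l' := [w])
          have r2 : (w :: l).IsRotated (g₁ ++ g₂) :=
            ((List.isRotated_append (l := [w]) (l' := l)).trans (by rw [← e'])).trans
              List.isRotated_append
          rw [e', valid_iff_of_isRotated (r1.map _), ← valid_iff_of_isRotated (r2.map _)]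
          simp only [List.map_cons]
          rw [valid_crimp ha le_rfl le_rfl h, sub_self, zero_add]
        · intro h'; rw [h'] at hlen; simp at hlen
        · have : (g₁ ++ u :: v :: g₂).length = (g₁ ++ g₂).length + 2 := by simp; omega
          rw [this] at he
          simpa [Nat.even_add] using he

/-! ### Counting -/

/-- The lists of `m` crease types with a given excess of valleys over mountains. -/
def signSumSet (m : ℕ) (s : ℤ) : Set (List MV) := {g | g.length = m ∧ signSum g = s}

lemma finite_length (m : ℕ) : {g : List MV | g.length = m}.Finite := List.finite_length_eq MV m

lemma neg_length_le_signSum (g : List MV) : -(g.length : ℤ) ≤ signSum g := by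
  induction g with
  | nil => simp [signSum]
  | cons e g ih =>
    have := sign_eq e
    rw [signSum_cons, List.length_cons]
    push_cast
    omega

lemma ncard_signSumSet (m j : ℕ) : (signSumSet m (2 * j - m)).ncard = m.choose j := by
  have fin : ∀ m s, (signSumSet m s).Finite := fun m s =>
    (finite_length m).subset fun g hg => hg.1
  induction m generalizing j with
  | zero =>
    rcases j with _ | j
    · have : signSumSet 0 (2 * (0 : ℕ) - (0 : ℕ)) = {[]} := by
        ext g
        simp only [signSumSet, Set.mem_ofPred_eq, Set.mem_singleton_iff, List.length_eq_zero_iff]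
        exact ⟨fun h => h.1, fun h => ⟨h, by rw [h]; simp [signSum]⟩⟩
      rw [this]
      simp
    · have : signSumSet 0 (2 * (j + 1 : ℕ) - (0 : ℕ)) = ∅ := by
        ext g
        simp only [signSumSet, Set.mem_ofPred_eq, Set.mem_empty_iff_false, iff_false,
          List.length_eq_zero_iff]
        rintro ⟨rfl, h⟩
        simp [signSum] at h
        omega
      rw [this]
      simp
  | succ m ih =>
    have split : ∀ s, signSumSet (m + 1) s = (MV.valley :: ·) '' signSumSet m (s - 1) ∪
        (MV.mountain :: ·) '' signSumSet m (s + 1) := by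
      intro s
      ext g
      simp only [signSumSet, Set.mem_union, Set.mem_image, Set.mem_ofPred_eq]
      constructor
      · rintro ⟨h1, h2⟩
        rcases g with _ | ⟨e, g⟩
        · simp at h1
        · rw [List.length_cons] at h1
          rw [signSum_cons] at h2
          cases e
          · exact Or.inr ⟨g, ⟨by omega, by simp [sign] at h2; omega⟩, rfl⟩
          · exact Or.inl ⟨g, ⟨by omega, by simp [sign] at h2; omega⟩, rfl⟩
      · rintro (⟨g, ⟨h1, h2⟩, rfl⟩ | ⟨g, ⟨h1, h2⟩, rfl⟩)
        · exact ⟨by simp [h1], by rw [signSum_cons, h2]; simp [sign]⟩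
        · exact ⟨by simp [h1], by rw [signSum_cons, h2]; simp [sign]⟩
    rw [split, Set.ncard_union_eq ?_ ((fin _ _).image _) ((fin _ _).image _),
      Set.ncard_image_of_injective _ (List.cons_injective),
      Set.ncard_image_of_injective _ (List.cons_injective)]
    · rcases j with _ | j
      · have : signSumSet m (2 * (0 : ℕ) - (m + 1 : ℕ) - 1) = ∅ := by
          ext g
          simp only [signSumSet, Set.mem_ofPred_eq, Set.mem_empty_iff_false, iff_false]
          rintro ⟨rfl, h⟩
          have := neg_length_le_signSum g
          push_cast at h
          omega
        rw [this, show (2 * (0 : ℕ) - (m + 1 : ℕ) + 1 : ℤ) = 2 * (0 : ℕ) - m by push_cast; ring, ih]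
        simp
      · rw [show (2 * (j + 1 : ℕ) - (m + 1 : ℕ) - 1 : ℤ) = 2 * j - m by push_cast; ring, ih,
          show (2 * (j + 1 : ℕ) - (m + 1 : ℕ) + 1 : ℤ) = 2 * (j + 1 : ℕ) - m by push_cast; ring, ih,
          Nat.choose_succ_succ]
    · rw [Set.disjoint_left]
      rintro _ ⟨g, -, rfl⟩ ⟨g', -, h⟩
      simp at h

/-- The lists of crease types that are valid for the angles `α`. -/
def validSet (α : List ℝ) : Set (List MV) := {g | g.length = α.length ∧ Valid (α.zip g)}

lemma finite_validSet (α : List ℝ) : (validSet α).Finite :=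
  (finite_length α.length).subset fun _ hg => hg.1

lemma withCreases_eq_zip (α : List ℝ) (f : Fin α.length → MV) :
    withCreases α f = α.zip (List.ofFn f) := by
  apply List.ext_getElem
  · simp [withCreases]
  · intro i h1 h2
    simp [withCreases]

lemma ofFn_mem_validSet {α : List ℝ} (he : Even α.length) (h0 : α ≠ []) (hp : ∀ a ∈ α, 0 < a)
    (f : Fin α.length → MV) : List.ofFn f ∈ validSet α ↔ IsValid α f := by
  rw [isValid_iff he (List.length_pos_of_ne_nil h0) hp, withCreases_eq_zip]
  simp [validSet]

lemma isClosed_of_mem_validSet {α : List ℝ} {g : List MV} (h : g ∈ validSet α) : IsClosed α := by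
  have := h.2.1
  rwa [List.map_fst_zip h.1.ge] at this

lemma exists_ofFn_eq {n : ℕ} {g : List MV} (h : g.length = n) :
    ∃ f : Fin n → MV, List.ofFn f = g := by
  subst h
  exact ⟨fun i => g[i], by simp⟩

lemma isFlatVertexFold_iff {α : List ℝ} :
    IsFlatVertexFold α ↔ α.sum ≤ 2 * Real.pi ∧ (validSet α).Nonempty := by
  constructor
  · rintro ⟨h1, h2, h3, h4, f, hf⟩
    exact ⟨h4, _, (ofFn_mem_validSet h2 h1 h3 f).2 hf⟩
  · rintro ⟨h, g, hg⟩
    obtain ⟨h1, h2, h3, -⟩ := isClosed_of_mem_validSet hg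
    have h1' := List.ne_nil_of_length_pos h1
    obtain ⟨f, rfl⟩ := exists_ofFn_eq hg.1
    exact ⟨h1', h2, h3, h, f, (ofFn_mem_validSet h2 h1' h3 f).1 hg⟩

lemma C_eq_ncard {α : List ℝ} (h : IsFlatVertexFold α) : C α = (validSet α).ncard := by
  obtain ⟨h1, h2, h3, -, -⟩ := h
  unfold C
  rw [← Nat.card_coe_set_eq]
  refine Nat.card_congr (Equiv.ofBijective
    (fun f => ⟨List.ofFn f.1, (ofFn_mem_validSet h2 h1 h3 f.1).2 f.2⟩) ⟨?_, ?_⟩)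
  · intro f f' h
    exact Subtype.ext (List.ofFn_injective (congrArg Subtype.val h))
  · rintro ⟨g, hg⟩
    obtain ⟨f, rfl⟩ := exists_ofFn_eq hg.1
    exact ⟨⟨f, (ofFn_mem_validSet h2 h1 h3 f).1 hg⟩, rfl⟩

lemma rotate_mem_validSet {α : List ℝ} {g : List MV} (h : g ∈ validSet α) (n : ℕ) :
    g.rotate n ∈ validSet (α.rotate n) := by
  refine ⟨by simpa using h.1, ?_⟩
  have := List.zipWith_rotate_distrib Prod.mk α g n h.1.symm
  rw [List.zip, ← this]
  exact valid_of_isRotated ⟨n, rfl⟩ h.2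

lemma ncard_validSet_of_isRotated {α β : List ℝ} (h : α.IsRotated β) :
    (validSet α).ncard = (validSet β).ncard := by
  have key : ∀ {α β : List ℝ}, α.IsRotated β → (validSet α).ncard ≤ (validSet β).ncard := by
    rintro α β ⟨n, rfl⟩
    rw [← Set.ncard_image_of_injective _ (List.rotate_injective n)]
    refine Set.ncard_le_ncard ?_ (finite_validSet _)
    rintro _ ⟨g, hg, rfl⟩
    exact rotate_mem_validSet hg n
  exact le_antisymm (key h) (key h.symm)

lemma IsFlatVertexFold.of_isRotated {α β : List ℝ} (hα : IsFlatVertexFold α)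
    (h : α.IsRotated β) : IsFlatVertexFold β := by
  rw [isFlatVertexFold_iff] at hα ⊢
  obtain ⟨h1, g, hg⟩ := hα
  refine ⟨by rw [← h.perm.sum_eq]; exact h1, ?_⟩
  obtain ⟨n, rfl⟩ := h
  exact ⟨_, rotate_mem_validSet hg n⟩

lemma C_of_isRotated {α β : List ℝ} (hα : IsFlatVertexFold α) (h : α.IsRotated β) :
    C α = C β := by
  rw [C_eq_ncard hα, C_eq_ncard (hα.of_isRotated h), ncard_validSet_of_isRotated h]

/-- The number of valid assignments of a vertex with equal angles. -/
lemma C_replicate {n : ℕ} (hn : 1 ≤ n) (h : IsFlatVertexFold (List.replicate (2 * n) a)) :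
    C (List.replicate (2 * n) a) = 2 * (2 * n).choose (n - 1) := by
  have ha : 0 < a := h.pos a (by simp; omega)
  have fin : ∀ m s, (signSumSet m s).Finite := fun m s =>
    (finite_length m).subset fun g hg => hg.1
  have split : validSet (List.replicate (2 * n) a) =
      signSumSet (2 * n) (2 * (n + 1 : ℕ) - (2 * n : ℕ)) ∪
      signSumSet (2 * n) (2 * (n - 1 : ℕ) - (2 * n : ℕ)) := by
    ext g
    simp only [validSet, signSumSet, Set.mem_union, Set.mem_ofPred_eq, List.length_replicate]
    by_cases hg : g.length = 2 * n
    · have : (List.replicate (2 * n) a).zip g = g.map fun e => (a, e) := by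
        rw [← hg]
        apply List.ext_getElem <;> simp
      have hg0 : g ≠ [] := by rintro rfl; simp at hg; omega
      rw [this, valid_map_iff ha g hg0 (by rw [hg]; simp)]
      have e1 : (2 * (n + 1 : ℕ) - (2 * n : ℕ) : ℤ) = 2 := by push_cast; ring
      have e2 : (2 * (n - 1 : ℕ) - (2 * n : ℕ) : ℤ) = -2 := by push_cast [Nat.cast_sub hn]; ring
      rw [e1, e2]
      tauto
    · simp [hg]
  rw [C_eq_ncard h, split, Set.ncard_union_eq ?_ (fin _ _) (fin _ _), ncard_signSumSet,
    ncard_signSumSet]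
  · have := Nat.choose_symm_of_eq_add (n := 2 * n) (a := n + 1) (b := n - 1) (by omega)
    omega
  · rw [Set.disjoint_left]
    rintro g ⟨-, h1⟩ ⟨-, h2⟩
    omega

lemma zip_run (x y : ℝ) (k : ℕ) (t : List ℝ) (e : MV) (g u : List MV) (hg : g.length = k + 1) :
    (x :: (List.replicate k a ++ y :: t)).zip (e :: (g ++ u)) = run a y (t.zip u) x e g := by
  induction k generalizing x e g with
  | zero =>
    obtain ⟨w, rfl⟩ := List.length_eq_one_iff.1 hg
    simp [run]
  | succ k ih =>
    rcases g with _ | ⟨w, g⟩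
    · simp at hg
    · rw [run, ← ih a w g (by simpa using hg), List.replicate_succ]
      simp

lemma even_length_add_signSum (g : List MV) : Even ((g.length : ℤ) + signSum g) := by
  induction g with
  | nil => simp [signSum]
  | cons e g ih =>
    rw [signSum_cons, List.length_cons]
    push_cast
    rcases sign_eq e with h | h <;> rw [h] <;> grind

variable {x : ℝ} {t : List ℝ} {k : ℕ}

lemma mem_validSet_run_iff (ha : 0 < a) (hx : a < x) (hy : a < y) {e : MV} {g u : List MV}
    (hg : g.length = k + 2) :
    e :: (g ++ u) ∈ validSet (x :: (List.replicate (k + 1) a ++ y :: t)) ↔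
      (signSum g = 0 ∧ e :: u ∈ validSet ((x - a + y) :: t)) ∨
      ∃ w, signSum g = sign w ∧ e :: w :: u ∈ validSet (x :: y :: t) := by
  have hl : (e :: (g ++ u)).length = (x :: (List.replicate (k + 1) a ++ y :: t)).length ↔
      u.length = t.length := by
    simp [hg]; omega
  simp only [validSet, Set.mem_ofPred_eq]
  rw [hl, zip_run x y (k + 1) t e g u hg, valid_run_iff ha hx hy g]
  simp only [List.length_cons, List.zip_cons_cons, run, sub_self, zero_add,
    Nat.add_right_cancel_iff]
  constructor
  · rintro ⟨h1, ⟨h2, h3⟩ | ⟨w, h2, h3⟩⟩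
    · exact Or.inl ⟨h2, h1, h3⟩
    · exact Or.inr ⟨w, h2, h1, h3⟩
  · rintro (⟨h2, h1, h3⟩ | ⟨w, h2, h1, h3⟩)
    · exact ⟨h1, Or.inl ⟨h2, h3⟩⟩
    · exact ⟨h1, Or.inr ⟨w, h2, h3⟩⟩

lemma exists_split_of_mem_validSet {g : List MV}
    (hg : g ∈ validSet (x :: (List.replicate (k + 1) a ++ y :: t))) :
    ∃ e g' u, g'.length = k + 2 ∧ g = e :: (g' ++ u) := by
  have hl := hg.1
  rcases g with _ | ⟨e, g⟩
  · simp at hl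
  · refine ⟨e, g.take (k + 2), g.drop (k + 2), ?_, by rw [List.take_append_drop]⟩
    simp at hl
    rw [List.length_take]
    omega

lemma ncard_validSet_even (ha : 0 < a) (hx : a < x) (hy : a < y) (hk : Even k) :
    (validSet (x :: (List.replicate (k + 1) a ++ y :: t))).ncard =
      (k + 2).choose ((k + 2) / 2) * (validSet ((x - a + y) :: t)).ncard := by
  have par : ∀ g : List MV, g.length = k + 2 → ∀ w, signSum g ≠ sign w := by
    intro g hg w h
    have := even_length_add_signSum g
    have := sign_eq w
    grind
  have h2 : signSumSet (k + 2) (2 * ((k + 2) / 2 : ℕ) - (k + 2 : ℕ)) = signSumSet (k + 2) 0 := by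
    congr 1
    obtain ⟨j, rfl⟩ := hk
    omega
  rw [← ncard_signSumSet, h2, ← Set.ncard_prod]
  symm
  refine Set.ncard_congr (fun p _ => p.2.take 1 ++ (p.1 ++ p.2.drop 1)) ?_ ?_ ?_
  · rintro ⟨g, h⟩ ⟨hg, hh⟩
    rcases h with _ | ⟨e, u⟩
    · exact absurd hh.1 (by simp)
    · exact (mem_validSet_run_iff ha hx hy hg.1).2 (Or.inl ⟨hg.2, hh⟩)
  · rintro ⟨g, h⟩ ⟨g', h'⟩ ⟨hg, hh⟩ ⟨hg', hh'⟩ e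
    rcases h with _ | ⟨e, u⟩
    · exact absurd hh.1 (by simp)
    rcases h' with _ | ⟨e', u'⟩
    · exact absurd hh'.1 (by simp)
    simp only [List.take_succ_cons, List.take_zero, List.drop_succ_cons, List.drop_zero,
      List.cons_append, List.nil_append, List.cons.injEq] at e
    obtain ⟨rfl, e⟩ := e
    obtain ⟨rfl, rfl⟩ := List.append_inj e (hg.1.trans hg'.1.symm)
    rfl
  · intro l hl
    obtain ⟨e, g, u, hg, rfl⟩ := exists_split_of_mem_validSet hl
    rcases (mem_validSet_run_iff ha hx hy hg).1 hl with ⟨h1, h2⟩ | ⟨w, h1, -⟩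
    · exact ⟨(g, e :: u), ⟨⟨hg, h1⟩, h2⟩, rfl⟩
    · exact absurd h1 (par g hg w)

/-- The involution of the crease types that sends `w` to a valley. -/
def twist : MV → MV → MV
  | .valley, e => e
  | .mountain, .valley => .mountain
  | .mountain, .mountain => .valley

lemma twist_twist (w e : MV) : twist w (twist w e) = e := by cases w <;> cases e <;> rfl

lemma signSum_map_twist (w : MV) (g : List MV) :
    signSum (g.map (twist w)) = sign w * signSum g := by
  induction g with
  | nil => simp [signSum]
  | cons e g ih =>
    rw [List.map_cons, signSum_cons, signSum_cons, ih]
    cases w <;> cases e <;> simp [sign, twist] <;> ring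

lemma map_twist_map_twist (w : MV) (g : List MV) : (g.map (twist w)).map (twist w) = g := by
  rw [List.map_map, show twist w ∘ twist w = id from funext (twist_twist w), List.map_id]

lemma ncard_validSet_odd (ha : 0 < a) (hx : a < x) (hy : a < y) (hk : Odd k) :
    (validSet (x :: (List.replicate (k + 1) a ++ y :: t))).ncard =
      (k + 2).choose ((k + 1) / 2) * (validSet (x :: y :: t)).ncard := by
  have par : ∀ g : List MV, g.length = k + 2 → signSum g ≠ 0 := by
    intro g hg h
    have := even_length_add_signSum g
    grind
  have h1 : (k + 2).choose ((k + 1) / 2) = (k + 2).choose ((k + 3) / 2) := by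
    obtain ⟨j, rfl⟩ := hk
    exact Nat.choose_symm_of_eq_add (by omega)
  have h2 : signSumSet (k + 2) (2 * ((k + 3) / 2 : ℕ) - (k + 2 : ℕ)) = signSumSet (k + 2) 1 := by
    congr 1
    obtain ⟨j, rfl⟩ := hk
    omega
  have sq : ∀ w : MV, sign w * sign w = 1 := by intro w; cases w <;> rfl
  rw [h1, ← ncard_signSumSet, h2, ← Set.ncard_prod]
  symm
  -- the single crease that remains has the type of the majority
  refine Set.ncard_congr (fun p _ => p.2.take 1 ++
    (((p.2.drop 1).take 1).flatMap (fun w => p.1.map (twist w)) ++ p.2.drop 2)) ?_ ?_ ?_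
  · rintro ⟨g, h⟩ ⟨hg, hh⟩
    rcases h with _ | ⟨e, _ | ⟨w, u⟩⟩
    · exact absurd hh.1 (by simp)
    · exact absurd hh.1 (by simp)
    · have := (mem_validSet_run_iff (g := g.map (twist w)) ha hx hy
        (by rw [List.length_map]; exact hg.1)).2
        (Or.inr ⟨w, by rw [signSum_map_twist, hg.2, mul_one], hh⟩)
      simpa using this
  · rintro ⟨g, h⟩ ⟨g', h'⟩ ⟨hg, hh⟩ ⟨hg', hh'⟩ e
    rcases h with _ | ⟨e, _ | ⟨w, u⟩⟩
    · exact absurd hh.1 (by simp)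
    · exact absurd hh.1 (by simp)
    rcases h' with _ | ⟨e', _ | ⟨w', u'⟩⟩
    · exact absurd hh'.1 (by simp)
    · exact absurd hh'.1 (by simp)
    simp only [List.take_succ_cons, List.take_zero, List.drop_succ_cons, List.drop_zero,
      List.cons_append, List.nil_append, List.cons.injEq, List.flatMap_cons, List.flatMap_nil,
      List.append_nil] at e
    obtain ⟨rfl, e⟩ := e
    obtain ⟨e1, rfl⟩ := List.append_inj e (by simp [hg.1, hg'.1])
    have e2 := congrArg signSum e1
    rw [signSum_map_twist, signSum_map_twist, hg.2, hg'.2, mul_one, mul_one] at e2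
    obtain rfl := sign_injective e2
    have := congrArg (List.map (twist w)) e1
    rw [map_twist_map_twist, map_twist_map_twist] at this
    rw [this]
  · intro l hl
    obtain ⟨e, g, u, hg, rfl⟩ := exists_split_of_mem_validSet hl
    rcases (mem_validSet_run_iff ha hx hy hg).1 hl with ⟨h1, -⟩ | ⟨w, h1, h2⟩
    · exact absurd h1 (par g hg)
    · refine ⟨(g.map (twist w), e :: w :: u), ⟨⟨by simpa using hg, ?_⟩, h2⟩, ?_⟩
      · rw [signSum_map_twist, h1, sq]
      · simp [map_twist_map_twist, -List.map_map]

end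

section

/-! ### The recursion -/

variable {α β : List ℝ}

lemma reduce_even {k : ℕ} {x a y : ℝ} {t : List ℝ} (hα : IsFlatVertexFold α) (hx : a < x)
    (hy : a < y) (hr : α.IsRotated (x :: (List.replicate (k + 1) a ++ y :: t)))
    (hβ : β.IsRotated ((x - a + y) :: t)) (hk : Even k) :
    IsFlatVertexFold β ∧ C α = (k + 2).choose ((k + 2) / 2) * C β := by
  have hα' := hα.of_isRotated hr
  have ha : 0 < a := hα'.pos a (by simp)
  have hcard := ncard_validSet_even (t := t) ha hx hy hk
  obtain ⟨hs, hne⟩ := isFlatVertexFold_iff.1 hα'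
  have hβ' : IsFlatVertexFold ((x - a + y) :: t) := by
    refine isFlatVertexFold_iff.2 ⟨?_, ?_⟩
    · have : (0 : ℝ) ≤ (k + 1 : ℕ) * a := by positivity
      simp only [List.sum_cons, List.sum_append, List.sum_replicate, nsmul_eq_mul] at hs ⊢
      linarith
    · rw [← Set.ncard_pos (finite_validSet _)] at hne ⊢
      rw [hcard] at hne
      exact Nat.pos_of_mul_pos_left hne
  refine ⟨hβ'.of_isRotated hβ.symm, ?_⟩
  rw [C_of_isRotated hα hr, ← C_of_isRotated hβ' hβ.symm, C_eq_ncard hα', C_eq_ncard hβ', hcard]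

lemma reduce_odd {k : ℕ} {x a y : ℝ} {t : List ℝ} (hα : IsFlatVertexFold α) (hx : a < x)
    (hy : a < y) (hr : α.IsRotated (x :: (List.replicate (k + 1) a ++ y :: t)))
    (hβ : β.IsRotated (x :: y :: t)) (hk : Odd k) :
    IsFlatVertexFold β ∧ C α = (k + 2).choose ((k + 1) / 2) * C β := by
  have hα' := hα.of_isRotated hr
  have ha : 0 < a := hα'.pos a (by simp)
  have hcard := ncard_validSet_odd (t := t) ha hx hy hk
  obtain ⟨hs, hne⟩ := isFlatVertexFold_iff.1 hα'
  have hβ' : IsFlatVertexFold (x :: y :: t) := by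
    refine isFlatVertexFold_iff.2 ⟨?_, ?_⟩
    · have : (0 : ℝ) ≤ (k + 1 : ℕ) * a := by positivity
      simp only [List.sum_cons, List.sum_append, List.sum_replicate, nsmul_eq_mul] at hs ⊢
      linarith
    · rw [← Set.ncard_pos (finite_validSet _)] at hne ⊢
      rw [hcard] at hne
      exact Nat.pos_of_mul_pos_left hne
  refine ⟨hβ'.of_isRotated hβ.symm, ?_⟩
  rw [C_of_isRotated hα hr, ← C_of_isRotated hβ' hβ.symm, C_eq_ncard hα', C_eq_ncard hβ', hcard]

lemma eq_of_recursionGives {c : ℕ} (h : RecursionGives α c) (hα : IsFlatVertexFold α) :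
    c = C α := by
  induction h with
  | all_equal n a hn => exact (C_replicate hn hα).symm
  | even_step k x a y t α β c hk hx hy hr hβ _ ih =>
    obtain ⟨h1, h2⟩ := reduce_even hα hx hy hr hβ hk
    rw [h2, ih h1]
  | odd_step k x a y t α β c hk hx hy hr hβ _ ih =>
    obtain ⟨h1, h2⟩ := reduce_odd hα hx hy hr hβ hk
    rw [h2, ih h1]

/-- Splitting off the elements equal to `a` at the start of a list. -/
lemma exists_replicate_append (a : ℝ) (l : List ℝ) :
    ∃ n r, l = List.replicate n a ++ r ∧ ∀ b s, r = b :: s → b ≠ a := by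
  induction l with
  | nil => exact ⟨0, [], rfl, by simp⟩
  | cons c l ih =>
    by_cases h : c = a
    · obtain ⟨n, r, rfl, hr⟩ := ih
      exact ⟨n + 1, r, by rw [h]; rfl, hr⟩
    · exact ⟨0, c :: l, rfl, by rintro b s e; rw [List.cons_eq_cons] at e; rw [← e.1]; exact h⟩

/-- In a cyclic sequence that is not constant, some run of minimal elements is preceded by a
larger element and, unless it exhausts the rest of the sequence, followed by a larger element. -/
lemma exists_min_run (h0 : α ≠ []) :
    (∃ a, α = List.replicate α.length a) ∨ ∃ k x a r, a < x ∧
      α.IsRotated (x :: (List.replicate (k + 1) a ++ r)) ∧ ∀ y t, r = y :: t → a < y := by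
  obtain ⟨a, ha, hmin⟩ : ∃ a ∈ α, ∀ b ∈ α, a ≤ b := by
    obtain ⟨a, ha, h⟩ := α.toFinset.exists_min_image id
      (by obtain ⟨b, hb⟩ := List.exists_mem_of_ne_nil α h0; exact ⟨b, by simpa using hb⟩)
    exact ⟨a, by simpa using ha, fun b hb => h b (by simpa using hb)⟩
  by_cases hc : ∀ b ∈ α, b = a
  · exact Or.inl ⟨a, List.eq_replicate_iff.2 ⟨rfl, hc⟩⟩
  · right
    push Not at hc
    obtain ⟨x₀, hx₀, hne⟩ := hc
    obtain ⟨u, v, rfl⟩ := List.append_of_mem ha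
    -- rotate so that the minimal element comes first, and read the rest backwards up to the last
    -- element that is not minimal
    have r1 : (u ++ a :: v).IsRotated (a :: (v ++ u)) := by
      have := List.isRotated_append (l := u) (l' := a :: v)
      simpa using this
    obtain ⟨n, r, hr, hr'⟩ := exists_replicate_append a (v ++ u).reverse
    have hr2 : v ++ u = r.reverse ++ List.replicate n a := by
      have := congrArg List.reverse hr
      simpa using this
    have mem : ∀ b ∈ r, b ∈ u ++ a :: v := by
      intro b hb
      have : b ∈ v ++ u := by rw [hr2]; simp [hb]
      simp only [List.mem_append, List.mem_cons] at this ⊢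
      tauto
    rcases r with _ | ⟨x, r⟩
    · exfalso
      have : x₀ ∈ a :: (v ++ u) := r1.perm.mem_iff.1 hx₀
      rw [hr2] at this
      simp at this
      tauto
    · obtain ⟨m, s, hs, hs'⟩ := exists_replicate_append a r.reverse
      have hx : a < x := lt_of_le_of_ne (hmin x (mem x (by simp))) (hr' x r rfl).symm
      refine ⟨n + m, x, a, s, hx, ?_, ?_⟩
      · refine r1.trans ?_
        rw [hr2, List.reverse_cons, hs]
        have := List.isRotated_append (l := a :: (List.replicate m a ++ s))
          (l' := x :: List.replicate n a)
        have e : List.replicate (n + m + 1) a = List.replicate n a ++ a :: List.replicate m a := by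
          rw [add_assoc, List.replicate_add, List.replicate_succ]
        rw [e]
        simpa using this
      · intro y t e
        have hy : y ∈ r := by
          have : y ∈ r.reverse := by rw [hs, e]; simp
          simpa using this
        exact lt_of_le_of_ne (hmin y (mem y (by simp [hy]))) (hs' y t e).symm

/-- The larger angle that precedes a run of minimal angles is not the only one, since the
alternating sum of the angles vanishes. -/
lemma run_ne_all {k : ℕ} {x a : ℝ} (hx : a < x)
    (h : IsFlatVertexFold (x :: List.replicate (k + 1) a)) : False := by
  obtain ⟨-, g, hg⟩ := isFlatVertexFold_iff.1 h
  have hc := isClosed_of_mem_validSet hg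
  have ha := hc.pos a (by simp)
  have h1 := hc.closed
  have h2 := hc.even
  have P := creasePos_run x a k [] (c := k + 1) le_rfl
  rw [List.append_nil] at P
  rw [List.length_cons, List.length_replicate] at h1 h2
  rw [h1, if_neg (by rw [Nat.even_add_one] at h2; exact h2)] at P
  linarith

lemma recursionGives_C (hα : IsFlatVertexFold α) : RecursionGives α (C α) := by
  induction hn : α.length using Nat.strong_induction_on generalizing α with
  | _ n ih =>
    rcases exists_min_run hα.ne_nil with ⟨a, ha⟩ | ⟨k, x, a, r, hx, hr, hy⟩
    · obtain ⟨m, hm⟩ := hα.even_length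
      have hm' : α.length = 2 * m := by omega
      have hm1 : 1 ≤ m := by have := List.length_pos_of_ne_nil hα.ne_nil; omega
      rw [hm'] at ha
      have hC := C_replicate (a := a) hm1 (ha ▸ hα)
      rw [ha, hC]
      exact RecursionGives.all_equal m a hm1
    · rcases r with _ | ⟨y, t⟩
      · rw [List.append_nil] at hr
        exact (run_ne_all hx (hα.of_isRotated hr)).elim
      · have hlen := hr.perm.length_eq
        simp at hlen
        rcases Nat.even_or_odd k with hk | hk
        · obtain ⟨h1, h2⟩ := reduce_even hα hx (hy y t rfl) hr (List.IsRotated.refl _) hk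
          rw [h2]
          exact RecursionGives.even_step k x a y t α _ _ hk hx (hy y t rfl) hr
            (List.IsRotated.refl _) (ih _ (by simp; omega) h1 rfl)
        · obtain ⟨h1, h2⟩ := reduce_odd hα hx (hy y t rfl) hr (List.IsRotated.refl _) hk
          rw [h2]
          exact RecursionGives.odd_step k x a y t α _ _ hk hx (hy y t rfl) hr
            (List.IsRotated.refl _) (ih _ (by simp; omega) h1 rfl)

end

end FlatFold

theorem theorem3 (α : List ℝ) (hα : FlatFold.IsFlatVertexFold α) :
    (∀ (k : ℕ) (x a y : ℝ) (t β : List ℝ), a < x → a < y →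
      α.IsRotated (x :: (List.replicate (k + 1) a ++ y :: t)) →
      (Even k → β.IsRotated ((x - a + y) :: t) →
        FlatFold.IsFlatVertexFold β ∧
          FlatFold.C α = (k + 2).choose ((k + 2) / 2) * FlatFold.C β) ∧
      (Odd k → β.IsRotated (x :: y :: t) →
        FlatFold.IsFlatVertexFold β ∧
          FlatFold.C α = (k + 2).choose ((k + 1) / 2) * FlatFold.C β)) ∧
    (∀ c : ℕ, FlatFold.RecursionGives α c ↔ c = FlatFold.C α) := by
  refine ⟨fun k x a y t β hx hy hr => ⟨fun hk hβ => FlatFold.reduce_even hα hx hy hr hβ hk,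
    fun hk hβ => FlatFold.reduce_odd hα hx hy hr hβ hk⟩, fun c => ⟨fun h =>
    FlatFold.eq_of_recursionGives h hα, ?_⟩⟩
  rintro rfl
  exact FlatFold.recursionGives_C hα
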